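/- Fix $0<\varepsilon<1/64$ and let $k_0\in\mathbb N$ be such that $2^{-k}<\varepsilon/4$ for all $k\ge k_0$. For $k\in\mathbb N$ let $B_\varepsilon\subset\mathbb R^2$ be the closed disc of radius $\varepsilon$ centred at the origin, $D_\varepsilon^k:=2^{-k}\mathbb Z^2\setminus B_\varepsilon$, and $E^k:=2^{-k}\mathbb Z_+\cup\{a_k^*\}\cup D_\varepsilon^k$ with $\mathbb Z_+=\{1,2,\dots\}$, where the point $a_k^*$ represents all points of $2^{-k}\mathbb Z^2\cap B_\varepsilon$ and is also identified with the origin of the half line. Let $G^k$ be the graph on $E^k$ with the following edges: $x,y\in D_\varepsilon^k$ are adjacent if $|x-y|=2^{-k}$ and the segment from $x$ to $y$ does not meet $B_\varepsilon$; $x,y\in 2^{-k}\mathbb Z_+\cup\{0\}$ (with $0=a_k^*$) are adjacent if $|x-y|=2^{-k}$; and $x\in D_\varepsilon^k$ is adjacent to $a_k^*$ if some $y\in 2^{-k}\mathbb Z^2\cap B_\varepsilon$ satisfies $|x-y|=2^{-k}$. Let $v_k(x)$ be the degree of $x$ in $G^k$, let $d_k(x,y)$ be $2^{-k}$ times the number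 of edges of a shortest path from $x$ to $y$ in $G^k$, and let $m_k$ be the measure on $E^k$ given by $$m_k(x)=\tfrac{2^{-2k}}4v_k(x)\ (x\in D_\varepsilon^k),\qquad m_k(x)=\tfrac{2^{-k}}2v_k(x)\ (x\in2^{-k}\mathbb Z_+),\qquad m_k(a_k^*)=\tfrac{2^{-k}}2+\tfrac{2^{-2k}}4\,(v_k(a_k^*)-1).$$ Let $X^k$ be the symmetric Markov process associated with the Dirichlet form on $L^2(E^k,m_k)$ with domain $L^2(E^k,m_k)$ and $$\mathcal E^k(f,f)=\frac18\sum_{\substack{x\leftrightarrow y\\ x,y\in D_\varepsilon^k\cup\{a_k^*\}}}(f(x)-f(y))^2+\frac{2^k}4\sum_{\substack{x\leftrightarrow y\\ x,y\in2^{-k}\mathbb Z_+\cup\{a_k^*\}}}(f(x)-f(y))^2,$$ the sums being over oriented edges $(x,y)$ of $G^k$, and let $p_k(t,x,y)$ be the transition density with respect to $m_k$ of its semigroup $(P_t^k)_{t\ge0}$, i.e. $p_k(t,x,y)=P_t^k\mathbf 1_{\{y\}}(x)/m_k(y)$. There exists $C_3>0$, independent of $k$, such that for all $k\ge k_0$,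 all $x,y\in E^k$ and all $t>0$, $$p_k(t,x,y)\le\begin{cases}C_3\left(\frac1t\vee\frac1{\sqrt t}\right)e^{-d_k(x,y)^2/(32t)}&\text{when }d_k(x,y)\le16\cdot2^kt,\\[2mm] C_3\left(\frac1t\vee\frac1{\sqrt t}\right)e^{-2^kd_k(x,y)/2}&\text{when }d_k(x,y)\ge16\cdot2^kt.\end{cases}$$ In particular, for every $T>0$ there exists $C_4>0$, independent of $k$, such that for all $k\ge k_0$ and all $(t,x,y)\in(0,T]\times E^k\times E^k$, $$p_k(t,x,y)\le\frac{C_4}t\left(e^{-d_k(x,y)^2/(32t)}+e^{-2^kd_k(x,y)/2}\right).$$ -/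

import Mathlib

open scoped ENNReal

noncomputable section

namespace VaryingDim

/-! ## The lattice with varying dimension -/

/-- The mesh size `2^{-k}`. -/
def mesh (k : ℕ) : ℝ := ((2 : ℝ) ^ k)⁻¹

/-- The point `2^{-k} z` of `2^{-k} ℤ² ⊆ ℝ²`, where `ℝ²` carries the Euclidean norm. -/
def pt (k : ℕ) (z : ℤ × ℤ) : EuclideanSpace ℝ (Fin 2) :=
  !₂[mesh k * (z.1 : ℝ), mesh k * (z.2 : ℝ)]

/-- The state space `E^k = 2^{-k} ℤ₊ ∪ {a*_k} ∪ D_ε^k`, with `ℤ₊ = {1, 2, …}`: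
`plane z` is the point `2^{-k} z` of `2^{-k} ℤ²`, which lies outside the closed disc of radius `ε`
around the origin; `darn` is the darning point `a*_k`, which stands for all points of
`2^{-k} ℤ²` in that disc and for the origin of the half line; `half n` is the point `2^{-k} n` of
the half line. -/
inductive Vertex (ε : ℝ) (k : ℕ) : Type
  | plane (z : {z : ℤ × ℤ // ε < ‖pt k z‖})
  | darn
  | half (n : ℕ+)

namespace Vertex

variable {ε : ℝ} {k : ℕ}

/-- Membership in `D_ε^k`. -/
def IsPlane : Vertex ε k → Prop
  | plane _ => True
  | darn => False
  | half _ => False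

/-- Membership in `2^{-k} ℤ₊`. -/
def IsHalf : Vertex ε k → Prop
  | plane _ => False
  | darn => False
  | half _ => True

/-- Adjacency in `G^k`. -/
def adj : Vertex ε k → Vertex ε k → Prop
  | plane z, plane w => dist (pt k z) (pt k w) = mesh k ∧
      Disjoint (segment ℝ (pt k z) (pt k w)) (Metric.closedBall 0 ε)
  | plane z, darn => ∃ w : ℤ × ℤ, ‖pt k w‖ ≤ ε ∧ dist (pt k z) (pt k w) = mesh k
  | darn, plane z => ∃ w : ℤ × ℤ, ‖pt k w‖ ≤ ε ∧ dist (pt k z) (pt k w) = mesh k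
  | darn, half n => mesh k * (n : ℝ) = mesh k
  | half n, darn => mesh k * (n : ℝ) = mesh k
  | half m, half n => |mesh k * (m : ℝ) - mesh k * (n : ℝ)| = mesh k
  | darn, darn => False
  | plane _, half _ => False
  | half _, plane _ => False

/-- All subsets of the discrete space `E^k` are measurable. -/
instance : MeasurableSpace (Vertex ε k) := ⊤

instance : DiscreteMeasurableSpace (Vertex ε k) := ⟨fun _ => trivial⟩

end Vertex

open Vertex

theorem mesh_pos (k : ℕ) : 0 < mesh k := by unfold mesh; positivity

/-- The graph `G^k` on `E^k`. -/
def graph (ε : ℝ) (k : ℕ) : SimpleGraph (Vertex ε k) where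
  Adj := adj
  symm := ⟨by
    rintro (z | _ | m) (w | _ | n) h
    · exact ⟨by rw [dist_comm]; exact h.1, by rw [segment_symm]; exact h.2⟩
    · exact h
    · exact h
    · exact h
    · exact h
    · exact h
    · exact h
    · exact h
    · simp only [adj] at h ⊢
      rw [abs_sub_comm]; exact h⟩
  loopless := ⟨by
    have := mesh_pos k
    rintro (z | _ | m) h
    · simp only [adj, dist_self] at h
      linarith [h.1]
    · exact h
    · simp only [adj, sub_self, abs_zero] at h
      linarith⟩

/-- The graph metric `d_k`: `2^{-k}` times the number of edges of a shortest path in `G^k`. -/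
def graphDist {ε : ℝ} {k : ℕ} (x y : Vertex ε k) : ℝ := mesh k * ((graph ε k).dist x y : ℝ)

/-- The degree `v_k(x)` of `x` in `G^k`. -/
def deg {ε : ℝ} {k : ℕ} (x : Vertex ε k) : ℕ := ((graph ε k).neighborSet x).ncard

/-- The mass `m_k(x)` of a point. -/
def mass {ε : ℝ} {k : ℕ} : Vertex ε k → ℝ
  | plane z => mesh k ^ 2 / 4 * (deg (plane z) : ℝ)
  | darn => mesh k / 2 + mesh k ^ 2 / 4 * ((deg (darn : Vertex ε k) : ℝ) - 1)
  | half n => mesh k / 2 * (deg (half n : Vertex ε k) : ℝ)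

/-- The reference measure `m_k` on `E^k`. -/
def refMeasure (ε : ℝ) (k : ℕ) : MeasureTheory.Measure (Vertex ε k) :=
  MeasureTheory.Measure.sum fun x => ENNReal.ofReal (mass x) • MeasureTheory.Measure.dirac x

/-- The oriented edges of `G^k` with both endpoints in `D_ε^k ∪ {a*_k}`. -/
def planeEdges (ε : ℝ) (k : ℕ) : Set (Vertex ε k × Vertex ε k) :=
  {e | (graph ε k).Adj e.1 e.2 ∧ ¬ e.1.IsHalf ∧ ¬ e.2.IsHalf}

/-- The oriented edges of `G^k` with both endpoints in `2^{-k} ℤ₊ ∪ {a*_k}`. -/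
def halfEdges (ε : ℝ) (k : ℕ) : Set (Vertex ε k × Vertex ε k) :=
  {e | (graph ε k).Adj e.1 e.2 ∧ ¬ e.1.IsPlane ∧ ¬ e.2.IsPlane}

/-- The (polarized) Dirichlet form `𝓔^k(f, g)`. -/
def dirichletForm {ε : ℝ} {k : ℕ} (f g : Vertex ε k → ℝ) : ℝ :=
  1 / 8 * ∑' e : planeEdges ε k, (f e.1.1 - f e.1.2) * (g e.1.1 - g e.1.2) +
    2 ^ k / 4 * ∑' e : halfEdges ε k, (f e.1.1 - f e.1.2) * (g e.1.1 - g e.1.2)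

/-- The Hilbert space `L²(E^k, m_k)`. -/
abbrev L2 (ε : ℝ) (k : ℕ) : Type := MeasureTheory.Lp ℝ 2 (refMeasure ε k)

/-! ## The Dirichlet form is a bounded form on `L²(E^k, m_k)` -/

section Bounded

variable {ε : ℝ} {k : ℕ}

theorem finite_lattice_ball (k : ℕ) (R : ℝ) : {z : ℤ × ℤ | ‖pt k z‖ ≤ R}.Finite := by
  have hm := mesh_pos k
  have hb : ∀ (z : ℤ × ℤ), ‖pt k z‖ ≤ R → ∀ c : ℤ, mesh k * |(c : ℝ)| ≤ ‖pt k z‖ →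
      c ∈ Set.Icc (-⌈R / mesh k⌉) ⌈R / mesh k⌉ := by
    intro z hz c hc
    have h1 : |(c : ℝ)| ≤ R / mesh k := by
      rw [le_div_iff₀ hm]; linarith
    have h2 : ((|c| : ℤ) : ℝ) ≤ (⌈R / mesh k⌉ : ℝ) := by
      push_cast; exact h1.trans (Int.le_ceil _)
    have h3 : |c| ≤ ⌈R / mesh k⌉ := by exact_mod_cast h2
    exact abs_le.mp h3
  refine ((Set.finite_Icc (-⌈R / mesh k⌉) ⌈R / mesh k⌉).prod
    (Set.finite_Icc (-⌈R / mesh k⌉) ⌈R / mesh k⌉)).subset ?_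
  intro z hz
  have h0 := PiLp.norm_apply_le (pt k z) 0
  have h1 := PiLp.norm_apply_le (pt k z) 1
  simp only [pt, PiLp.toLp_apply, Matrix.cons_val_zero, Matrix.cons_val_one, norm_mul,
    Real.norm_eq_abs, abs_of_pos hm] at h0 h1
  exact ⟨hb z hz z.1 h0, hb z hz z.2 h1⟩

theorem finite_plane_ball (R : ℝ) :
    {x : Vertex ε k | ∃ z, x = plane z ∧ ‖pt k z‖ ≤ R}.Finite := by
  have h := (finite_lattice_ball k R).preimage
    (f := fun z : {z : ℤ × ℤ // ε < ‖pt k z‖} => (z : ℤ × ℤ)) Subtype.val_injective.injOn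
  refine (h.image (fun z => (plane z : Vertex ε k))).subset ?_
  rintro x ⟨z, rfl, hz⟩
  exact ⟨z, hz, rfl⟩

theorem finite_half_ball (N : ℕ) : {x : Vertex ε k | ∃ n : ℕ+, x = half n ∧ (n : ℕ) ≤ N}.Finite := by
  have h := (Set.finite_Iic N).preimage (f := fun n : ℕ+ => (n : ℕ)) PNat.coe_injective.injOn
  refine (h.image (fun n => (half n : Vertex ε k))).subset ?_
  rintro x ⟨n, rfl, hn⟩
  exact ⟨n, hn, rfl⟩

theorem finite_neighborSet (x : Vertex ε k) : ((graph ε k).neighborSet x).Finite := by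
  have hm := mesh_pos k
  obtain ⟨R, N, h⟩ : ∃ (R : ℝ) (N : ℕ), ∀ y, (graph ε k).Adj x y →
      (∃ z, y = plane z ∧ ‖pt k z‖ ≤ R) ∨ y = darn ∨ ∃ n : ℕ+, y = half n ∧ (n : ℕ) ≤ N := by
    rcases x with z | _ | m
    · refine ⟨‖pt k z‖ + mesh k, 0, ?_⟩
      rintro (w | _ | n) h
      · refine Or.inl ⟨w, rfl, ?_⟩
        have h1 : dist (pt k z) (pt k w) = mesh k := h.1
        rw [dist_comm, dist_eq_norm] at h1
        have := norm_sub_norm_le (pt k w) (pt k z)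
        linarith
      · exact Or.inr (Or.inl rfl)
      · exact h.elim
    · refine ⟨ε + mesh k, 1, ?_⟩
      rintro (w | _ | n) h
      · obtain ⟨z, hz, h1⟩ := h
        refine Or.inl ⟨w, rfl, ?_⟩
        rw [dist_eq_norm] at h1
        have := norm_sub_norm_le (pt k w) (pt k z)
        linarith
      · exact Or.inr (Or.inl rfl)
      · refine Or.inr (Or.inr ⟨n, rfl, ?_⟩)
        have h1 : mesh k * (n : ℝ) = mesh k := h
        have h2 : ((n : ℕ) : ℝ) ≤ ((1 : ℕ) : ℝ) := by
          have := mul_left_cancel₀ hm.ne' (h1.trans (mul_one _).symm)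
          simp [this]
        exact_mod_cast h2
    · refine ⟨0, m + 1, ?_⟩
      rintro (w | _ | n) h
      · exact h.elim
      · exact Or.inr (Or.inl rfl)
      · refine Or.inr (Or.inr ⟨n, rfl, ?_⟩)
        have h1 : |mesh k * (m : ℝ) - mesh k * (n : ℝ)| = mesh k := h
        have h2 : ((n : ℕ) : ℝ) ≤ (((m : ℕ) + 1 : ℕ) : ℝ) := by
          have h3 := (abs_le.mp h1.le).1
          push_cast
          by_contra! hc
          nlinarith [mul_lt_mul_of_pos_left hc hm]
        exact_mod_cast h2
  refine (((finite_plane_ball (ε := ε) (k := k) R).union (Set.finite_singleton darn)).union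
    (finite_half_ball N)).subset ?_
  intro y hy
  rcases h y hy with h | h | h
  · exact Or.inl (Or.inl h)
  · exact Or.inl (Or.inr h)
  · exact Or.inr h

theorem plane_adj_outward (k : ℕ) (z : ℤ × ℤ) :
    ∃ w : ℤ × ℤ, dist (pt k z) (pt k w) = mesh k ∧
      ∀ p ∈ segment ℝ (pt k z) (pt k w), ‖pt k z‖ ≤ ‖p‖ := by
  have hm := mesh_pos k
  obtain ⟨s, hs, hs'⟩ : ∃ s : ℤ, (s : ℝ) ^ 2 = 1 ∧ 0 ≤ (s : ℝ) * (z.1 : ℝ) := by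
    rcases le_total 0 z.1 with h | h
    · refine ⟨1, by simp, ?_⟩
      have : (0 : ℝ) ≤ z.1 := by exact_mod_cast h
      simpa using this
    · refine ⟨-1, by simp, ?_⟩
      have : (z.1 : ℝ) ≤ 0 := by exact_mod_cast h
      simpa using this
  refine ⟨(z.1 + s, z.2), ?_, ?_⟩
  · rw [EuclideanSpace.dist_eq]
    simp only [pt, Fin.sum_univ_two, Real.dist_eq, PiLp.toLp_apply, Matrix.cons_val_zero,
      Matrix.cons_val_one, sq_abs, sub_self]
    push_cast
    have : (mesh k * (z.1 : ℝ) - mesh k * ((z.1 : ℝ) + s)) ^ 2 + 0 ^ 2 = mesh k ^ 2 := by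
      linear_combination (mesh k) ^ 2 * hs
    rw [this, Real.sqrt_sq hm.le]
  · rintro p ⟨a, b, ha, hb, hab, rfl⟩
    rw [EuclideanSpace.norm_eq, EuclideanSpace.norm_eq]
    apply Real.sqrt_le_sqrt
    simp only [pt, Fin.sum_univ_two, PiLp.add_apply, PiLp.smul_apply, PiLp.toLp_apply,
      Matrix.cons_val_zero, Matrix.cons_val_one, Real.norm_eq_abs, sq_abs, smul_eq_mul]
    push_cast
    have e1 : a * (mesh k * (z.1 : ℝ)) + b * (mesh k * ((z.1 : ℝ) + s))
        = mesh k * z.1 + b * mesh k * s := by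
      linear_combination mesh k * (z.1 : ℝ) * hab
    have e2 : a * (mesh k * (z.2 : ℝ)) + b * (mesh k * (z.2 : ℝ)) = mesh k * z.2 := by
      linear_combination mesh k * (z.2 : ℝ) * hab
    rw [e1, e2]
    have h1 : 0 ≤ 2 * mesh k ^ 2 * b * ((s : ℝ) * z.1) := by positivity
    nlinarith [sq_nonneg (b * mesh k * s)]

theorem deg_pos (x : Vertex ε k) : 0 < deg x := by
  have hm := mesh_pos k
  refine (Set.ncard_pos (finite_neighborSet x)).mpr ?_
  rcases x with z | _ | m
  · obtain ⟨w, hw, hs⟩ := plane_adj_outward k z.1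
    refine ⟨plane ⟨w, z.2.trans_le (hs _ (right_mem_segment ℝ _ _))⟩, hw, ?_⟩
    rw [Set.disjoint_left]
    intro p hp hp'
    have h1 := hs p hp
    have h2 := z.2
    rw [mem_closedBall_zero_iff] at hp'
    linarith
  · exact ⟨half 1, show mesh k * (((1 : ℕ+) : ℕ) : ℝ) = mesh k by simp⟩
  · refine ⟨half (m + 1), ?_⟩
    change |mesh k * (m : ℝ) - mesh k * (((m + 1 : ℕ+) : ℕ) : ℝ)| = mesh k
    push_cast
    rw [show mesh k * (m : ℝ) - mesh k * ((m : ℝ) + 1) = -mesh k by ring, abs_neg,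
      abs_of_pos hm]

theorem mesh_le_one (k : ℕ) : mesh k ≤ 1 := by
  unfold mesh
  exact inv_le_one_of_one_le₀ (one_le_pow₀ (by norm_num))

theorem deg_le_mass (x : Vertex ε k) : mesh k ^ 2 / 4 * (deg x : ℝ) ≤ mass x := by
  have hm := mesh_pos k
  have hm1 := mesh_le_one k
  have hd : (0 : ℝ) ≤ deg x := Nat.cast_nonneg _
  have h2 : mesh k ^ 2 ≤ mesh k := by nlinarith
  rcases x with z | _ | m
  · exact le_rfl
  · simp only [mass]; nlinarith
  · simp only [mass]
    have h3 : mesh k ^ 2 / 4 ≤ mesh k / 2 := by linarith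
    exact mul_le_mul_of_nonneg_right h3 hd

theorem mass_pos (x : Vertex ε k) : 0 < mass x := by
  have hm := mesh_pos k
  have hd : (0 : ℝ) < deg x := by exact_mod_cast deg_pos x
  exact lt_of_lt_of_le (by positivity) (deg_le_mass x)

theorem refMeasure_singleton (x : Vertex ε k) :
    refMeasure ε k {x} = ENNReal.ofReal (mass x) := by
  classical
  rw [refMeasure, MeasureTheory.Measure.sum_apply _ (MeasurableSet.of_discrete),
    tsum_eq_single x]
  · simp
  · intro y hy
    simp [hy]

theorem refMeasure_singleton_ne_top (x : Vertex ε k) : refMeasure ε k {x} ≠ ∞ := by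
  rw [refMeasure_singleton]; exact ENNReal.ofReal_ne_top

/-- As all points have positive mass, functions that agree almost everywhere are equal. -/
theorem eq_of_ae_eq {f g : Vertex ε k → ℝ} (h : f =ᵐ[refMeasure ε k] g) : f = g := by
  funext x
  by_contra hx
  have h0 : refMeasure ε k {y | ¬ f y = g y} = 0 := h
  have h1 : refMeasure ε k {x} = 0 :=
    MeasureTheory.measure_mono_null (Set.singleton_subset_iff.mpr hx) h0
  rw [refMeasure_singleton, ENNReal.ofReal_eq_zero] at h1
  exact absurd (mass_pos x) (not_lt.mpr h1)

theorem coe_add (f g : L2 ε k) : ((f + g : L2 ε k) : Vertex ε k → ℝ) = ⇑f + ⇑g :=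
  eq_of_ae_eq (MeasureTheory.Lp.coeFn_add f g)

theorem coe_smul (c : ℝ) (f : L2 ε k) : ((c • f : L2 ε k) : Vertex ε k → ℝ) = c • ⇑f :=
  eq_of_ae_eq (MeasureTheory.Lp.coeFn_smul c f)

theorem tsum_sq_mass (f : L2 ε k) :
    ∑' x, ENNReal.ofReal (f x ^ 2) * ENNReal.ofReal (mass x) = ENNReal.ofReal (‖f‖ ^ 2) := by
  have h1 : ‖f‖ ^ 2 = ∫ x, f x ^ 2 ∂(refMeasure ε k) := by
    rw [← real_inner_self_eq_norm_sq, MeasureTheory.L2.inner_def]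
    simp [sq]
  rw [h1, MeasureTheory.ofReal_integral_eq_lintegral_ofReal
    (MeasureTheory.Lp.memLp f).integrable_sq (Filter.Eventually.of_forall fun x => sq_nonneg _)]
  generalize (⇑f : Vertex ε k → ℝ) = u
  rw [refMeasure, MeasureTheory.lintegral_sum_measure]
  refine tsum_congr fun x => ?_
  rw [MeasureTheory.lintegral_smul_measure, MeasureTheory.lintegral_dirac, smul_eq_mul, mul_comm]

/-- All oriented edges of `G^k`. -/
def edges (ε : ℝ) (k : ℕ) : Set (Vertex ε k × Vertex ε k) := {e | (graph ε k).Adj e.1 e.2}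

theorem tsum_edges_le (f : L2 ε k) :
    ∑' e : edges ε k, ENNReal.ofReal (f e.1.1 ^ 2) ≤ ENNReal.ofReal (4 * 4 ^ k * ‖f‖ ^ 2) := by
  have h1 : ∑' e : edges ε k, ENNReal.ofReal (f e.1.1 ^ 2)
      = ∑' x : Vertex ε k, (deg x : ℝ≥0∞) * ENNReal.ofReal (f x ^ 2) := by
    rw [tsum_subtype (edges ε k) fun e => ENNReal.ofReal (f e.1 ^ 2), ENNReal.tsum_prod']
    refine tsum_congr fun x => ?_
    have : ∀ y, (edges ε k).indicator (fun e => ENNReal.ofReal (f e.1 ^ 2)) (x, y)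
        = ((graph ε k).neighborSet x).indicator (fun _ => ENNReal.ofReal (f x ^ 2)) y := by
      intro y
      by_cases h : (graph ε k).Adj x y
      · rw [Set.indicator_of_mem (show (x, y) ∈ edges ε k from h),
          Set.indicator_of_mem (show y ∈ (graph ε k).neighborSet x from h)]
      · rw [Set.indicator_of_notMem (show (x, y) ∉ edges ε k from h),
          Set.indicator_of_notMem (show y ∉ (graph ε k).neighborSet x from h)]
    simp_rw [this]
    rw [← tsum_subtype, ENNReal.tsum_set_const, deg,
      ← (finite_neighborSet x).cast_ncard_eq]
    simp
  rw [h1, show (4 : ℝ) * 4 ^ k * ‖f‖ ^ 2 = (4 * 4 ^ k) * ‖f‖ ^ 2 by ring,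
    ENNReal.ofReal_mul (by positivity), ← tsum_sq_mass, ← ENNReal.tsum_mul_left]
  refine ENNReal.tsum_le_tsum fun x => ?_
  rw [mul_left_comm, mul_comm]
  refine mul_le_mul_right ?_ _
  rw [← ENNReal.ofReal_mul (by positivity), ← ENNReal.ofReal_natCast]
  refine ENNReal.ofReal_le_ofReal ?_
  have h2 := deg_le_mass x
  have h3 : mesh k ^ 2 * 4 ^ k = 1 := by
    unfold mesh
    rw [inv_pow, ← pow_mul, mul_comm k 2, pow_mul]
    norm_num
  calc (deg x : ℝ) = 4 * 4 ^ k * (mesh k ^ 2 / 4 * deg x) := by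
        linear_combination -(deg x : ℝ) * h3
    _ ≤ _ := mul_le_mul_of_nonneg_left h2 (by positivity)

theorem summable_edges_fst (f : L2 ε k) : Summable fun e : edges ε k => f e.1.1 ^ 2 := by
  have h := (tsum_edges_le f).trans_lt ENNReal.ofReal_lt_top
  have := ENNReal.summable_toReal h.ne
  simpa [ENNReal.toReal_ofReal, sq_nonneg] using this

theorem tsum_edges_fst_le (f : L2 ε k) :
    ∑' e : edges ε k, f e.1.1 ^ 2 ≤ 4 * 4 ^ k * ‖f‖ ^ 2 := by
  have h := tsum_edges_le f
  rw [← ENNReal.ofReal_tsum_of_nonneg (fun _ => sq_nonneg _) (summable_edges_fst f)] at h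
  exact (ENNReal.ofReal_le_ofReal_iff (by positivity)).mp h

/-- Reversal of oriented edges. -/
def edgeSwap (ε : ℝ) (k : ℕ) : edges ε k ≃ edges ε k where
  toFun e := ⟨e.1.swap, (graph ε k).adj_symm e.2⟩
  invFun e := ⟨e.1.swap, (graph ε k).adj_symm e.2⟩
  left_inv _ := rfl
  right_inv _ := rfl

theorem summable_edges (f : L2 ε k) :
    (Summable fun e : edges ε k => (f e.1.1 - f e.1.2) ^ 2) ∧
      ∑' e : edges ε k, (f e.1.1 - f e.1.2) ^ 2 ≤ 16 * 4 ^ k * ‖f‖ ^ 2 := by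
  have s1 := summable_edges_fst f
  have s2 : Summable fun e : edges ε k => f e.1.2 ^ 2 :=
    (edgeSwap ε k).summable_iff.mp s1
  have t2 : ∑' e : edges ε k, f e.1.2 ^ 2 = ∑' e : edges ε k, f e.1.1 ^ 2 :=
    (edgeSwap ε k).tsum_eq fun e : edges ε k => f e.1.1 ^ 2
  have s3 := (s1.add s2).mul_left 2
  have hle : ∀ e : edges ε k, (f e.1.1 - f e.1.2) ^ 2 ≤ 2 * (f e.1.1 ^ 2 + f e.1.2 ^ 2) :=
    fun e => by nlinarith [sq_nonneg (f e.1.1 + f e.1.2)]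
  have s := Summable.of_nonneg_of_le (fun _ => sq_nonneg _) hle s3
  refine ⟨s, (s.tsum_le_tsum hle s3).trans ?_⟩
  rw [tsum_mul_left, s1.tsum_add s2, t2]
  linarith [tsum_edges_fst_le f]

theorem summable_subset {β : Type*} {S T : Set β} (hS : S ⊆ T) (F : β → ℝ) (hF : ∀ b, 0 ≤ F b)
    (K : ℝ) (h : (Summable fun e : T => F e) ∧ ∑' e : T, F e ≤ K) :
    (Summable fun e : S => F e) ∧ ∑' e : S, F e ≤ K := by
  have hi := Set.inclusion_injective hS
  have s' : Summable fun e : S => F e := h.1.comp_injective hi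
  exact ⟨s', (s'.tsum_le_tsum_of_inj (Set.inclusion hS) hi (fun _ _ => hF _)
    (fun _ => le_rfl) h.1).trans h.2⟩

theorem summable_subedges {S : Set (Vertex ε k × Vertex ε k)} (hS : S ⊆ edges ε k) (f : L2 ε k) :
    (Summable fun e : S => (f e.1.1 - f e.1.2) ^ 2) ∧
      ∑' e : S, (f e.1.1 - f e.1.2) ^ 2 ≤ 16 * 4 ^ k * ‖f‖ ^ 2 :=
  summable_subset hS (fun e => (f e.1 - f e.2) ^ 2) (fun _ => sq_nonneg _) _ (summable_edges f)

theorem summable_mul {S : Set (Vertex ε k × Vertex ε k)} (hS : S ⊆ edges ε k) (f g : L2 ε k) :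
    Summable fun e : S => (f e.1.1 - f e.1.2) * (g e.1.1 - g e.1.2) := by
  refine Summable.of_norm_bounded
    ((summable_subedges hS f).1.add (summable_subedges hS g).1) fun e => ?_
  rw [Real.norm_eq_abs, abs_le]
  constructor <;>
    nlinarith [sq_nonneg ((f e.1.1 - f e.1.2) + (g e.1.1 - g e.1.2)),
      sq_nonneg ((f e.1.1 - f e.1.2) - (g e.1.1 - g e.1.2)),
      sq_nonneg (f e.1.1 - f e.1.2), sq_nonneg (g e.1.1 - g e.1.2)]

theorem planeEdges_subset : planeEdges ε k ⊆ edges ε k := fun _ h => h.1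

theorem halfEdges_subset : halfEdges ε k ⊆ edges ε k := fun _ h => h.1

theorem dirichletForm_comm (f g : Vertex ε k → ℝ) : dirichletForm f g = dirichletForm g f := by
  simp only [dirichletForm, mul_comm]

theorem dirichletForm_add_left (f f' g : L2 ε k) :
    dirichletForm (⇑(f + f')) ⇑g = dirichletForm ⇑f ⇑g + dirichletForm ⇑f' ⇑g := by
  have key : ∀ {S : Set (Vertex ε k × Vertex ε k)}, S ⊆ edges ε k →
      ∑' e : S, ((f + f' : L2 ε k) e.1.1 - (f + f' : L2 ε k) e.1.2) * (g e.1.1 - g e.1.2) =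
        ∑' e : S, (f e.1.1 - f e.1.2) * (g e.1.1 - g e.1.2) +
          ∑' e : S, (f' e.1.1 - f' e.1.2) * (g e.1.1 - g e.1.2) := by
    intro S hS
    rw [← (summable_mul hS f g).tsum_add (summable_mul hS f' g), coe_add]
    refine tsum_congr fun e => ?_
    simp only [Pi.add_apply]
    ring
  simp only [dirichletForm]
  rw [key planeEdges_subset, key halfEdges_subset]
  ring

theorem dirichletForm_smul_left (c : ℝ) (f g : L2 ε k) :
    dirichletForm (⇑(c • f)) ⇑g = c * dirichletForm ⇑f ⇑g := by
  have key : ∀ S : Set (Vertex ε k × Vertex ε k),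
      ∑' e : S, ((c • f : L2 ε k) e.1.1 - (c • f : L2 ε k) e.1.2) * (g e.1.1 - g e.1.2) =
        c * ∑' e : S, (f e.1.1 - f e.1.2) * (g e.1.1 - g e.1.2) := by
    intro S
    rw [← tsum_mul_left, coe_smul]
    refine tsum_congr fun e => ?_
    simp only [Pi.smul_apply, smul_eq_mul]
    ring
  simp only [dirichletForm]
  rw [key, key]
  ring

/-- The Dirichlet form as a bilinear form on `L²(E^k, m_k)`. -/
def formBilin (ε : ℝ) (k : ℕ) : L2 ε k →ₗ[ℝ] L2 ε k →ₗ[ℝ] ℝ :=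
  LinearMap.mk₂ ℝ (fun f g => dirichletForm ⇑f ⇑g) dirichletForm_add_left
    dirichletForm_smul_left
    (fun f g g' => by
      rw [dirichletForm_comm, dirichletForm_add_left, dirichletForm_comm ⇑g,
        dirichletForm_comm ⇑g'])
    (fun c f g => by
      rw [dirichletForm_comm, dirichletForm_smul_left, dirichletForm_comm ⇑g, smul_eq_mul])

theorem formBilin_apply (f g : L2 ε k) : formBilin ε k f g = dirichletForm ⇑f ⇑g := rfl

theorem formBilin_self_nonneg (f : L2 ε k) : 0 ≤ formBilin ε k f f := by
  rw [formBilin_apply, dirichletForm]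
  have : ∀ S : Set (Vertex ε k × Vertex ε k),
      0 ≤ ∑' e : S, (f e.1.1 - f e.1.2) * (f e.1.1 - f e.1.2) :=
    fun S => tsum_nonneg fun _ => mul_self_nonneg _
  have h1 := this (planeEdges ε k)
  have h2 := this (halfEdges ε k)
  positivity

theorem formBilin_self_le (f : L2 ε k) :
    formBilin ε k f f ≤ ((2 + 4 * 2 ^ k) * 4 ^ k) * ‖f‖ ^ 2 := by
  rw [formBilin_apply, dirichletForm]
  simp only [← sq]
  have h1 := (summable_subedges planeEdges_subset f).2
  have h2 := (summable_subedges halfEdges_subset f).2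
  have h3 := mul_le_mul_of_nonneg_left h2 (show (0 : ℝ) ≤ 2 ^ k / 4 by positivity)
  nlinarith

theorem formBilin_bound (f g : L2 ε k) :
    ‖formBilin ε k f g‖ ≤ ((2 + 4 * 2 ^ k) * 4 ^ k) * ‖f‖ * ‖g‖ := by
  have hK : (0 : ℝ) ≤ (2 + 4 * 2 ^ k) * 4 ^ k := by positivity
  have h := LinearMap.BilinForm.apply_mul_apply_le_of_forall_zero_le (formBilin ε k)
    formBilin_self_nonneg f g
  rw [show formBilin ε k g f = formBilin ε k f g from dirichletForm_comm _ _] at h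
  refine abs_le_of_sq_le_sq ?_ (by positivity)
  calc (formBilin ε k f g) ^ 2 ≤ formBilin ε k f f * formBilin ε k g g := by rw [sq]; exact h
    _ ≤ (((2 + 4 * 2 ^ k) * 4 ^ k) * ‖f‖ ^ 2) * (((2 + 4 * 2 ^ k) * 4 ^ k) * ‖g‖ ^ 2) :=
        mul_le_mul (formBilin_self_le f) (formBilin_self_le g) (formBilin_self_nonneg g)
          (by positivity)
    _ = _ := by ring

end Bounded

/-! ## The semigroup and its transition density -/

/-- The Dirichlet form `𝓔^k` as a bounded bilinear form on its domain `L²(E^k, m_k)`. -/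
def form (ε : ℝ) (k : ℕ) : L2 ε k →L[ℝ] L2 ε k →L[ℝ] ℝ :=
  (formBilin ε k).mkContinuous₂ ((2 + 4 * 2 ^ k) * 4 ^ k) formBilin_bound

theorem form_apply {ε : ℝ} {k : ℕ} (f g : L2 ε k) : form ε k f g = dirichletForm ⇑f ⇑g := rfl

/-- The nonnegative self-adjoint operator `A_k` associated with `𝓔^k`. -/
def formOperator (ε : ℝ) (k : ℕ) : L2 ε k →L[ℝ] L2 ε k :=
  InnerProductSpace.continuousLinearMapOfBilin (𝕜 := ℝ) (form ε k)

/-- The defining relation `⟨A_k f, g⟩_{L²(m_k)} = 𝓔^k(f, g)`. -/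
theorem inner_formOperator {ε : ℝ} {k : ℕ} (f g : L2 ε k) :
    inner ℝ (formOperator ε k f) g = dirichletForm ⇑f ⇑g :=
  InnerProductSpace.continuousLinearMapOfBilin_apply (𝕜 := ℝ) (form ε k) f g

/-- The transition semigroup `P^k_t = exp(-t A_k)` of the walk `X^k`, that is, the symmetric
strongly continuous semigroup on `L²(E^k, m_k)` associated with the Dirichlet form `𝓔^k`. -/
def semigroup (ε : ℝ) (k : ℕ) (t : ℝ) : L2 ε k →L[ℝ] L2 ε k :=
  NormedSpace.exp ((-t) • formOperator ε k)

/-- The transition density `p_k(t, x, y)` of `X^k` with respect to `m_k`, that is,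
`(P^k_t 1_{y})(x) / m_k({y})`. -/
def heatKernel {ε : ℝ} {k : ℕ} (t : ℝ) (x y : Vertex ε k) : ℝ :=
  semigroup ε k t (MeasureTheory.indicatorConstLp 2 (MeasurableSet.of_discrete (s := {y}))
    (refMeasure_singleton_ne_top y) (1 : ℝ)) x / (refMeasure ε k).real {y}

end VaryingDim

end

open scoped ENNReal

namespace VaryingDim

open Vertex

variable {ε : ℝ} {k : ℕ}

/-! ## Geometry of the graph -/

/-! The conductances and masses are matched so that the total conductance at every vertex, the
darning point included, is `4^k` times its mass (`sum_cond`). Hence the form operator is `4^k (1 -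
Q)` with `Q` the transition operator of a discrete walk, and `P_t` is the Poisson average of the
powers of `Q` with parameter `4^k t`. Positivity and all weighted `L¹` estimates are read off this
series.

On-diagonal bound: Nash's method. For `f ≥ 0` of mass at most `1`, a one-dimensional Nash argument
on the half line bounds `f` there, in particular at the darning point. The excess of `f` over its
darning value vanishes on the disc, so it is a function on all of `ℤ²`, and a two-dimensional Nash
argument controls its `ℓ²` norm. Together (`norm_sq_le_of_dirichletForm_le`) they bound `min (u²,
u³)` by a multiple of the energy, where `u = ‖f‖²`. The resulting differential inequality along the
semigroup yields `1/t ∨ 1/√t`.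

Off-diagonal bound: if `φ ≥ 0` and `Q φ ≤ cosh β · φ`, then `P_t` increases the integral against `φ`
by at most `exp (4^k t (cosh β - 1))`. Let `φ` be such a function bounded by `4` at `x`, and `ψ` one
bounded by `4` at `y`, with `φ + ψ` exponentially large in the distance from `x` to `y` at every
vertex. Writing `p_t(x, y)` as the inner product of two half-time kernels, bounding one factor by
the on-diagonal estimate and the other by its weighted integral, gives decay `exp (4^k t (cosh β -
1) / 2 - β D)`, where `D` is about `7/20` of the number of edges between `x` and `y`
(`heatKernel_le_mul_exp`).

The functions `φ` and `ψ` are the `barrier`s: a minimum of an explicit `cosh` eigenfunction centred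
at the source, valid inside its component, and a function that grows from the darning point in the
direction of the target. The Gaussian and exponential regimes follow from `β = N / (8 · 4^k t)` and
`β = 2`, where `N` is the number of edges. The constant obtained depends neither on `k` nor on `ε`.
-/

/-- The Euclidean norm of a point of `ℤ²`. -/
noncomputable def rad (z : ℤ × ℤ) : ℝ := √((z.1 : ℝ) ^ 2 + (z.2 : ℝ) ^ 2)

theorem rad_nonneg (z : ℤ × ℤ) : 0 ≤ rad z := Real.sqrt_nonneg _

theorem rad_sq (z : ℤ × ℤ) : rad z ^ 2 = (z.1 : ℝ) ^ 2 + (z.2 : ℝ) ^ 2 :=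
  Real.sq_sqrt (by positivity)

theorem norm_pt (k : ℕ) (z : ℤ × ℤ) : ‖pt k z‖ = mesh k * rad z := by
  have hm := mesh_pos k
  rw [EuclideanSpace.norm_eq, rad, ← Real.sqrt_sq hm.le, ← Real.sqrt_mul (by positivity)]
  congr 1
  simp only [pt, Fin.sum_univ_two, PiLp.toLp_apply, Matrix.cons_val_zero, Matrix.cons_val_one,
    Real.norm_eq_abs, sq_abs]
  ring

theorem dist_pt (k : ℕ) (z w : ℤ × ℤ) : dist (pt k z) (pt k w) = mesh k * rad (z - w) := by
  rw [← norm_pt, dist_eq_norm]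
  congr 1
  ext i
  fin_cases i <;> simp [pt] <;> ring

/-- Two points of `ℤ²` are lattice neighbours if they are at Euclidean distance `1`. -/
def LatticeAdj (z w : ℤ × ℤ) : Prop := (z.1 - w.1) ^ 2 + (z.2 - w.2) ^ 2 = 1

theorem dist_pt_eq_mesh_iff {z w : ℤ × ℤ} :
    dist (pt k z) (pt k w) = mesh k ↔ LatticeAdj z w := by
  have hm := mesh_pos k
  rw [dist_pt, LatticeAdj, mul_eq_left₀ hm.ne', rad, Real.sqrt_eq_one]
  simp only [Prod.fst_sub, Prod.snd_sub]
  norm_cast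

theorem LatticeAdj.symm {z w : ℤ × ℤ} (h : LatticeAdj z w) : LatticeAdj w z := by
  unfold LatticeAdj at *; linarith

theorem latticeAdj_iff {z w : ℤ × ℤ} : LatticeAdj z w ↔
    w = (z.1 + 1, z.2) ∨ w = (z.1 - 1, z.2) ∨ w = (z.1, z.2 + 1) ∨ w = (z.1, z.2 - 1) := by
  obtain ⟨a, b⟩ := z
  obtain ⟨c, d⟩ := w
  simp only [LatticeAdj, Prod.mk.injEq]
  constructor
  · intro h
    have h1 : -1 ≤ a - c := by nlinarith [sq_nonneg (b - d), sq_nonneg (a - c + 1)]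
    have h2 : a - c ≤ 1 := by nlinarith [sq_nonneg (b - d), sq_nonneg (a - c - 1)]
    have h3 : -1 ≤ b - d := by nlinarith [sq_nonneg (a - c), sq_nonneg (b - d + 1)]
    have h4 : b - d ≤ 1 := by nlinarith [sq_nonneg (a - c), sq_nonneg (b - d - 1)]
    generalize hu : a - c = u at *
    generalize hv : b - d = v at *
    interval_cases u <;> interval_cases v <;> omega
  · rintro (⟨rfl, rfl⟩ | ⟨rfl, rfl⟩ | ⟨rfl, rfl⟩ | ⟨rfl, rfl⟩) <;> ring

/-- The vertex of `G^k` that represents a lattice point: the points of the disc are identified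
with the darning point. -/
noncomputable def proj (ε : ℝ) (k : ℕ) (z : ℤ × ℤ) : Vertex ε k :=
  if h : ε < ‖pt k z‖ then plane ⟨z, h⟩ else darn

theorem proj_of_lt {z : ℤ × ℤ} (h : ε < ‖pt k z‖) : proj ε k z = plane ⟨z, h⟩ := dif_pos h

theorem proj_of_le {z : ℤ × ℤ} (h : ‖pt k z‖ ≤ ε) : proj ε k z = darn := dif_neg h.not_gt

theorem proj_coe (z : {z : ℤ × ℤ // ε < ‖pt k z‖}) : proj ε k z.1 = plane z := proj_of_lt z.2

theorem proj_eq_plane_iff {z : ℤ × ℤ} {w : {z : ℤ × ℤ // ε < ‖pt k z‖}} :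
    proj ε k z = plane w ↔ z = w.1 := by
  constructor
  · intro h
    by_cases hz : ε < ‖pt k z‖
    · rw [proj_of_lt hz, plane.injEq] at h
      rw [← h]
    · rw [proj_of_le (not_lt.mp hz)] at h
      cases h
  · rintro rfl
    exact proj_coe w

theorem proj_eq_darn_iff {z : ℤ × ℤ} : proj ε k z = darn ↔ ‖pt k z‖ ≤ ε := by
  constructor
  · intro h
    by_contra hz
    rw [proj_of_lt (not_le.mp hz)] at h
    cases h
  · exact proj_of_le

theorem not_isHalf_proj (z : ℤ × ℤ) : ¬ (proj ε k z).IsHalf := by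
  by_cases hz : ε < ‖pt k z‖
  · rw [proj_of_lt hz]; exact id
  · rw [proj_of_le (not_lt.mp hz)]; exact id

/-- The squared norm along a unit lattice step `e` is `|z|² + 2 r (z · e) + r²` in mesh units. As `z
· e` is an integer, it is either nonnegative or at most `-1`, so this is monotone on `[0, 1]` and
the minimum is at an endpoint. Hence a lattice edge with both ends outside the disc never meets it.
-/
theorem le_norm_of_mem_segment {z w : ℤ × ℤ} (h : LatticeAdj z w) {p : EuclideanSpace ℝ (Fin 2)}
    (hp : p ∈ segment ℝ (pt k z) (pt k w)) : min ‖pt k z‖ ‖pt k w‖ ≤ ‖p‖ := by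
  obtain ⟨a, b, ha, hb, hab, rfl⟩ := hp
  obtain ⟨s, t, rfl, hst⟩ : ∃ s t : ℤ, w = (z.1 + s, z.2 + t) ∧ s ^ 2 + t ^ 2 = 1 := by
    refine ⟨w.1 - z.1, w.2 - z.2, by simp, ?_⟩
    unfold LatticeAdj at h; linarith
  have hb' : b = 1 - a := by linarith
  subst hb'
  have hst' : (s : ℝ) ^ 2 + (t : ℝ) ^ 2 = 1 := by exact_mod_cast hst
  have hm := mesh_pos k
  have hp : ‖a • pt k z + (1 - a) • pt k (z.1 + s, z.2 + t)‖ =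
      mesh k * √((z.1 + (1 - a) * s : ℝ) ^ 2 + (z.2 + (1 - a) * t : ℝ) ^ 2) := by
    rw [EuclideanSpace.norm_eq, ← Real.sqrt_sq hm.le, ← Real.sqrt_mul (by positivity)]
    congr 1
    simp only [pt, Fin.sum_univ_two, PiLp.add_apply, PiLp.smul_apply,
      Matrix.cons_val_zero, Matrix.cons_val_one, Real.norm_eq_abs, sq_abs, smul_eq_mul]
    push_cast
    ring
  rw [hp, norm_pt, norm_pt]
  rcases le_or_gt 0 (z.1 * s + z.2 * t) with h0 | h0
  · refine (min_le_left _ _).trans (mul_le_mul_of_nonneg_left (Real.sqrt_le_sqrt ?_) hm.le)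
    have h0' : (0 : ℝ) ≤ z.1 * s + z.2 * t := by exact_mod_cast h0
    nlinarith [mul_nonneg hb h0', mul_nonneg hb hb]
  · refine (min_le_right _ _).trans (mul_le_mul_of_nonneg_left (Real.sqrt_le_sqrt ?_) hm.le)
    have h0' : (z.1 * s + z.2 * t : ℝ) + 1 ≤ 0 := by exact_mod_cast h0
    push_cast
    have h1 := mul_nonneg ha (neg_nonneg.mpr h0')
    nlinarith [mul_nonneg ha ha]

/-- Since the segment condition is automatic, `G^k` near a plane vertex is just the image of `ℤ²`
under the collapse `proj`. -/
theorem adj_plane_iff {z : {z : ℤ × ℤ // ε < ‖pt k z‖}} {y : Vertex ε k} :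
    (graph ε k).Adj (plane z) y ↔ ∃ w, LatticeAdj z.1 w ∧ y = proj ε k w := by
  constructor
  · rcases y with w | _ | n
    · intro h
      exact ⟨w.1, dist_pt_eq_mesh_iff.mp h.1, (proj_coe w).symm⟩
    · rintro ⟨w, hw, h⟩
      exact ⟨w, dist_pt_eq_mesh_iff.mp h, (proj_of_le hw).symm⟩
    · exact False.elim
  · rintro ⟨w, hw, rfl⟩
    by_cases h : ε < ‖pt k w‖
    · rw [proj_of_lt h]
      refine ⟨dist_pt_eq_mesh_iff.mpr hw, Set.disjoint_left.mpr fun p hp hp' => ?_⟩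
      rw [mem_closedBall_zero_iff] at hp'
      exact (lt_min z.2 h).not_ge ((le_norm_of_mem_segment hw hp).trans hp')
    · rw [proj_of_le (not_lt.mp h)]
      exact ⟨w, not_lt.mp h, dist_pt_eq_mesh_iff.mpr hw⟩

/-- The points of the half line, with the darning point as origin. -/
def line (ε : ℝ) (k : ℕ) : ℕ → Vertex ε k
  | 0 => darn
  | n + 1 => half n.succPNat

theorem line_coe (n : ℕ+) : line ε k n = half n := by
  obtain ⟨m, hm⟩ : ∃ m : ℕ, (n : ℕ) = m + 1 := ⟨n.natPred, n.natPred_add_one.symm⟩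
  rw [hm, line]
  congr 1
  exact PNat.eq hm.symm

theorem line_injective : Function.Injective (line ε k) := by
  rintro (_ | m) (_ | n) h
  · rfl
  · cases h
  · cases h
  · simpa [line] using h

theorem not_isPlane_line (n : ℕ) : ¬ (line ε k n).IsPlane := by
  cases n <;> exact id

theorem adj_line_succ (n : ℕ) : (graph ε k).Adj (line ε k n) (line ε k (n + 1)) := by
  have hm := mesh_pos k
  cases n with
  | zero => exact show mesh k * (((1 : ℕ+) : ℕ) : ℝ) = mesh k by simp
  | succ n =>
    change |mesh k * ((n.succPNat : ℕ) : ℝ) - mesh k * (((n + 1).succPNat : ℕ) : ℝ)| = mesh k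
    rw [Nat.succPNat_coe, Nat.succPNat_coe]
    push_cast
    rw [show mesh k * ((n : ℝ) + 1) - mesh k * ((n : ℝ) + 1 + 1) = -mesh k by ring, abs_neg,
      abs_of_pos hm]

theorem adj_half_iff {n : ℕ+} {y : Vertex ε k} :
    (graph ε k).Adj (half n) y ↔ y = line ε k (n + 1) ∨ y = line ε k (n - 1) := by
  have hm := mesh_pos k
  constructor
  · rcases y with w | _ | m
    · exact False.elim
    · intro h
      have h1 : mesh k * (n : ℝ) = mesh k := h
      have h2 : ((n : ℕ) : ℝ) = 1 := by rwa [mul_eq_left₀ hm.ne'] at h1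
      have h3 : (n : ℕ) = 1 := by exact_mod_cast h2
      right
      rw [h3]; rfl
    · intro h
      have h1 : |mesh k * (n : ℝ) - mesh k * (m : ℝ)| = mesh k := h
      rw [← mul_sub, abs_mul, abs_of_pos hm, mul_eq_left₀ hm.ne'] at h1
      have h2 : |((n : ℕ) : ℤ) - ((m : ℕ) : ℤ)| = 1 := by exact_mod_cast h1
      rw [← line_coe m]
      rcases (abs_eq zero_le_one).mp h2 with h3 | h3
      · right; congr 1; omega
      · left; congr 1; omega
  · rw [← line_coe n]
    rintro (rfl | rfl)
    · exact adj_line_succ _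
    · have := adj_line_succ (ε := ε) (k := k) (n - 1 : ℕ)
      rw [Nat.sub_add_cancel n.pos] at this
      exact this.symm

theorem adj_darn_half_iff {n : ℕ+} : (graph ε k).Adj darn (half n) ↔ n = 1 := by
  rw [SimpleGraph.adj_comm, adj_half_iff]
  constructor
  · rintro (h | h)
    · cases h
    · have := line_injective (show line ε k 0 = _ from h)
      have h1 := n.pos
      exact PNat.eq (show (n : ℕ) = 1 by omega)
  · rintro rfl
    exact Or.inr rfl

/-! ## Upper bounds for the graph distance -/

/-- A lattice path through the disc collapses to a path that waits at the darning point, so no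
detour around the disc is needed and `ℓ¹` distances bound graph distances. -/
theorem edist_proj_le_one {z w : ℤ × ℤ} (h : LatticeAdj z w) :
    (graph ε k).edist (proj ε k z) (proj ε k w) ≤ 1 := by
  by_cases hz : ε < ‖pt k z‖
  · refine le_of_eq (SimpleGraph.edist_eq_one_iff_adj.mpr ?_)
    rw [proj_of_lt hz]
    exact adj_plane_iff.mpr ⟨w, h, rfl⟩
  by_cases hw : ε < ‖pt k w‖
  · refine le_of_eq (SimpleGraph.edist_eq_one_iff_adj.mpr ?_)
    rw [proj_of_lt hw]
    exact (adj_plane_iff.mpr ⟨z, h.symm, rfl⟩).symm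
  · rw [proj_of_le (not_lt.mp hz), proj_of_le (not_lt.mp hw), SimpleGraph.edist_self]
    exact zero_le_one

theorem edist_iterate_le {V : Type*} {G : SimpleGraph V} {f : ℕ → V}
    (h : ∀ i, G.edist (f i) (f (i + 1)) ≤ 1) (n : ℕ) : G.edist (f 0) (f n) ≤ n := by
  induction n with
  | zero => simp
  | succ n ih =>
    refine SimpleGraph.edist_triangle.trans ((add_le_add ih (h n)).trans ?_)
    push_cast
    exact le_rfl

theorem edist_le_natAbs {V : Type*} {G : SimpleGraph V} {f : ℤ → V}
    (h : ∀ i, G.edist (f i) (f (i + 1)) ≤ 1) (i j : ℤ) : G.edist (f i) (f j) ≤ (i - j).natAbs := by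
  have key : ∀ (i : ℤ) (n : ℕ), G.edist (f i) (f (i + n)) ≤ n := by
    intro i n
    have := edist_iterate_le (G := G) (f := fun n : ℕ => f (i + n)) (fun m => by
      have := h (i + m)
      push_cast
      rwa [add_assoc] at this) n
    simpa using this
  rcases le_total i j with hij | hij
  · have := key i (j - i).natAbs
    rw [show i + ((j - i).natAbs : ℤ) = j by omega] at this
    rwa [← Int.natAbs_neg, neg_sub]
  · have := key j (i - j).natAbs
    rw [show j + ((i - j).natAbs : ℤ) = i by omega] at this
    rwa [SimpleGraph.edist_comm]

/-- The `ℓ¹` distance on `ℤ²`. -/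
def gridDist (z w : ℤ × ℤ) : ℕ := (z.1 - w.1).natAbs + (z.2 - w.2).natAbs

theorem edist_proj_le (z w : ℤ × ℤ) :
    (graph ε k).edist (proj ε k z) (proj ε k w) ≤ gridDist z w := by
  refine (SimpleGraph.edist_triangle (v := proj ε k (w.1, z.2))).trans ?_
  rw [gridDist, Nat.cast_add]
  refine add_le_add ?_ ?_
  · refine edist_le_natAbs (f := fun i => proj ε k (i, z.2)) (fun i => edist_proj_le_one ?_)
      z.1 w.1
    exact latticeAdj_iff.mpr (Or.inl rfl)
  · refine edist_le_natAbs (f := fun i => proj ε k (w.1, i)) (fun i => edist_proj_le_one ?_)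
      z.2 w.2
    exact latticeAdj_iff.mpr (Or.inr (Or.inr (Or.inl rfl)))

theorem edist_line_le (m n : ℕ) :
    (graph ε k).edist (line ε k m) (line ε k n) ≤ ((m : ℤ) - n).natAbs := by
  refine edist_le_natAbs (f := fun i : ℤ => line ε k i.toNat) (fun i => ?_) m n
  rcases lt_or_ge i 0 with hi | hi
  · rw [Int.toNat_of_nonpos hi.le, Int.toNat_of_nonpos (by omega), SimpleGraph.edist_self]
    exact zero_le_one
  · obtain ⟨n, rfl⟩ := Int.eq_ofNat_of_zero_le hi
    exact (SimpleGraph.edist_eq_one_iff_adj.mpr (adj_line_succ n)).le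

theorem reachable_darn (hε : 0 < ε) (x : Vertex ε k) : (graph ε k).Reachable darn x := by
  refine SimpleGraph.reachable_of_edist_ne_top ?_
  rcases x with z | _ | n
  · have h0 : proj ε k (0, 0) = darn := proj_of_le (by rw [norm_pt]; simp [rad, hε.le])
    rw [← h0, ← proj_coe z]
    exact ((edist_proj_le _ _).trans_lt (ENat.natCast_lt_top _)).ne
  · simp
  · rw [← line_coe n]
    exact ((edist_line_le 0 n).trans_lt (ENat.natCast_lt_top _)).ne

theorem graph_connected (hε : 0 < ε) (k : ℕ) : (graph ε k).Connected :=
  haveI : Nonempty (Vertex ε k) := ⟨darn⟩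
  ⟨fun x y => (reachable_darn hε x).symm.trans (reachable_darn hε y)⟩

theorem dist_le_of_edist_le {V : Type*} {G : SimpleGraph V} {x y : V} {n : ℕ}
    (h : G.edist x y ≤ n) : G.dist x y ≤ n :=
  ENat.toNat_le_of_le_natCast h

theorem dist_proj_le (z w : ℤ × ℤ) :
    (graph ε k).dist (proj ε k z) (proj ε k w) ≤ gridDist z w :=
  dist_le_of_edist_le (edist_proj_le z w)

theorem dist_line_le (m n : ℕ) :
    (graph ε k).dist (line ε k m) (line ε k n) ≤ ((m : ℤ) - n).natAbs :=
  dist_le_of_edist_le (edist_line_le m n)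

/-- Take `s * a` rounded towards zero: rounding inwards keeps a radially shrunk point inside the
disc and costs at most one step per coordinate. -/
theorem exists_int_between (a : ℤ) {s : ℝ} (hs₀ : 0 ≤ s) (hs₁ : s ≤ 1) :
    ∃ b : ℤ, (b : ℝ) ^ 2 ≤ s ^ 2 * (a : ℝ) ^ 2 ∧ |(a : ℝ) - b| ≤ (1 - s) * |(a : ℝ)| + 1 := by
  have key : ∀ n : ℕ, ∃ b : ℤ, (b : ℝ) ^ 2 ≤ s ^ 2 * (n : ℝ) ^ 2 ∧
      |(n : ℝ) - b| ≤ (1 - s) * n + 1 := by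
    intro n
    have h0 : 0 ≤ s * n := by positivity
    have h1 : (⌊s * n⌋₊ : ℝ) ≤ s * n := Nat.floor_le h0
    have h2 := Nat.lt_floor_add_one (s * n)
    have h3 : s * n ≤ n := mul_le_of_le_one_left (Nat.cast_nonneg n) hs₁
    refine ⟨(⌊s * n⌋₊ : ℤ), ?_, ?_⟩
    · rw [← mul_pow, Int.cast_natCast]
      exact pow_le_pow_left₀ (Nat.cast_nonneg _) h1 2
    · rw [Int.cast_natCast, abs_of_nonneg (by linarith)]
      linarith
  obtain ⟨n, rfl | rfl⟩ := Int.eq_nat_or_neg a <;> obtain ⟨b, h1, h2⟩ := key n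
  · exact ⟨b, by simpa using h1, by simpa using h2⟩
  · refine ⟨-b, by simpa using h1, ?_⟩
    push_cast
    rw [abs_neg, Nat.abs_cast, neg_sub_neg, abs_sub_comm]
    exact h2

theorem abs_add_abs_le_sqrt_two_mul_rad (z : ℤ × ℤ) :
    |(z.1 : ℝ)| + |(z.2 : ℝ)| ≤ √2 * rad z := by
  rw [rad, ← Real.sqrt_mul (by norm_num)]
  refine Real.le_sqrt_of_sq_le ?_
  nlinarith [sq_nonneg (|(z.1 : ℝ)| - |(z.2 : ℝ)|), sq_abs (z.1 : ℝ), sq_abs (z.2 : ℝ)]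

theorem gridDist_cast (z w : ℤ × ℤ) :
    (gridDist z w : ℝ) = |(z.1 : ℝ) - w.1| + |(z.2 : ℝ) - w.2| := by
  simp [gridDist, Nat.cast_natAbs]

theorem lt_rad (z : {z : ℤ × ℤ // ε < ‖pt k z‖}) : ε / mesh k < rad z.1 := by
  have h := z.2
  rw [norm_pt] at h
  rwa [div_lt_iff₀ (mesh_pos k), mul_comm]

/-- Shrink `z` radially onto the disc and round both coordinates inwards. The factor `√2` compares
`ℓ¹` with Euclidean length; the `2` pays for the rounding. -/
theorem dist_plane_darn_le (hε : 0 < ε) (z : {z : ℤ × ℤ // ε < ‖pt k z‖}) :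
    ((graph ε k).dist (plane z) darn : ℝ) ≤ √2 * (rad z.1 - ε / mesh k) + 2 := by
  have hm := mesh_pos k
  have hR : 0 < ε / mesh k := by positivity
  have hz := lt_rad z
  set R := ε / mesh k with hRdef
  have hr : 0 < rad z.1 := hR.trans hz
  have hs₁ : R / rad z.1 ≤ 1 := (div_le_one hr).mpr hz.le
  have hs₀ : 0 ≤ R / rad z.1 := by positivity
  obtain ⟨b, hb, hb'⟩ := exists_int_between z.1.1 hs₀ hs₁
  obtain ⟨c, hc, hc'⟩ := exists_int_between z.1.2 hs₀ hs₁
  have hbc : ‖pt k (b, c)‖ ≤ ε := by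
    rw [norm_pt, ← le_div_iff₀' hm, rad]
    refine Real.sqrt_le_iff.mpr ⟨hR.le, ?_⟩
    calc (b : ℝ) ^ 2 + (c : ℝ) ^ 2
        ≤ (R / rad z.1) ^ 2 * (z.1.1 : ℝ) ^ 2 + (R / rad z.1) ^ 2 * (z.1.2 : ℝ) ^ 2 :=
          add_le_add hb hc
      _ = (R / rad z.1) ^ 2 * rad z.1 ^ 2 := by rw [rad_sq]; ring
      _ = R ^ 2 := by rw [← mul_pow, div_mul_cancel₀ _ hr.ne']
  rw [← proj_coe z, ← proj_of_le hbc]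
  refine (Nat.cast_le.mpr (dist_proj_le z.1 (b, c))).trans ?_
  rw [gridDist_cast]
  have h1 := abs_add_abs_le_sqrt_two_mul_rad z.1
  have h2 : (1 - R / rad z.1) * (√2 * rad z.1) = √2 * (rad z.1 - R) := by
    field_simp
  have h3 := mul_le_mul_of_nonneg_left h1 (sub_nonneg.mpr hs₁)
  simp only
  nlinarith

/-! ## Conductances and the generator -/

/-- The neighbours of a vertex. -/
noncomputable def nbrs (x : Vertex ε k) : Finset (Vertex ε k) := (finite_neighborSet x).toFinset

theorem mem_nbrs {x y : Vertex ε k} : y ∈ nbrs x ↔ (graph ε k).Adj x y := by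
  simp [nbrs]

theorem card_nbrs (x : Vertex ε k) : (nbrs x).card = deg x :=
  (Set.ncard_eq_toFinset_card _ _).symm

/-- The conductance of the edge between two vertices. -/
noncomputable def cond (x y : Vertex ε k) : ℝ :=
  (planeEdges ε k).indicator (fun _ => 1 / 4) (x, y) +
    (halfEdges ε k).indicator (fun _ => 2 ^ k / 2) (x, y)

theorem cond_nonneg (x y : Vertex ε k) : 0 ≤ cond x y :=
  add_nonneg (Set.indicator_nonneg (fun _ _ => by positivity) _)
    (Set.indicator_nonneg (fun _ _ => by positivity) _)

theorem swap_mem_planeEdges {e : Vertex ε k × Vertex ε k} :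
    e.swap ∈ planeEdges ε k ↔ e ∈ planeEdges ε k :=
  ⟨fun h => ⟨h.1.symm, h.2.2, h.2.1⟩, fun h => ⟨h.1.symm, h.2.2, h.2.1⟩⟩

theorem swap_mem_halfEdges {e : Vertex ε k × Vertex ε k} :
    e.swap ∈ halfEdges ε k ↔ e ∈ halfEdges ε k :=
  ⟨fun h => ⟨h.1.symm, h.2.2, h.2.1⟩, fun h => ⟨h.1.symm, h.2.2, h.2.1⟩⟩

theorem cond_comm (x y : Vertex ε k) : cond x y = cond y x := by
  have h1 := swap_mem_planeEdges (e := (x, y))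
  have h2 := swap_mem_halfEdges (e := (x, y))
  simp only [Prod.swap_prod_mk] at h1 h2
  classical
  simp only [cond, Set.indicator_apply, h1, h2]

theorem cond_of_not_adj {x y : Vertex ε k} (h : ¬ (graph ε k).Adj x y) : cond x y = 0 := by
  rw [cond, Set.indicator_of_notMem (fun h' => h h'.1), Set.indicator_of_notMem (fun h' => h h'.1),
    add_zero]

theorem cond_plane {z : {z : ℤ × ℤ // ε < ‖pt k z‖}} {y : Vertex ε k}
    (h : (graph ε k).Adj (plane z) y) : cond (plane z) y = 1 / 4 := by
  have hy : ¬ y.IsHalf := by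
    obtain ⟨w, -, rfl⟩ := adj_plane_iff.mp h
    exact not_isHalf_proj w
  rw [cond, Set.indicator_of_mem (show _ ∈ planeEdges ε k from ⟨h, id, hy⟩),
    Set.indicator_of_notMem (fun h' => h'.2.1 trivial), add_zero]

theorem cond_half {n : ℕ+} {y : Vertex ε k} (h : (graph ε k).Adj (half n) y) :
    cond (half n) y = 2 ^ k / 2 := by
  have hy : ¬ y.IsPlane := by
    rcases adj_half_iff.mp h with rfl | rfl <;> exact not_isPlane_line _
  rw [cond, Set.indicator_of_notMem (fun h' => h'.2.1 trivial),
    Set.indicator_of_mem (show _ ∈ halfEdges ε k from ⟨h, id, hy⟩), zero_add]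

theorem half_one_mem_nbrs_darn : (half 1 : Vertex ε k) ∈ nbrs darn :=
  mem_nbrs.mpr (adj_darn_half_iff.mpr rfl)

theorem mesh_mul_two_pow (k : ℕ) : mesh k * 2 ^ k = 1 := by
  unfold mesh; exact inv_mul_cancel₀ (by positivity)

theorem mesh_sq_mul_four_pow (k : ℕ) : mesh k ^ 2 * 4 ^ k = 1 := by
  rw [show (4 : ℝ) ^ k = (2 ^ k) ^ 2 by rw [← pow_mul, mul_comm, pow_mul]; norm_num, ← mul_pow,
    mesh_mul_two_pow, one_pow]

/-- The walk leaves every vertex at the same rate `4^k`. At the darning point exactly one edge leads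
into the half line, which is what the `deg - 1` in its mass accounts for. -/
theorem sum_cond (x : Vertex ε k) : ∑ y ∈ nbrs x, cond x y = 4 ^ k * mass x := by
  have h4 := mesh_sq_mul_four_pow k
  have h2 := mesh_mul_two_pow k
  have h3 : mesh k * 4 ^ k = 2 ^ k := by
    rw [show (4 : ℝ) ^ k = 2 ^ k * 2 ^ k by rw [← mul_pow]; norm_num, ← mul_assoc, h2, one_mul]
  rcases x with z | _ | n
  · rw [Finset.sum_congr rfl fun y hy => cond_plane (mem_nbrs.mp hy), Finset.sum_const, card_nbrs,
      nsmul_eq_mul, mass]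
    linear_combination (-(deg (plane z) : ℝ) / 4) * h4
  · classical
    rw [← Finset.add_sum_erase _ _ half_one_mem_nbrs_darn, cond_comm,
      cond_half (adj_darn_half_iff.mpr rfl).symm]
    have : ∀ y ∈ (nbrs (darn : Vertex ε k)).erase (half 1), cond darn y = 1 / 4 := by
      intro y hy
      obtain ⟨hy1, hy2⟩ := Finset.mem_erase.mp hy
      rw [mem_nbrs] at hy2
      rcases y with w | _ | n
      · rw [cond_comm, cond_plane hy2.symm]
      · exact hy2.elim
      · exact absurd (congrArg half (adj_darn_half_iff.mp hy2)) hy1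
    rw [Finset.sum_congr rfl this, Finset.sum_const, Finset.card_erase_of_mem
      half_one_mem_nbrs_darn, card_nbrs, nsmul_eq_mul, Nat.cast_sub (deg_pos darn), mass]
    push_cast
    linear_combination (-((deg (darn : Vertex ε k) : ℝ) - 1) / 4) * h4 - h3 / 2
  · rw [Finset.sum_congr rfl fun y hy => cond_half (mem_nbrs.mp hy), Finset.sum_const, card_nbrs,
      nsmul_eq_mul, mass]
    linear_combination (-(deg (half n : Vertex ε k) : ℝ) / 2) * h3

/-- The element `1_{y}` of `L²(E^k, m_k)`. -/
noncomputable def pointL2 (y : Vertex ε k) : L2 ε k :=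
  MeasureTheory.indicatorConstLp 2 (MeasurableSet.of_discrete (s := {y}))
    (refMeasure_singleton_ne_top y) (1 : ℝ)

theorem coe_pointL2 (y : Vertex ε k) : ⇑(pointL2 y) = Set.indicator {y} fun _ => (1 : ℝ) :=
  eq_of_ae_eq MeasureTheory.indicatorConstLp_coeFn

theorem refMeasure_real_singleton (x : Vertex ε k) : (refMeasure ε k).real {x} = mass x := by
  rw [MeasureTheory.measureReal_def, refMeasure_singleton, ENNReal.toReal_ofReal (mass_pos x).le]

theorem inner_pointL2 (f : L2 ε k) (x : Vertex ε k) :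
    inner ℝ (pointL2 x) f = mass x * f x := by
  rw [pointL2, MeasureTheory.L2.inner_indicatorConstLp_one, MeasureTheory.integral_singleton,
    refMeasure_real_singleton, smul_eq_mul]

/-- Each edge at `x` is counted in both orientations with equal contributions. The resulting factor
`2` turns the prefactors `1/8` and `2^k/4` of the form into the conductances `1/4` and `2^k/2`. -/
theorem tsum_edges_indicator {S : Set (Vertex ε k × Vertex ε k)} (hS : S ⊆ edges ε k)
    (hsymm : ∀ e, e.swap ∈ S ↔ e ∈ S) (f : Vertex ε k → ℝ) (x : Vertex ε k) :
    ∑' e : S, (f e.1.1 - f e.1.2) *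
        (Set.indicator {x} (fun _ => (1 : ℝ)) e.1.1 - Set.indicator {x} (fun _ => (1 : ℝ)) e.1.2) =
      2 * ∑ y ∈ nbrs x, S.indicator (fun _ => (1 : ℝ)) (x, y) * (f x - f y) := by
  classical
  set F : Vertex ε k × Vertex ε k → ℝ := fun e =>
    S.indicator (fun _ => (1 : ℝ)) e * ((f e.1 - f e.2) *
      Set.indicator {x} (fun _ => (1 : ℝ)) e.1) with hF
  have hsum : HasSum F (∑ y ∈ nbrs x, S.indicator (fun _ => (1 : ℝ)) (x, y) * (f x - f y)) := by
    have : HasSum F (∑ e ∈ {x} ×ˢ nbrs x, F e) := by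
      refine hasSum_sum_of_ne_finset_zero fun e he => ?_
      rw [Finset.mem_product, Finset.mem_singleton, not_and] at he
      by_cases h1 : e.1 = x
      · have : e ∉ S := fun h => he h1 (mem_nbrs.mpr (h1 ▸ hS h))
        simp [hF, this]
      · simp [hF, h1]
    rw [Finset.sum_product, Finset.sum_singleton] at this
    simpa [hF] using this
  have hsum' : HasSum (fun e : Vertex ε k × Vertex ε k => F e.swap) _ := (Equiv.prodComm _ _).hasSum_iff.mpr hsum
  rw [tsum_subtype S fun e : Vertex ε k × Vertex ε k => (f e.1 - f e.2) *
    (Set.indicator {x} (fun _ => (1 : ℝ)) e.1 - Set.indicator {x} (fun _ => (1 : ℝ)) e.2), two_mul]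
  refine HasSum.tsum_eq ?_
  convert hsum.add hsum' using 1
  funext e
  by_cases h : e ∈ S
  · have h' : e.swap ∈ S := (hsymm e).mpr h
    simp only [hF, Set.indicator_of_mem h, Set.indicator_of_mem h', Prod.fst_swap, Prod.snd_swap]
    ring
  · have h' : e.swap ∉ S := fun h' => h ((hsymm e).mp h')
    simp only [hF, Set.indicator_of_notMem h, Set.indicator_of_notMem h', zero_mul, add_zero]

theorem dirichletForm_indicator (f : Vertex ε k → ℝ) (x : Vertex ε k) :
    dirichletForm f (Set.indicator {x} fun _ => (1 : ℝ)) =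
      ∑ y ∈ nbrs x, cond x y * (f x - f y) := by
  rw [dirichletForm, tsum_edges_indicator planeEdges_subset fun _ => swap_mem_planeEdges,
    tsum_edges_indicator halfEdges_subset fun _ => swap_mem_halfEdges, ← mul_assoc, ← mul_assoc,
    Finset.mul_sum, Finset.mul_sum, ← Finset.sum_add_distrib]
  refine Finset.sum_congr rfl fun y _ => ?_
  rw [cond]
  by_cases h1 : (x, y) ∈ planeEdges ε k <;> by_cases h2 : (x, y) ∈ halfEdges ε k <;>
    simp only [h1, h2, Set.indicator_of_mem, Set.indicator_of_notMem, not_false_eq_true] <;> ring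

theorem mass_mul_formOperator (f : L2 ε k) (x : Vertex ε k) :
    mass x * formOperator ε k f x = ∑ y ∈ nbrs x, cond x y * (f x - f y) := by
  rw [← inner_pointL2, real_inner_comm, inner_formOperator, coe_pointL2, dirichletForm_indicator]

theorem coe_sub (f g : L2 ε k) : ((f - g : L2 ε k) : Vertex ε k → ℝ) = ⇑f - ⇑g :=
  eq_of_ae_eq (MeasureTheory.Lp.coeFn_sub f g)

/-- The transition operator of the discrete-time walk, so that the generator is `4^k (1 - Q)`. -/
noncomputable def stepOperator (ε : ℝ) (k : ℕ) : L2 ε k →L[ℝ] L2 ε k :=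
  1 - ((4 : ℝ) ^ k)⁻¹ • formOperator ε k

theorem four_pow_mul_mass_mul_stepOperator (f : L2 ε k) (x : Vertex ε k) :
    4 ^ k * mass x * stepOperator ε k f x = ∑ y ∈ nbrs x, cond x y * f y := by
  have h : stepOperator ε k f x = f x - ((4 : ℝ) ^ k)⁻¹ * formOperator ε k f x := by
    rw [stepOperator, sub_apply, coe_sub]
    simp [coe_smul]
  have h1 := mass_mul_formOperator f x
  simp only [mul_sub, Finset.sum_sub_distrib, ← Finset.sum_mul, sum_cond] at h1
  rw [h]
  have h4 : (4 : ℝ) ^ k * ((4 : ℝ) ^ k)⁻¹ = 1 := mul_inv_cancel₀ (by positivity)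
  linear_combination -h1 - mass x * formOperator ε k f x * h4

theorem semigroup_eq (t : ℝ) : semigroup ε k t =
    Real.exp (-(4 ^ k * t)) • NormedSpace.exp ((4 ^ k * t) • stepOperator ε k) := by
  have h4 : (4 : ℝ) ^ k * ((4 : ℝ) ^ k)⁻¹ = 1 := mul_inv_cancel₀ (by positivity)
  have h : (-t) • formOperator ε k = algebraMap ℝ (L2 ε k →L[ℝ] L2 ε k) (-(4 ^ k * t)) +
      (4 ^ k * t) • stepOperator ε k := by
    rw [stepOperator, smul_sub, smul_smul, Algebra.algebraMap_eq_smul_one,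
      show (4 ^ k * t) * ((4 : ℝ) ^ k)⁻¹ = t by rw [mul_right_comm, h4, one_mul], neg_smul,
      neg_smul]
    abel
  let _ : NormedAlgebra ℚ (L2 ε k →L[ℝ] L2 ε k) := NormedAlgebra.restrictScalars ℚ ℝ _
  rw [semigroup, h, NormedSpace.exp_add_of_commute (Algebra.commutes _ _),
    ← NormedSpace.algebraMap_exp_comm, ← Real.exp_eq_exp_ℝ, Algebra.algebraMap_eq_smul_one,
    smul_mul_assoc, one_mul]

/-! ## Propagation of weights by the semigroup -/

/-- Functions `φ ≥ 0` with `Q φ ≤ θ φ`, where `Q` is the transition operator of the discrete-time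
walk. -/
structure IsSuper (θ : ℝ) (φ : Vertex ε k → ℝ) : Prop where
  nonneg : ∀ x, 0 ≤ φ x
  sum_le : ∀ x, ∑ y ∈ nbrs x, cond x y * φ y ≤ θ * (∑ y ∈ nbrs x, cond x y) * φ x

/-- The integral of `f φ` against the reference measure. -/
noncomputable def weight (φ f : Vertex ε k → ℝ) : ℝ≥0∞ :=
  ∑' x, ENNReal.ofReal (f x) * ENNReal.ofReal (φ x * mass x)

theorem tsum_cond_mul {g : Vertex ε k → ℝ} (hg : ∀ x, 0 ≤ g x) (x : Vertex ε k) :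
    ∑' y, ENNReal.ofReal (cond x y) * ENNReal.ofReal (g y) =
      ENNReal.ofReal (∑ y ∈ nbrs x, cond x y * g y) := by
  rw [ENNReal.ofReal_sum_of_nonneg fun y _ => mul_nonneg (cond_nonneg x y) (hg y),
    tsum_eq_sum (s := nbrs x)]
  · exact Finset.sum_congr rfl fun y _ => (ENNReal.ofReal_mul (cond_nonneg x y)).symm
  · intro y hy
    rw [cond_of_not_adj fun h => hy (mem_nbrs.mpr h), ENNReal.ofReal_zero, zero_mul]

theorem stepOperator_nonneg {f : L2 ε k} (hf : ∀ x, 0 ≤ f x) (x : Vertex ε k) :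
    0 ≤ stepOperator ε k f x := by
  have h := four_pow_mul_mass_mul_stepOperator f x
  have h1 : 0 ≤ ∑ y ∈ nbrs x, cond x y * f y :=
    Finset.sum_nonneg fun y _ => mul_nonneg (cond_nonneg x y) (hf y)
  rw [← h] at h1
  exact nonneg_of_mul_nonneg_right h1 (mul_pos (by positivity) (mass_pos x))

/-- Symmetry of the conductances moves `Q` from `f` onto `φ`. The weights may grow exponentially and
need not be in `L²`, so the exchange is done by Tonelli in `ℝ≥0∞`. -/
theorem weight_stepOperator_le {θ : ℝ} {φ : Vertex ε k → ℝ} (hφ : IsSuper θ φ) (hθ : 0 ≤ θ)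
    {f : L2 ε k} (hf : ∀ x, 0 ≤ f x) :
    weight φ (stepOperator ε k f) ≤ ENNReal.ofReal θ * weight φ f := by
  have h4 : (0 : ℝ) < 4 ^ k := by positivity
  have h0 : ENNReal.ofReal (4 ^ k) ≠ 0 := by simp
  rw [← ENNReal.mul_le_mul_iff_right h0 ENNReal.ofReal_ne_top]
  calc ENNReal.ofReal (4 ^ k) * weight φ (stepOperator ε k f)
      = ∑' x, ∑' y, ENNReal.ofReal (φ x) *
          (ENNReal.ofReal (cond x y) * ENNReal.ofReal (f y)) := by
        rw [weight, ← ENNReal.tsum_mul_left]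
        refine tsum_congr fun x => ?_
        rw [ENNReal.tsum_mul_left, tsum_cond_mul hf, ← four_pow_mul_mass_mul_stepOperator,
          ← ENNReal.ofReal_mul (stepOperator_nonneg hf x), ← ENNReal.ofReal_mul h4.le,
          ← ENNReal.ofReal_mul (hφ.nonneg x)]
        congr 1
        ring
    _ = ∑' y, ENNReal.ofReal (f y) *
          ∑' x, ENNReal.ofReal (cond y x) * ENNReal.ofReal (φ x) := by
        rw [ENNReal.tsum_comm]
        refine tsum_congr fun y => ?_
        rw [← ENNReal.tsum_mul_left]
        refine tsum_congr fun x => ?_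
        rw [cond_comm]
        ring
    _ ≤ ∑' y, ENNReal.ofReal (4 ^ k) * (ENNReal.ofReal θ *
          (ENNReal.ofReal (f y) * ENNReal.ofReal (φ y * mass y))) := by
        refine ENNReal.tsum_le_tsum fun y => ?_
        rw [tsum_cond_mul hφ.nonneg, mul_left_comm, mul_left_comm _ (ENNReal.ofReal (f y)),
          mul_left_comm]
        refine mul_le_mul_right ?_ _
        rw [← ENNReal.ofReal_mul h4.le, ← ENNReal.ofReal_mul hθ]
        refine ENNReal.ofReal_le_ofReal ((hφ.sum_le y).trans (le_of_eq ?_))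
        rw [sum_cond]
        ring
    _ = _ := by rw [ENNReal.tsum_mul_left, ENNReal.tsum_mul_left, weight]

theorem stepOperator_pow_nonneg {f : L2 ε k} (hf : ∀ x, 0 ≤ f x) (n : ℕ) (x : Vertex ε k) :
    0 ≤ (stepOperator ε k ^ n) f x := by
  induction n generalizing x with
  | zero => simpa using hf x
  | succ n ih => rw [pow_succ']; exact stepOperator_nonneg ih x

theorem weight_stepOperator_pow_le {θ : ℝ} {φ : Vertex ε k → ℝ} (hφ : IsSuper θ φ) (hθ : 0 ≤ θ)
    {f : L2 ε k} (hf : ∀ x, 0 ≤ f x) (n : ℕ) :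
    weight φ ((stepOperator ε k ^ n) f) ≤ ENNReal.ofReal (θ ^ n) * weight φ f := by
  induction n with
  | zero => simp
  | succ n ih =>
    rw [pow_succ', pow_succ', ENNReal.ofReal_mul hθ, mul_assoc]
    exact (weight_stepOperator_le hφ hθ (stepOperator_pow_nonneg hf n)).trans
      (mul_le_mul_right ih _)

/-- The exponential series converges in operator norm; evaluation at `x` is, up to the mass, the
inner product with `pointL2 x`, hence continuous. -/
theorem hasSum_semigroup_apply (t : ℝ) (f : L2 ε k) (x : Vertex ε k) :
    HasSum (fun n : ℕ => Real.exp (-(4 ^ k * t)) * ((n.factorial : ℝ)⁻¹ * (4 ^ k * t) ^ n) *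
      (stepOperator ε k ^ n) f x) (semigroup ε k t f x) := by
  have h := NormedSpace.exp_series_hasSum_exp' (𝕂 := ℝ) ((4 ^ k * t) • stepOperator ε k)
  have h1 := (h.mapL (ContinuousLinearMap.apply ℝ (L2 ε k) f)).mapL (innerSL ℝ (pointL2 x))
  have h2 := h1.mul_left (Real.exp (-(4 ^ k * t)) * (mass x)⁻¹)
  have hm : (mass x)⁻¹ * mass x = 1 := inv_mul_cancel₀ (mass_pos x).ne'
  have e : semigroup ε k t f x = Real.exp (-(4 ^ k * t)) * (mass x)⁻¹ *
      inner ℝ (pointL2 x) (NormedSpace.exp ((4 ^ k * t) • stepOperator ε k) f) := by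
    rw [inner_pointL2, semigroup_eq, smul_apply, coe_smul, Pi.smul_apply, smul_eq_mul]
    linear_combination (-(Real.exp (-(4 ^ k * t)) *
      (NormedSpace.exp ((4 ^ k * t) • stepOperator ε k)) f x)) * hm
  rw [e]
  refine Eq.subst (motive := fun F : ℕ → ℝ => HasSum F _) (funext fun n => ?_) h2
  simp only [smul_pow, ContinuousLinearMap.apply_apply, smul_apply, innerSL_apply_apply,
    inner_smul_right, inner_pointL2]
  linear_combination (Real.exp (-(4 ^ k * t)) * ((n.factorial : ℝ)⁻¹ * (4 ^ k * t) ^ n) *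
    (stepOperator ε k ^ n) f x) * hm

theorem semigroup_nonneg {t : ℝ} (ht : 0 ≤ t) {f : L2 ε k} (hf : ∀ x, 0 ≤ f x) (x : Vertex ε k) :
    0 ≤ semigroup ε k t f x :=
  (hasSum_semigroup_apply t f x).nonneg fun n =>
    mul_nonneg (by positivity) (stepOperator_pow_nonneg hf n x)

/-- Each power of `Q` costs a factor `θ`, and the Poisson average of `θ ^ n` with parameter `s` is
`exp (s (θ - 1))`. -/
theorem weight_semigroup_le {θ : ℝ} {φ : Vertex ε k → ℝ} (hφ : IsSuper θ φ) (hθ : 0 ≤ θ)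
    {t : ℝ} (ht : 0 ≤ t) {f : L2 ε k} (hf : ∀ x, 0 ≤ f x) :
    weight φ (semigroup ε k t f) ≤
      ENNReal.ofReal (Real.exp (4 ^ k * t * (θ - 1))) * weight φ f := by
  set s : ℝ := 4 ^ k * t with hs
  have hs0 : 0 ≤ s := by positivity
  set a : ℕ → ℝ := fun n => Real.exp (-s) * ((n.factorial : ℝ)⁻¹ * s ^ n) with ha
  have ha0 : ∀ n, 0 ≤ a n := fun n => by positivity
  have hsum : HasSum (fun n => a n * θ ^ n) (Real.exp (s * (θ - 1))) := by
    have h := NormedSpace.exp_series_hasSum_exp' (𝕂 := ℝ) (s * θ)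
    rw [← Real.exp_eq_exp_ℝ] at h
    have h1 := h.mul_left (Real.exp (-s))
    rw [← Real.exp_add, show -s + s * θ = s * (θ - 1) by ring] at h1
    refine Eq.subst (motive := fun F : ℕ → ℝ => HasSum F _) (funext fun n => ?_) h1
    rw [smul_eq_mul, mul_pow]
    ring
  calc weight φ (semigroup ε k t f)
      = ∑' x, ∑' n, ENNReal.ofReal (a n) * (ENNReal.ofReal ((stepOperator ε k ^ n) f x) *
          ENNReal.ofReal (φ x * mass x)) := by
        refine tsum_congr fun x => ?_
        have h := hasSum_semigroup_apply t f x
        rw [← h.tsum_eq, ENNReal.ofReal_tsum_of_nonneg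
          (fun n => mul_nonneg (ha0 n) (stepOperator_pow_nonneg hf n x)) h.summable,
          ← ENNReal.tsum_mul_right]
        refine tsum_congr fun n => ?_
        rw [ENNReal.ofReal_mul (ha0 n), mul_assoc]
    _ = ∑' n, ENNReal.ofReal (a n) * weight φ ((stepOperator ε k ^ n) f) := by
        rw [ENNReal.tsum_comm]
        exact tsum_congr fun n => ENNReal.tsum_mul_left
    _ ≤ ∑' n, ENNReal.ofReal (a n * θ ^ n) * weight φ f := by
        refine ENNReal.tsum_le_tsum fun n => ?_
        rw [ENNReal.ofReal_mul (ha0 n), mul_assoc]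
        exact mul_le_mul_right (weight_stepOperator_pow_le hφ hθ hf n) _
    _ = _ := by
        rw [ENNReal.tsum_mul_right, ← hsum.tsum_eq, ENNReal.ofReal_tsum_of_nonneg
          (fun n => mul_nonneg (ha0 n) (pow_nonneg hθ n)) hsum.summable]

/-! ## The heat kernel -/

/-- The function `1_{x} / m_k(x)`. -/
noncomputable def deltaL2 (x : Vertex ε k) : L2 ε k := (mass x)⁻¹ • pointL2 x

theorem inner_deltaL2 (f : L2 ε k) (x : Vertex ε k) : inner ℝ (deltaL2 x) f = f x := by
  rw [deltaL2, real_inner_smul_left, inner_pointL2, inv_mul_cancel_left₀ (mass_pos x).ne']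

theorem coe_deltaL2 (x : Vertex ε k) :
    ⇑(deltaL2 x) = Set.indicator {x} fun _ => (mass x)⁻¹ := by
  rw [deltaL2, coe_smul, coe_pointL2]
  funext y
  by_cases h : y = x <;> simp [h]

theorem deltaL2_nonneg (x y : Vertex ε k) : 0 ≤ deltaL2 x y := by
  rw [coe_deltaL2]
  exact Set.indicator_nonneg (fun _ _ => (inv_pos.mpr (mass_pos x)).le) _

theorem weight_deltaL2 (φ : Vertex ε k → ℝ) (x : Vertex ε k) :
    weight φ (deltaL2 x) = ENNReal.ofReal (φ x) := by
  rw [weight, tsum_eq_single x]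
  · rw [coe_deltaL2, Set.indicator_of_mem (Set.mem_singleton x),
      ← ENNReal.ofReal_mul (inv_pos.mpr (mass_pos x)).le]
    congr 1
    have := (mass_pos x).ne'
    field_simp
  · intro y hy
    rw [coe_deltaL2, Set.indicator_of_notMem (by simpa using hy), ENNReal.ofReal_zero, zero_mul]

theorem semigroup_add (s t : ℝ) :
    semigroup ε k (s + t) = semigroup ε k s * semigroup ε k t := by
  let _ : NormedAlgebra ℚ (L2 ε k →L[ℝ] L2 ε k) := NormedAlgebra.restrictScalars ℚ ℝ _
  rw [semigroup, neg_add, add_smul, NormedSpace.exp_add_of_commute, semigroup, semigroup]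
  exact ((Commute.refl _).smul_left _).smul_right _

theorem semigroup_zero : semigroup ε k 0 = 1 := by
  rw [semigroup, neg_zero, zero_smul, NormedSpace.exp_zero]

theorem isSelfAdjoint_formOperator : IsSelfAdjoint (formOperator ε k) := by
  rw [ContinuousLinearMap.isSelfAdjoint_iff_isSymmetric]
  intro f g
  change inner ℝ (formOperator ε k f) g = inner ℝ f (formOperator ε k g)
  rw [inner_formOperator, real_inner_comm, inner_formOperator, dirichletForm_comm]

theorem isSelfAdjoint_semigroup (t : ℝ) : IsSelfAdjoint (semigroup ε k t) := by
  let _ : NormedAlgebra ℚ (L2 ε k →L[ℝ] L2 ε k) := NormedAlgebra.restrictScalars ℚ ℝ _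
  exact ((IsSelfAdjoint.all (-t)).smul isSelfAdjoint_formOperator).exp

theorem inner_semigroup (t : ℝ) (f g : L2 ε k) :
    inner ℝ (semigroup ε k t f) g = inner ℝ f (semigroup ε k t g) :=
  ContinuousLinearMap.isSelfAdjoint_iff_isSymmetric.mp (isSelfAdjoint_semigroup t) f g

theorem heatKernel_eq (t : ℝ) (x y : Vertex ε k) :
    heatKernel t x y = semigroup ε k t (deltaL2 y) x := by
  rw [heatKernel, refMeasure_real_singleton, deltaL2, map_smul, coe_smul, Pi.smul_apply,
    smul_eq_mul, div_eq_inv_mul]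
  rfl

theorem heatKernel_eq_inner (s t : ℝ) (x y : Vertex ε k) :
    heatKernel (s + t) x y =
      inner ℝ (semigroup ε k s (deltaL2 x)) (semigroup ε k t (deltaL2 y)) := by
  rw [heatKernel_eq, ← inner_deltaL2, semigroup_add, inner_semigroup]
  rfl

theorem isSuper_one : IsSuper 1 fun _ : Vertex ε k => (1 : ℝ) :=
  ⟨fun _ => zero_le_one, fun x => by simp⟩

theorem ofReal_inner_eq_tsum {f g : L2 ε k} (hf : ∀ x, 0 ≤ f x) (hg : ∀ x, 0 ≤ g x) :
    ENNReal.ofReal (inner ℝ f g) =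
      ∑' x, ENNReal.ofReal (f x) * ENNReal.ofReal (g x) * ENNReal.ofReal (mass x) := by
  have h := MeasureTheory.L2.integrable_inner (𝕜 := ℝ) f g
  rw [MeasureTheory.L2.inner_def, MeasureTheory.ofReal_integral_eq_lintegral_ofReal h
    (Filter.Eventually.of_forall fun x => mul_nonneg (hg x) (hf x))]
  revert hf hg
  generalize (⇑f : Vertex ε k → ℝ) = u
  generalize (⇑g : Vertex ε k → ℝ) = v
  intro hu hv
  rw [refMeasure, MeasureTheory.lintegral_sum_measure]
  refine tsum_congr fun x => ?_
  rw [MeasureTheory.lintegral_smul_measure, MeasureTheory.lintegral_dirac, smul_eq_mul, mul_comm,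
    ← ENNReal.ofReal_mul (hu x)]
  congr 2
  exact mul_comm _ _

/-! ## Lattice neighbours -/

/-- The four lattice neighbours of a point of `ℤ²`. -/
def latticeNbrs (z : ℤ × ℤ) : Finset (ℤ × ℤ) :=
  {(z.1 + 1, z.2), (z.1 - 1, z.2), (z.1, z.2 + 1), (z.1, z.2 - 1)}

theorem mem_latticeNbrs {z w : ℤ × ℤ} : w ∈ latticeNbrs z ↔ LatticeAdj z w := by
  rw [latticeAdj_iff]; simp [latticeNbrs]

theorem sum_latticeNbrs (z : ℤ × ℤ) (F : ℤ × ℤ → ℝ) : ∑ w ∈ latticeNbrs z, F w =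
    F (z.1 + 1, z.2) + F (z.1 - 1, z.2) + F (z.1, z.2 + 1) + F (z.1, z.2 - 1) := by
  rw [latticeNbrs, Finset.sum_insert, Finset.sum_insert, Finset.sum_pair]
  · ring
  all_goals simp <;> try omega

theorem card_latticeNbrs (z : ℤ × ℤ) : (latticeNbrs z).card = 4 := by
  have := sum_latticeNbrs z fun _ => 1
  rw [Finset.sum_const, nsmul_eq_mul, mul_one] at this
  have h : ((latticeNbrs z).card : ℝ) = ((4 : ℕ) : ℝ) := by rw [this]; norm_num
  exact_mod_cast h

theorem nbrs_plane [DecidableEq (Vertex ε k)] (z : {z : ℤ × ℤ // ε < ‖pt k z‖}) :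
    nbrs (plane z) = (latticeNbrs z.1).image (proj ε k) := by
  ext y
  rw [mem_nbrs, adj_plane_iff, Finset.mem_image]
  simp only [mem_latticeNbrs]
  exact ⟨fun ⟨w, h, e⟩ => ⟨w, h, e.symm⟩, fun ⟨w, h, e⟩ => ⟨w, h, e.symm⟩⟩

theorem deg_plane_le (z : {z : ℤ × ℤ // ε < ‖pt k z‖}) : deg (plane z) ≤ 4 := by
  classical
  rw [← card_nbrs, nbrs_plane, ← card_latticeNbrs z.1]
  exact Finset.card_image_le

theorem mass_plane_le (z : {z : ℤ × ℤ // ε < ‖pt k z‖}) : mass (plane z) ≤ mesh k ^ 2 := by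
  have h : (deg (plane z) : ℝ) ≤ 4 := by exact_mod_cast deg_plane_le z
  rw [mass]
  nlinarith [pow_pos (mesh_pos k) 2]

theorem le_mass (x : Vertex ε k) : mesh k ^ 2 / 4 ≤ mass x := by
  have h : (1 : ℝ) ≤ deg x := by exact_mod_cast deg_pos x
  have := deg_le_mass x
  nlinarith [pow_pos (mesh_pos k) 2]

theorem le_mass_line (n : ℕ) : mesh k / 2 ≤ mass (line ε k n) := by
  have h : (1 : ℝ) ≤ deg (line ε k n) := by exact_mod_cast deg_pos _
  have hm := mesh_pos k
  cases n with
  | zero =>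
    have h0 : 0 ≤ mesh k ^ 2 / 4 * ((deg (darn : Vertex ε k) : ℝ) - 1) :=
      mul_nonneg (by positivity) (sub_nonneg.mpr h)
    simp only [line, mass]
    linarith
  | succ n =>
    simp only [line, mass] at h ⊢
    nlinarith

/-! ## One- and two-dimensional Nash inequalities -/

theorem ofReal_le_tsum_abs_sub {g : ℕ → ℝ} (hg : Filter.Tendsto g Filter.atTop (nhds 0)) :
    ENNReal.ofReal (g 0) ≤ ∑' n, ENNReal.ofReal |g (n + 1) - g n| := by
  have h1 : ∀ N, ENNReal.ofReal (g 0) ≤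
      ∑' n, ENNReal.ofReal |g (n + 1) - g n| + ENNReal.ofReal (g N) := by
    intro N
    have h2 : g 0 ≤ ∑ n ∈ Finset.range N, |g (n + 1) - g n| + g N := by
      have h3 := Finset.sum_range_sub g N
      have h4 := Finset.abs_sum_le_sum_abs (fun n => g (n + 1) - g n) (Finset.range N)
      rw [h3] at h4
      linarith [neg_le_abs (g N - g 0)]
    refine (ENNReal.ofReal_le_ofReal h2).trans (ENNReal.ofReal_add_le.trans ?_)
    rw [ENNReal.ofReal_sum_of_nonneg fun _ _ => abs_nonneg _]
    gcongr
    exact ENNReal.sum_le_tsum _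
  have h2 : Filter.Tendsto (fun N => ∑' n, ENNReal.ofReal |g (n + 1) - g n| +
      ENNReal.ofReal (g N)) Filter.atTop (nhds (∑' n, ENNReal.ofReal |g (n + 1) - g n| + 0)) := by
    refine Filter.Tendsto.const_add _ ?_
    simpa using ENNReal.tendsto_ofReal hg
  rw [add_zero] at h2
  exact ge_of_tendsto' h2 h1

theorem abs_sq_sub_sq_le {a b θ : ℝ} (ha : 0 ≤ a) (hb : 0 ≤ b) (hθ : 0 < θ) :
    |b ^ 2 - a ^ 2| ≤ θ * (b - a) ^ 2 + 1 / (2 * θ) * (a ^ 2 + b ^ 2) := by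
  have h1 : |b ^ 2 - a ^ 2| = |b - a| * (a + b) := by
    rw [show b ^ 2 - a ^ 2 = (b - a) * (a + b) by ring, abs_mul, abs_of_nonneg (add_nonneg ha hb)]
  rw [h1, ← sq_abs (b - a)]
  generalize |b - a| = d
  have h2 : d * (a + b) ≤ θ * d ^ 2 + (a + b) ^ 2 / (4 * θ) := by
    have h3 : θ * d ^ 2 + (a + b) ^ 2 / (4 * θ) - d * (a + b)
        = (2 * θ * d - (a + b)) ^ 2 / (4 * θ) := by
      field_simp; ring
    have h4 : 0 ≤ (2 * θ * d - (a + b)) ^ 2 / (4 * θ) := by positivity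
    linarith
  have h5 : (a + b) ^ 2 / (4 * θ) ≤ 1 / (2 * θ) * (a ^ 2 + b ^ 2) := by
    rw [div_mul_eq_mul_div, div_le_div_iff₀ (by positivity) (by positivity)]
    nlinarith [sq_nonneg (a - b)]
  linarith

/-- Young's inequality applied to `|b² - a²| = |b - a| (a + b)`. Only injectivity of `T` is
required, which covers the shift of `ℕ` as well as those of `ℤ²`. -/
theorem tsum_abs_sq_sub_sq_le {α : Type*} {T : α → α} (hT : Function.Injective T) {g : α → ℝ}
    (hg : ∀ z, 0 ≤ g z) {θ : ℝ} (hθ : 0 < θ) :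
    ∑' z, ENNReal.ofReal |g (T z) ^ 2 - g z ^ 2| ≤
      ENNReal.ofReal θ * ∑' z, ENNReal.ofReal ((g (T z) - g z) ^ 2) +
        ENNReal.ofReal (1 / θ) * ∑' z, ENNReal.ofReal (g z ^ 2) := by
  have h1 : ∑' z, ENNReal.ofReal (g (T z) ^ 2) ≤ ∑' z, ENNReal.ofReal (g z ^ 2) :=
    ENNReal.tsum_comp_le_tsum_of_injective hT fun z => ENNReal.ofReal (g z ^ 2)
  calc ∑' z, ENNReal.ofReal |g (T z) ^ 2 - g z ^ 2|
      ≤ ∑' z, (ENNReal.ofReal θ * ENNReal.ofReal ((g (T z) - g z) ^ 2) +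
          ENNReal.ofReal (1 / (2 * θ)) *
            (ENNReal.ofReal (g z ^ 2) + ENNReal.ofReal (g (T z) ^ 2))) := by
        refine ENNReal.tsum_le_tsum fun z => ?_
        rw [← ENNReal.ofReal_add (sq_nonneg _) (sq_nonneg _), ← ENNReal.ofReal_mul hθ.le,
          ← ENNReal.ofReal_mul (by positivity), ← ENNReal.ofReal_add (by positivity)
            (by positivity)]
        exact ENNReal.ofReal_le_ofReal (abs_sq_sub_sq_le (hg z) (hg _) hθ)
    _ = ENNReal.ofReal θ * ∑' z, ENNReal.ofReal ((g (T z) - g z) ^ 2) +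
          ENNReal.ofReal (1 / (2 * θ)) *
            (∑' z, ENNReal.ofReal (g z ^ 2) + ∑' z, ENNReal.ofReal (g (T z) ^ 2)) := by
        rw [ENNReal.tsum_add, ENNReal.tsum_mul_left, ENNReal.tsum_mul_left, ENNReal.tsum_add]
    _ ≤ _ := by
        refine add_le_add le_rfl ((mul_le_mul_right (add_le_add le_rfl h1) _).trans (le_of_eq ?_))
        rw [← two_mul, ← mul_assoc, ← ENNReal.ofReal_ofNat, ← ENNReal.ofReal_mul (by positivity)]
        congr 2
        field_simp

theorem tendsto_zero_of_tsum_ne_top {g : ℕ → ℝ} (hg : ∀ n, 0 ≤ g n)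
    (h : ∑' n, ENNReal.ofReal (g n) ≠ ∞) : Filter.Tendsto g Filter.atTop (nhds 0) := by
  have := (ENNReal.summable_toReal h).tendsto_atTop_zero
  simpa [ENNReal.toReal_ofReal, hg] using this

/-- A one-dimensional Nash inequality for a nonnegative sequence. -/
theorem sequence_nash {g : ℕ → ℝ} (hg : ∀ n, 0 ≤ g n) {a b τ : ℝ} (hτ : 0 < τ) (ha : 0 < a)
    (h1 : ∑' n, ENNReal.ofReal (g n) ≤ ENNReal.ofReal a) (hb : 0 ≤ b)
    (h2 : ∑' n, ENNReal.ofReal ((g (n + 1) - g n) ^ 2) ≤ ENNReal.ofReal b)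
    (hab : a * b ≤ τ ^ 3 / 32) (i : ℕ) : g i ≤ τ := by
  have hfin : ∑' n, ENNReal.ofReal (g n) ≠ ∞ := (h1.trans_lt ENNReal.ofReal_lt_top).ne
  have hle : ∀ n, g n ≤ a := fun n =>
    (ENNReal.ofReal_le_ofReal_iff ha.le).mp ((ENNReal.le_tsum n).trans h1)
  have hbdd : BddAbove (Set.range g) := ⟨a, by rintro _ ⟨n, rfl⟩; exact hle n⟩
  set s := ⨆ n, g n with hs
  have hgs : ∀ n, g n ≤ s := fun n => le_ciSup hbdd n
  have hs0 : 0 ≤ s := (hg 0).trans (hgs 0)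
  have hlim := tendsto_zero_of_tsum_ne_top hg hfin
  have hsq : ∑' n, ENNReal.ofReal (g n ^ 2) ≤ ENNReal.ofReal (s * a) := by
    rw [ENNReal.ofReal_mul hs0]
    refine le_trans ?_ (mul_le_mul_right h1 _)
    rw [← ENNReal.tsum_mul_left]
    refine ENNReal.tsum_le_tsum fun n => ?_
    rw [← ENNReal.ofReal_mul hs0, sq]
    exact ENNReal.ofReal_le_ofReal (mul_le_mul_of_nonneg_right (hgs n) (hg n))
  have key : ∀ i, g i ^ 2 ≤ τ ^ 2 / 16 + s * τ / 2 := by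
    intro i
    -- With this Young parameter the mass term becomes `s * τ / 2`, and the energy term `2ab/τ` is
    -- at most `τ²/16` by `hab`.
    have hθ : 0 < 2 * a / τ := by positivity
    have h3 : Filter.Tendsto (fun n => g (i + n) ^ 2) Filter.atTop (nhds 0) := by
      have h4 : Filter.Tendsto (fun n => g (i + n)) Filter.atTop (nhds 0) :=
        hlim.comp (Filter.tendsto_atTop_mono (fun n => Nat.le_add_left n i) Filter.tendsto_id)
      simpa using h4.pow 2
    have h5 := ofReal_le_tsum_abs_sub h3
    have h6 : ∑' n, ENNReal.ofReal |g (i + (n + 1)) ^ 2 - g (i + n) ^ 2| ≤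
        ∑' n, ENNReal.ofReal |g (n + 1) ^ 2 - g n ^ 2| :=
      ENNReal.tsum_comp_le_tsum_of_injective (add_right_injective i)
        fun n => ENNReal.ofReal |g (n + 1) ^ 2 - g n ^ 2|
    have h7 := tsum_abs_sq_sub_sq_le (add_left_injective 1) hg hθ
    have h8 : ENNReal.ofReal (g i ^ 2) ≤
        ENNReal.ofReal (2 * a / τ * b + 1 / (2 * a / τ) * (s * a)) := by
      rw [ENNReal.ofReal_add (by positivity) (by positivity), ENNReal.ofReal_mul hθ.le,
        ENNReal.ofReal_mul (by positivity)]
      exact h5.trans (h6.trans (h7.trans (add_le_add (mul_le_mul_right h2 _)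
        (mul_le_mul_right hsq _))))
    refine ((ENNReal.ofReal_le_ofReal_iff (by positivity)).mp h8).trans (add_le_add ?_ (le_of_eq ?_))
    · rw [div_mul_eq_mul_div, div_le_iff₀ hτ]
      nlinarith
    · field_simp
  refine (hgs i).trans ?_
  by_contra! hlt
  have hs1 : 0 < s := hτ.trans hlt
  -- If `τ < s`, then `key` gives `g n ^ 2 ≤ (1/16 + 1/2) s² = (3s/4)²`, which contradicts the
  -- choice of `s` as the supremum.
  have h9 : ∀ n, g n ≤ 3 / 4 * s := by
    intro n
    refine abs_le_of_sq_le_sq' ?_ (by positivity) |>.2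
    nlinarith [key n]
  have := ciSup_le h9
  linarith

/-- A two-dimensional Nash inequality for a nonnegative function on `ℤ²`. -/
theorem lattice_nash {G : ℤ × ℤ → ℝ} (hG : ∀ z, 0 ≤ G z) {τ e : ℝ} (hτ : 0 < τ) (he : 0 ≤ e)
    (heτ : e ≤ τ ^ 2 / 16) {s : ℝ} (hs : 0 ≤ s) (h1 : ∑' z, ENNReal.ofReal (G z) ≤ ENNReal.ofReal s)
    (hx : ∑' z : ℤ × ℤ, ENNReal.ofReal ((G (z.1 + 1, z.2) - G z) ^ 2) ≤ ENNReal.ofReal e)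
    (hy : ∑' z : ℤ × ℤ, ENNReal.ofReal ((G (z.1, z.2 + 1) - G z) ^ 2) ≤ ENNReal.ofReal e) :
    ∑' z, ENNReal.ofReal (G z ^ 2) ≤ ENNReal.ofReal (2 * τ * s) := by
  have hfin : ∑' z, ENNReal.ofReal (G z) ≠ ∞ := (h1.trans_lt ENNReal.ofReal_lt_top).ne
  have hle : ∀ z, G z ≤ s := fun z =>
    (ENNReal.ofReal_le_ofReal_iff hs).mp ((ENNReal.le_tsum z).trans h1)
  have hsq : ∑' z, ENNReal.ofReal (G z ^ 2) ≤ ENNReal.ofReal (s * s) := by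
    rw [ENNReal.ofReal_mul hs]
    refine le_trans ?_ (mul_le_mul_right h1 _)
    rw [← ENNReal.tsum_mul_left]
    refine ENNReal.tsum_le_tsum fun n => ?_
    rw [← ENNReal.ofReal_mul hs, sq]
    exact ENNReal.ofReal_le_ofReal (mul_le_mul_of_nonneg_right (hle n) (hG n))
  obtain ⟨S, hS0, hS⟩ : ∃ S : ℝ, 0 ≤ S ∧ ∑' z, ENNReal.ofReal (G z ^ 2) = ENNReal.ofReal S :=
    ⟨_, ENNReal.toReal_nonneg, (ENNReal.ofReal_toReal (hsq.trans_lt ENNReal.ofReal_lt_top).ne).symm⟩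
  rw [hS]
  refine ENNReal.ofReal_le_ofReal ?_
  rcases hS0.eq_or_lt with rfl | hSpos
  · positivity
  have hr : 0 < √S := Real.sqrt_pos.mpr hSpos
  have hrr : √S * √S = S := Real.mul_self_sqrt hS0
  -- This Young parameter makes the energy and mass contributions to the total variation of `G²` at
  -- most `√S * τ / 4` each.
  have hθ : 0 < 4 * √S / τ := by positivity
  have hsum : ∀ T : ℤ × ℤ → ℤ × ℤ, Function.Injective T →
      ∑' z, ENNReal.ofReal ((G (T z) - G z) ^ 2) ≤ ENNReal.ofReal e →
      ∑' z, ENNReal.ofReal |G (T z) ^ 2 - G z ^ 2| ≤ ENNReal.ofReal (√S * τ / 2) := by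
    intro T hT h
    refine (tsum_abs_sq_sub_sq_le hT hG hθ).trans ?_
    rw [hS]
    refine (add_le_add (mul_le_mul_right h _) le_rfl).trans ?_
    rw [← ENNReal.ofReal_mul hθ.le, ← ENNReal.ofReal_mul (by positivity),
      ← ENNReal.ofReal_add (by positivity) (by positivity)]
    refine ENNReal.ofReal_le_ofReal ?_
    have e1 : 1 / (4 * √S / τ) * S = √S * τ / 4 := by
      field_simp; linarith [Real.sq_sqrt hS0]
    have e2 : 4 * √S / τ * e ≤ √S * τ / 4 := by
      rw [div_mul_eq_mul_div, div_le_iff₀ hτ]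
      nlinarith
    linarith
  have hX := hsum (fun z => (z.1 + 1, z.2)) (fun z w h => by simpa [Prod.ext_iff] using h) hx
  have hY := hsum (fun z => (z.1, z.2 + 1)) (fun z w h => by simpa [Prod.ext_iff] using h) hy
  have hlim : ∀ j : ℕ → ℤ × ℤ, Function.Injective j →
      Filter.Tendsto (fun n => G (j n) ^ 2) Filter.atTop (nhds 0) := by
    intro j hj
    have := tendsto_zero_of_tsum_ne_top (g := fun n => G (j n)) (fun n => hG _)
      (((ENNReal.tsum_comp_le_tsum_of_injective hj fun z => ENNReal.ofReal (G z)).trans_lt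
        hfin.lt_top).ne)
    simpa using this.pow 2
  set A : ℤ → ℝ≥0∞ := fun b => ∑' a : ℤ, ENNReal.ofReal |G (a + 1, b) ^ 2 - G (a, b) ^ 2| with hA
  set B : ℤ → ℝ≥0∞ := fun a => ∑' b : ℤ, ENNReal.ofReal |G (a, b + 1) ^ 2 - G (a, b) ^ 2| with hB
  have hGA : ∀ z : ℤ × ℤ, ENNReal.ofReal (G z ^ 2) ≤ A z.2 := by
    intro z
    have hj : Function.Injective fun n : ℕ => (z.1 + n : ℤ) := fun m n h => by simpa using h
    have h2 := ofReal_le_tsum_abs_sub (hlim (fun n => (z.1 + n, z.2))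
      fun m n h => by simpa using h)
    simp only [Nat.cast_zero, add_zero, Nat.cast_add, Nat.cast_one, ← add_assoc] at h2
    exact h2.trans (ENNReal.tsum_comp_le_tsum_of_injective hj
      fun a => ENNReal.ofReal |G (a + 1, z.2) ^ 2 - G (a, z.2) ^ 2|)
  have hGB : ∀ z : ℤ × ℤ, ENNReal.ofReal (G z ^ 2) ≤ B z.1 := by
    intro z
    have hj : Function.Injective fun n : ℕ => (z.2 + n : ℤ) := fun m n h => by simpa using h
    have h2 := ofReal_le_tsum_abs_sub (hlim (fun n => (z.1, z.2 + n))
      fun m n h => by simpa using h)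
    simp only [Nat.cast_zero, add_zero, Nat.cast_add, Nat.cast_one, ← add_assoc] at h2
    exact h2.trans (ENNReal.tsum_comp_le_tsum_of_injective hj
      fun b => ENNReal.ofReal |G (z.1, b + 1) ^ 2 - G (z.1, b) ^ 2|)
  have hsA : ∑' b, A b ≤ ENNReal.ofReal (√S * τ / 2) := by
    rw [hA, ENNReal.tsum_comm]
    rwa [ENNReal.tsum_prod'] at hX
  have hsB : ∑' a, B a ≤ ENNReal.ofReal (√S * τ / 2) := by
    rw [hB]
    rwa [ENNReal.tsum_prod'] at hY
  -- The Gagliardo–Nirenberg argument: `G²` is bounded by its variation along the row and along the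
  -- column, so `∑ G⁴` is at most the product of the two total variations.
  have h4 : ∑' z, ENNReal.ofReal (G z ^ 2) * ENNReal.ofReal (G z ^ 2) ≤
      ENNReal.ofReal (S * τ ^ 2 / 4) := by
    calc ∑' z, ENNReal.ofReal (G z ^ 2) * ENNReal.ofReal (G z ^ 2)
        ≤ ∑' z : ℤ × ℤ, B z.1 * A z.2 :=
          ENNReal.tsum_le_tsum fun z => mul_le_mul' (hGB z) (hGA z)
      _ = (∑' a, B a) * ∑' b, A b := by
          rw [ENNReal.tsum_prod', ← ENNReal.tsum_mul_right]
          refine tsum_congr fun a => ?_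
          simp only [ENNReal.tsum_mul_left]
      _ ≤ ENNReal.ofReal (√S * τ / 2) * ENNReal.ofReal (√S * τ / 2) := mul_le_mul' hsB hsA
      _ = _ := by
          rw [← ENNReal.ofReal_mul (by positivity)]
          congr 1
          linear_combination τ ^ 2 / 4 * hrr
  -- Pointwise `G² ≤ τ G + G⁴ / τ²`, by cases on `G ≤ τ`. The quartic part contributes only `S / 4`,
  -- which is absorbed on the left.
  have h5 : ENNReal.ofReal S ≤ ENNReal.ofReal (τ * s + 1 / τ ^ 2 * (S * τ ^ 2 / 4)) := by
    rw [← hS, ENNReal.ofReal_add (by positivity) (by positivity), ENNReal.ofReal_mul hτ.le,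
      ENNReal.ofReal_mul (by positivity)]
    refine le_trans ?_ (add_le_add (mul_le_mul_right h1 _) (mul_le_mul_right h4 _))
    rw [← ENNReal.tsum_mul_left, ← ENNReal.tsum_mul_left, ← ENNReal.tsum_add]
    refine ENNReal.tsum_le_tsum fun z => ?_
    rw [← ENNReal.ofReal_mul (sq_nonneg _), ← ENNReal.ofReal_mul hτ.le,
      ← ENNReal.ofReal_mul (by positivity), ← ENNReal.ofReal_add (mul_nonneg hτ.le (hG z))
      (by positivity)]
    refine ENNReal.ofReal_le_ofReal ?_
    have h0 := hG z
    rcases le_total (G z) τ with h | h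
    · have : 0 ≤ 1 / τ ^ 2 * (G z ^ 2 * G z ^ 2) := by positivity
      nlinarith
    · have h6 : G z ^ 2 ≤ 1 / τ ^ 2 * (G z ^ 2 * G z ^ 2) := by
        rw [one_div, inv_mul_eq_div, le_div_iff₀ (by positivity)]
        exact mul_le_mul_of_nonneg_left (pow_le_pow_left₀ hτ.le h 2) (by positivity)
      nlinarith [mul_nonneg hτ.le h0]
  have h6 := (ENNReal.ofReal_le_ofReal_iff (by positivity)).mp h5
  have e3 : 1 / τ ^ 2 * (S * τ ^ 2 / 4) = S / 4 := by field_simp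
  rw [e3] at h6
  nlinarith

/-! ## The Nash inequality on `E^k` -/

theorem dirichletForm_self_nonneg (f : L2 ε k) : 0 ≤ dirichletForm ⇑f ⇑f :=
  formBilin_self_nonneg f

theorem tsum_planeEdges_le (f : L2 ε k) :
    ∑' e : planeEdges ε k, ENNReal.ofReal ((f e.1.1 - f e.1.2) ^ 2) ≤
      ENNReal.ofReal (8 * dirichletForm ⇑f ⇑f) := by
  rw [← ENNReal.ofReal_tsum_of_nonneg (fun _ => sq_nonneg _)
    (summable_subedges planeEdges_subset f).1]
  refine ENNReal.ofReal_le_ofReal ?_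
  have h : 0 ≤ 2 ^ k / 4 * ∑' e : halfEdges ε k, (f e.1.1 - f e.1.2) ^ 2 :=
    mul_nonneg (by positivity) (tsum_nonneg fun _ => sq_nonneg _)
  simp only [dirichletForm, ← sq]
  linarith

theorem tsum_halfEdges_le (f : L2 ε k) :
    ∑' e : halfEdges ε k, ENNReal.ofReal ((f e.1.1 - f e.1.2) ^ 2) ≤
      ENNReal.ofReal (4 * mesh k * dirichletForm ⇑f ⇑f) := by
  rw [← ENNReal.ofReal_tsum_of_nonneg (fun _ => sq_nonneg _)
    (summable_subedges halfEdges_subset f).1]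
  refine ENNReal.ofReal_le_ofReal ?_
  have h : 0 ≤ mesh k * ∑' e : planeEdges ε k, (f e.1.1 - f e.1.2) ^ 2 :=
    mul_nonneg (mesh_pos k).le (tsum_nonneg fun _ => sq_nonneg _)
  simp only [dirichletForm, ← sq]
  generalize ∑' e : halfEdges ε k, (f e.1.1 - f e.1.2) ^ 2 = a at *
  have h2 := mesh_mul_two_pow k
  linear_combination (1 / 2) * h - a * h2

/-- Bonds inside the disc contribute nothing; any other bond projects to an edge of `G^k`. Several
lattice bonds may project to one edge into the darning point, but for a fixed shift `T` the endpoint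
outside the disc determines the bond. Splitting by which endpoint lies outside gives two injections
into the edges. -/
theorem tsum_lattice_le_two_mul {f : Vertex ε k → ℝ} {T : ℤ × ℤ → ℤ × ℤ}
    (hT : Function.Injective T) (hadj : ∀ z, LatticeAdj z (T z)) :
    ∑' z, ENNReal.ofReal ((f (proj ε k (T z)) - f (proj ε k z)) ^ 2) ≤
      2 * ∑' e : planeEdges ε k, ENNReal.ofReal ((f e.1.1 - f e.1.2) ^ 2) := by
  set a : ℤ × ℤ → ℝ≥0∞ := fun z => ENNReal.ofReal ((f (proj ε k (T z)) - f (proj ε k z)) ^ 2)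
    with ha
  set S₁ : Set (ℤ × ℤ) := {z | ε < ‖pt k z‖}
  set S₂ : Set (ℤ × ℤ) := {z | ε < ‖pt k (T z)‖}
  have hedge : ∀ z w, ε < ‖pt k z‖ → LatticeAdj z w →
      (proj ε k z, proj ε k w) ∈ planeEdges ε k := by
    intro z w hz h
    refine ⟨?_, not_isHalf_proj z, not_isHalf_proj w⟩
    change (graph ε k).Adj (proj ε k z) (proj ε k w)
    rw [proj_of_lt hz]
    exact adj_plane_iff.mpr ⟨w, h, rfl⟩
  have hinj : ∀ z w, ε < ‖pt k z‖ → proj ε k z = proj ε k w → z = w := by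
    intro z w hz h
    rw [proj_of_lt hz] at h
    exact (proj_eq_plane_iff.mp h.symm).symm
  have h1 : ∑' z, a z ≤ ∑' z, (S₁.indicator a z + S₂.indicator a z) := by
    refine ENNReal.tsum_le_tsum fun z => ?_
    by_cases hz : z ∈ S₁
    · rw [Set.indicator_of_mem hz]
      exact le_self_add
    by_cases hz' : z ∈ S₂
    · rw [Set.indicator_of_mem hz']
      exact le_add_self
    · have : a z = 0 := by
        simp only [ha]
        rw [proj_of_le (not_lt.mp hz), proj_of_le (not_lt.mp hz')]
        simp
      rw [this]
      exact bot_le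
  have h2 : ∑' z, S₁.indicator a z ≤
      ∑' e : planeEdges ε k, ENNReal.ofReal ((f e.1.1 - f e.1.2) ^ 2) := by
    rw [← tsum_subtype]
    have := ENNReal.tsum_comp_le_tsum_of_injective
      (f := fun z : S₁ => (⟨(proj ε k z.1, proj ε k (T z.1)), hedge _ _ z.2 (hadj _)⟩ :
        planeEdges ε k)) (fun z w h => Subtype.ext (hinj _ _ z.2 (by
          simpa using congrArg (fun e => e.1.1) h)))
      fun e => ENNReal.ofReal ((f e.1.1 - f e.1.2) ^ 2)
    refine le_trans (le_of_eq (tsum_congr fun z => ?_)) this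
    simp only [ha]
    congr 1
    ring
  have h3 : ∑' z, S₂.indicator a z ≤
      ∑' e : planeEdges ε k, ENNReal.ofReal ((f e.1.1 - f e.1.2) ^ 2) := by
    rw [← tsum_subtype]
    exact ENNReal.tsum_comp_le_tsum_of_injective
      (f := fun z : S₂ => (⟨(proj ε k (T z.1), proj ε k z.1), hedge _ _ z.2 (hadj _).symm⟩ :
        planeEdges ε k)) (fun z w h => Subtype.ext (hT (hinj _ _ z.2 (by
          simpa using congrArg (fun e => e.1.1) h))))
      fun e => ENNReal.ofReal ((f e.1.1 - f e.1.2) ^ 2)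
  rw [two_mul]
  exact h1.trans (by rw [ENNReal.tsum_add]; exact add_le_add h2 h3)

/-- The part above the value at the darning point of a function on `E^k`, restricted to the plane
and extended by `0`. -/
noncomputable def planeExcess (f : Vertex ε k → ℝ) (z : ℤ × ℤ) : ℝ :=
  max (f (proj ε k z) - f darn) 0

theorem planeExcess_nonneg (f : Vertex ε k → ℝ) (z : ℤ × ℤ) : 0 ≤ planeExcess f z :=
  le_max_right _ _

theorem planeExcess_of_le (f : Vertex ε k → ℝ) {z : ℤ × ℤ} (h : ‖pt k z‖ ≤ ε) :
    planeExcess f z = 0 := by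
  rw [planeExcess, proj_of_le h, sub_self, max_self]

theorem planeExcess_sub_sq_le (f : Vertex ε k → ℝ) (z w : ℤ × ℤ) :
    (planeExcess f w - planeExcess f z) ^ 2 ≤ (f (proj ε k w) - f (proj ε k z)) ^ 2 := by
  refine sq_le_sq.mpr ((abs_max_sub_max_le_abs _ _ _).trans (le_of_eq ?_))
  congr 1
  ring

variable {f : L2 ε k}

theorem tsum_le_of_le_mass {α : Type*} {i : α → Vertex ε k} (hi : Function.Injective i) {a : ℝ}
    (ha : 0 < a) (hf : ∀ x, 0 ≤ f x) (hw : weight (fun _ => 1) f ≤ 1)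
    (h : ∀ z, a ≤ mass (i z)) : ∑' z, ENNReal.ofReal (f (i z)) ≤ ENNReal.ofReal (1 / a) := by
  have h0 : ENNReal.ofReal a ≠ 0 := by simpa using ha
  rw [← ENNReal.mul_le_mul_iff_right h0 ENNReal.ofReal_ne_top, ← ENNReal.ofReal_mul ha.le,
    mul_one_div_cancel ha.ne', ENNReal.ofReal_one, ← ENNReal.tsum_mul_left]
  refine le_trans ?_ ((ENNReal.tsum_comp_le_tsum_of_injective hi
    fun x => ENNReal.ofReal (f x) * ENNReal.ofReal (1 * mass x)).trans hw)
  refine ENNReal.tsum_le_tsum fun z => ?_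
  rw [← ENNReal.ofReal_mul ha.le, ← ENNReal.ofReal_mul (hf _)]
  refine ENNReal.ofReal_le_ofReal ?_
  nlinarith [h z, hf (i z)]

/-- The mesh cancels: the `ℓ¹` bound `2 / mesh k` times the energy bound `4 * mesh k * E` is `8 E`,
and `sequence_nash` asks for `8 E ≤ τ³ / 32`. -/
theorem apply_line_le (hf : ∀ x, 0 ≤ f x) (hw : weight (fun _ => 1) f ≤ 1) {τ : ℝ} (hτ : 0 < τ)
    (h3 : 256 * dirichletForm ⇑f ⇑f ≤ τ ^ 3) (n : ℕ) : f (line ε k n) ≤ τ := by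
  have hm := mesh_pos k
  have he := dirichletForm_self_nonneg f
  have h1 := tsum_le_of_le_mass line_injective (half_pos hm) hf hw le_mass_line
  have h2 : ∑' n, ENNReal.ofReal ((f (line ε k (n + 1)) - f (line ε k n)) ^ 2) ≤
      ENNReal.ofReal (4 * mesh k * dirichletForm ⇑f ⇑f) := by
    refine le_trans ?_ (tsum_halfEdges_le f)
    have := ENNReal.tsum_comp_le_tsum_of_injective
      (f := fun n : ℕ => (⟨(line ε k (n + 1), line ε k n), (adj_line_succ n).symm,
        not_isPlane_line (n + 1), not_isPlane_line n⟩ : halfEdges ε k))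
      (fun m n h => line_injective (by simpa using congrArg (fun e => e.1.2) h))
      fun e => ENNReal.ofReal ((f e.1.1 - f e.1.2) ^ 2)
    exact this
  refine sequence_nash (g := fun n => f (line ε k n)) (fun n => hf _) hτ (by positivity) h1
    (by positivity) h2 ?_ n
  have : 1 / (mesh k / 2) * (4 * mesh k * dirichletForm ⇑f ⇑f) = 8 * dirichletForm ⇑f ⇑f := by
    field_simp; ring
  rw [this]
  linarith

theorem tsum_planeExcess_sq_le (hf : ∀ x, 0 ≤ f x) (hw : weight (fun _ => 1) f ≤ 1) {τ : ℝ}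
    (hτ : 0 < τ) (h2 : 256 * dirichletForm ⇑f ⇑f ≤ τ ^ 2) :
    ∑' z, ENNReal.ofReal (planeExcess f z ^ 2) ≤ ENNReal.ofReal (8 * τ / mesh k ^ 2) := by
  have hm := mesh_pos k
  have he := dirichletForm_self_nonneg f
  have hE : ∀ T : ℤ × ℤ → ℤ × ℤ, Function.Injective T → (∀ z, LatticeAdj z (T z)) →
      ∑' z, ENNReal.ofReal ((planeExcess f (T z) - planeExcess f z) ^ 2) ≤
        ENNReal.ofReal (16 * dirichletForm ⇑f ⇑f) := by
    intro T hT hadj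
    calc ∑' z, ENNReal.ofReal ((planeExcess f (T z) - planeExcess f z) ^ 2)
        ≤ ∑' z, ENNReal.ofReal ((f (proj ε k (T z)) - f (proj ε k z)) ^ 2) :=
          ENNReal.tsum_le_tsum fun z => ENNReal.ofReal_le_ofReal (planeExcess_sub_sq_le _ _ _)
      _ ≤ 2 * ENNReal.ofReal (8 * dirichletForm ⇑f ⇑f) :=
          (tsum_lattice_le_two_mul hT hadj).trans (mul_le_mul_right (tsum_planeEdges_le f) _)
      _ = _ := by
          rw [two_mul, ← ENNReal.ofReal_add (by positivity) (by positivity)]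
          congr 1
          ring
  -- The excess vanishes on the disc and is at most `f` outside it, so extending to all of `ℤ²`
  -- costs no mass; plane vertices have mass at least `mesh k ^ 2 / 4`.
  have h1 : ∑' z, ENNReal.ofReal (planeExcess f z) ≤ ENNReal.ofReal (4 / mesh k ^ 2) := by
    have hsupp : Function.support (fun z => ENNReal.ofReal (planeExcess f z)) ⊆
        {z | ε < ‖pt k z‖} := by
      intro z hz
      by_contra h
      refine hz ?_
      simp only
      rw [planeExcess_of_le _ (not_lt.mp h), ENNReal.ofReal_zero]
    rw [← tsum_subtype_eq_of_support_subset hsupp]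
    have h := tsum_le_of_le_mass (i := fun z : {z : ℤ × ℤ // ε < ‖pt k z‖} => plane z)
      (fun z w h => by simpa using h) (a := mesh k ^ 2 / 4) (by positivity) hf hw
      fun z => le_mass _
    rw [one_div_div] at h
    refine le_trans (ENNReal.tsum_le_tsum fun z => ENNReal.ofReal_le_ofReal ?_) h
    change max (f (proj ε k z.1) - f darn) 0 ≤ f (plane z)
    rw [proj_of_lt z.2]
    exact max_le (sub_le_self _ (hf darn)) (hf _)
  have hX := hE (fun z => (z.1 + 1, z.2)) (fun z w h => by simpa [Prod.ext_iff] using h)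
    fun z => latticeAdj_iff.mpr (Or.inl rfl)
  have hY := hE (fun z => (z.1, z.2 + 1)) (fun z w h => by simpa [Prod.ext_iff] using h)
    fun z => latticeAdj_iff.mpr (Or.inr (Or.inr (Or.inl rfl)))
  refine (lattice_nash (planeExcess_nonneg f) hτ (by positivity) (by linarith)
    (by positivity) h1 hX hY).trans (le_of_eq ?_)
  congr 1
  ring

/-- A Nash inequality on `E^k`, uniform in `k` and `ε`. -/
theorem norm_sq_le_of_dirichletForm_le (hf : ∀ x, 0 ≤ f x) (hw : weight (fun _ => 1) f ≤ 1)
    {τ : ℝ} (hτ : 0 < τ) (h2 : 256 * dirichletForm ⇑f ⇑f ≤ τ ^ 2)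
    (h3 : 256 * dirichletForm ⇑f ⇑f ≤ τ ^ 3) : ‖f‖ ^ 2 ≤ 18 * τ := by
  have hm := mesh_pos k
  have hline := apply_line_le hf hw hτ h3
  have hdarn : f darn ≤ τ := hline 0
  set H : Vertex ε k → ℝ≥0∞ := fun x => match x with
    | plane z => ENNReal.ofReal (planeExcess f z.1 ^ 2)
    | darn => 0
    | half _ => 0 with hH
  have hHsum : ∑' x, H x ≤ ENNReal.ofReal (8 * τ / mesh k ^ 2) := by
    refine le_trans ?_ (tsum_planeExcess_sq_le hf hw hτ h2)
    have hinj : Function.Injective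
        (fun z : {z : ℤ × ℤ // ε < ‖pt k z‖} => (plane z : Vertex ε k)) :=
      fun z w h => by simpa using h
    rw [← hinj.tsum_eq]
    · exact ENNReal.tsum_comp_le_tsum_of_injective Subtype.val_injective
        fun z => ENNReal.ofReal (planeExcess f z ^ 2)
    · rintro (z | _ | n) hx
      · exact ⟨z, rfl⟩
      · exact absurd rfl hx
      · exact absurd rfl hx
  have hpt : ∀ x, ENNReal.ofReal (f x ^ 2) * ENNReal.ofReal (mass x) ≤
      ENNReal.ofReal (2 * mesh k ^ 2) * H x +
        ENNReal.ofReal (2 * τ) * (ENNReal.ofReal (f x) * ENNReal.ofReal (1 * mass x)) := by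
    intro x
    have hx := hf x
    have hmass := mass_pos x
    have hsmall : f x ≤ τ → ENNReal.ofReal (f x ^ 2) * ENNReal.ofReal (mass x) ≤
        ENNReal.ofReal (2 * τ) * (ENNReal.ofReal (f x) * ENNReal.ofReal (1 * mass x)) := by
      intro h
      rw [← ENNReal.ofReal_mul (sq_nonneg _), ← ENNReal.ofReal_mul hx,
        ← ENNReal.ofReal_mul (by positivity)]
      refine ENNReal.ofReal_le_ofReal ?_
      have : f x ^ 2 ≤ 2 * τ * f x := by nlinarith
      calc f x ^ 2 * mass x ≤ 2 * τ * f x * mass x :=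
            mul_le_mul_of_nonneg_right this hmass.le
        _ = _ := by ring
    rcases x with z | _ | n
    · simp only [hH]
      rw [← ENNReal.ofReal_mul (sq_nonneg _), ← ENNReal.ofReal_mul hx,
        ← ENNReal.ofReal_mul (by positivity), ← ENNReal.ofReal_mul (by positivity),
        ← ENNReal.ofReal_add (by positivity) (by positivity)]
      refine ENNReal.ofReal_le_ofReal ?_
      have hml := mass_plane_le z
      have hd := hf darn
      have hexc : planeExcess f z.1 = max (f (plane z) - f darn) 0 := by
        rw [planeExcess, proj_coe]
      have hGpos := planeExcess_nonneg f z.1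
      -- Split `f` into its excess and a part at most `f darn ≤ τ`. After integration the two terms
      -- give `16 τ` and `2 τ`, whence the `18 τ`.
      have hsq : f (plane z) ^ 2 ≤ 2 * planeExcess f z.1 ^ 2 + 2 * τ * f (plane z) := by
        rcases le_total (f (plane z)) (f darn) with h | h
        · nlinarith
        · rw [hexc, max_eq_left (sub_nonneg.mpr h)]
          nlinarith [sq_nonneg (f (plane z) - 2 * f darn)]
      calc f (plane z) ^ 2 * mass (plane z)
          ≤ (2 * planeExcess f z.1 ^ 2 + 2 * τ * f (plane z)) * mass (plane z) :=
            mul_le_mul_of_nonneg_right hsq hmass.le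
        _ ≤ _ := by nlinarith [mul_le_mul_of_nonneg_left hml (sq_nonneg (planeExcess f z.1))]
    · exact (hsmall hdarn).trans le_add_self
    · exact (hsmall (by rw [← line_coe n]; exact hline n)).trans le_add_self
  have hfinal : ENNReal.ofReal (‖f‖ ^ 2) ≤ ENNReal.ofReal (18 * τ) := by
    rw [← tsum_sq_mass]
    refine (ENNReal.tsum_le_tsum hpt).trans ?_
    rw [ENNReal.tsum_add, ENNReal.tsum_mul_left, ENNReal.tsum_mul_left]
    refine (add_le_add (mul_le_mul_right hHsum _) (mul_le_mul_right hw _)).trans (le_of_eq ?_)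
    rw [mul_one, ← ENNReal.ofReal_mul (by positivity),
      ← ENNReal.ofReal_add (by positivity) (by positivity)]
    congr 1
    field_simp
    norm_num
  exact (ENNReal.ofReal_le_ofReal_iff (by positivity)).mp hfinal

/-! ## The on-diagonal upper bound -/

theorem hasDerivAt_semigroup (t : ℝ) (g : L2 ε k) :
    HasDerivAt (fun t => semigroup ε k t g) (-(formOperator ε k (semigroup ε k t g))) t := by
  have h : HasDerivAt (fun t : ℝ => semigroup ε k t)
      (-formOperator ε k * semigroup ε k t) t := by
    have := hasDerivAt_exp_smul_const' (𝕂 := ℝ) (-formOperator ε k) t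
    simpa only [semigroup, smul_neg, neg_smul] using this
  have h1 := h.clm_apply (hasDerivAt_const t g)
  simpa using h1

theorem hasDerivAt_norm_sq_semigroup (t : ℝ) (g : L2 ε k) :
    HasDerivAt (fun t => ‖semigroup ε k t g‖ ^ 2)
      (-(2 * dirichletForm ⇑(semigroup ε k t g) ⇑(semigroup ε k t g))) t := by
  convert (hasDerivAt_semigroup t g).norm_sq using 1
  rw [inner_neg_right, real_inner_comm, inner_formOperator]
  ring

/-- The operator is bounded, so the semigroup extends to a group and is invertible. This permits
division by the norm in the differential inequality. -/
theorem semigroup_apply_ne_zero (t : ℝ) {g : L2 ε k} (hg : g ≠ 0) : semigroup ε k t g ≠ 0 := by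
  intro h
  have h1 : semigroup ε k (-t + t) g = semigroup ε k (-t) (semigroup ε k t g) := by
    rw [semigroup_add]; rfl
  rw [h, map_zero, neg_add_cancel, semigroup_zero] at h1
  exact hg h1

theorem deltaL2_ne_zero (x : Vertex ε k) : deltaL2 x ≠ 0 := by
  intro h
  have h1 := inner_deltaL2 (deltaL2 x) x
  rw [coe_deltaL2, Set.indicator_of_mem (Set.mem_singleton x), h, inner_zero_left] at h1
  exact (inv_pos.mpr (mass_pos x)).ne h1

theorem weight_one_semigroup_deltaL2_le {t : ℝ} (ht : 0 ≤ t) (x : Vertex ε k) :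
    weight (fun _ => 1) (semigroup ε k t (deltaL2 x)) ≤ 1 := by
  have := weight_semigroup_le isSuper_one zero_le_one ht (deltaL2_nonneg x)
  simpa [weight_deltaL2] using this

/-- If the energy were smaller, the Nash inequality with `τ = ‖f‖² / 19` would give `‖f‖² ≤ (18/19)
‖f‖²`. -/
theorem min_le_dirichletForm (hf : ∀ x, 0 ≤ f x) (hw : weight (fun _ => 1) f ≤ 1) (hf0 : f ≠ 0) :
    min ((‖f‖ ^ 2) ^ 2) ((‖f‖ ^ 2) ^ 3) ≤ 256 * 19 ^ 3 * dirichletForm ⇑f ⇑f := by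
  have hu : 0 < ‖f‖ ^ 2 := by positivity
  set u := ‖f‖ ^ 2 with hudef
  by_contra! h
  obtain ⟨ha, hb⟩ := lt_min_iff.mp h
  have := norm_sq_le_of_dirichletForm_le hf hw (τ := u / 19) (by positivity)
    (by rw [div_pow, le_div_iff₀ (by positivity)]; linarith [dirichletForm_self_nonneg f])
    (by rw [div_pow, le_div_iff₀ (by positivity)]; linarith)
  rw [← hudef] at this
  linarith

theorem norm_sq_semigroup_deltaL2_le {t : ℝ} (ht : 0 < t) (x : Vertex ε k) :
    ‖semigroup ε k t (deltaL2 x)‖ ^ 2 ≤ 256 * 19 ^ 3 * max (1 / t) (1 / √t) := by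
  set K : ℝ := 256 * 19 ^ 3 with hK
  have hK0 : 0 < K := by norm_num [hK]
  set u : ℝ → ℝ := fun s => ‖semigroup ε k s (deltaL2 x)‖ ^ 2 with hu
  have hupos : ∀ s, 0 < u s := fun s =>
    pow_pos (norm_pos_iff.mpr (semigroup_apply_ne_zero s (deltaL2_ne_zero x))) 2
  set E : ℝ → ℝ := fun s =>
    dirichletForm ⇑(semigroup ε k s (deltaL2 x)) ⇑(semigroup ε k s (deltaL2 x)) with hE
  have hder : ∀ s, HasDerivAt u (-(2 * E s)) s := fun s => hasDerivAt_norm_sq_semigroup s _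
  have hnash : ∀ s, 0 ≤ s → min (u s ^ 2) (u s ^ 3) ≤ K * E s := fun s hs =>
    min_le_dirichletForm (semigroup_nonneg hs (deltaL2_nonneg x))
      (weight_one_semigroup_deltaL2_le hs x) (semigroup_apply_ne_zero s (deltaL2_ne_zero x))
  -- From `u' = -2E` and `min (u², u³) ≤ K E`, the function `1/u + 1/(2u²)` has derivative `2E (1/u²
  -- + 1/u³) ≥ 2/K`, so `F` increases. One potential thus handles both dimensions.
  set F : ℝ → ℝ := fun s => (u s)⁻¹ + (u s)⁻¹ ^ 2 / 2 - 2 / K * s with hF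
  have hFder : ∀ s, HasDerivAt F (2 * E s / u s ^ 2 * (1 + (u s)⁻¹) - 2 / K) s := by
    intro s
    have h1 := (hder s).inv (hupos s).ne'
    have h2 := (h1.add ((h1.pow 2).div_const 2)).sub ((hasDerivAt_id s).const_mul (2 / K))
    refine h2.congr_deriv ?_
    simp only [Pi.inv_apply]
    field_simp
    ring
  have hmono : MonotoneOn F (Set.Icc 0 t) := by
    refine monotoneOn_of_deriv_nonneg (convex_Icc 0 t)
      (fun s _ => (hFder s).continuousAt.continuousWithinAt)
      (fun s _ => (hFder s).differentiableAt.differentiableWithinAt) fun s hs => ?_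
    rw [interior_Icc] at hs
    rw [(hFder s).deriv, sub_nonneg]
    have hus := hupos s
    have h1 := hnash s hs.1.le
    have h2 : u s ^ 2 ≤ K * E s * (1 + (u s)⁻¹) := by
      rcases le_total (u s) 1 with h | h
      · have h3 : u s ^ 3 ≤ K * E s := by
          refine le_trans (le_min ?_ le_rfl) h1
          nlinarith [pow_pos hus 2]
        calc u s ^ 2 ≤ u s ^ 3 * (1 + (u s)⁻¹) := by
              have e : u s ^ 3 * (u s)⁻¹ = u s ^ 2 := by field_simp
              rw [mul_add, e]
              linarith [pow_pos hus 3]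
          _ ≤ _ := mul_le_mul_of_nonneg_right h3 (by positivity)
      · have h3 : u s ^ 2 ≤ K * E s := by
          refine le_trans (le_min le_rfl ?_) h1
          nlinarith [pow_pos hus 2]
        have h4 : 0 ≤ K * E s := (by positivity : 0 ≤ u s ^ 2).trans h3
        have h5 : 0 ≤ K * E s * (u s)⁻¹ := mul_nonneg h4 (by positivity)
        linarith
    rw [div_mul_eq_mul_div, div_le_div_iff₀ hK0 (by positivity)]
    nlinarith
  have h0 := hmono (Set.left_mem_Icc.mpr ht.le) (Set.right_mem_Icc.mpr ht.le) ht.le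
  have hF0 : 0 ≤ F 0 := by
    have := hupos 0
    simp only [hF, mul_zero, sub_zero]
    positivity
  have hFt := hF0.trans h0
  change u t ≤ _
  have hut := hupos t
  set w := (u t)⁻¹ with hw
  have hwpos : 0 < w := inv_pos.mpr hut
  have huw : u t = 1 / w := by rw [hw, one_div, inv_inv]
  have hFt' : 2 / K * t ≤ w + w ^ 2 / 2 := by
    simp only [hF] at hFt
    linarith
  -- Either the linear term already gives `u ≤ K / t`, or the quadratic term carries the inequality
  -- and gives `u ≤ K / √t`.
  rcases le_or_gt (t / K) w with h | h
  · refine le_trans ?_ (mul_le_mul_of_nonneg_left (le_max_left _ _) hK0.le)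
    rw [huw, mul_one_div]
    rw [div_le_div_iff₀ hwpos ht]
    rw [div_le_iff₀ hK0] at h
    linarith
  · refine le_trans ?_ (mul_le_mul_of_nonneg_left (le_max_right _ _) hK0.le)
    have h1 : 2 / K * t = 2 * (t / K) := by ring
    have h2 : t / K ≤ w ^ 2 := by nlinarith [sq_nonneg w]
    rw [div_le_iff₀ hK0] at h2
    have hst : √t ≤ K * w := by
      refine Real.sqrt_le_iff.mpr ⟨by positivity, h2.trans ?_⟩
      have : (1 : ℝ) ≤ K := by norm_num [hK]
      nlinarith [sq_nonneg w]
    rw [huw, mul_one_div, div_le_div_iff₀ hwpos (Real.sqrt_pos.mpr ht)]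
    linarith

theorem max_one_div_half_le {t : ℝ} (ht : 0 < t) :
    max (1 / (t / 2)) (1 / √(t / 2)) ≤ 2 * max (1 / t) (1 / √t) := by
  have ht2 : 0 < t / 2 := half_pos ht
  refine max_le ?_ ?_
  · rw [one_div_div, ← mul_one_div]
    exact mul_le_mul_of_nonneg_left (le_max_left _ _) zero_le_two
  · refine le_trans ?_ (mul_le_mul_of_nonneg_left (le_max_right _ _) zero_le_two)
    rw [mul_one_div, div_le_div_iff₀ (Real.sqrt_pos.mpr ht2) (Real.sqrt_pos.mpr ht), one_mul]
    refine Real.sqrt_le_iff.mpr ⟨by positivity, ?_⟩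
    rw [mul_pow, Real.sq_sqrt ht2.le]
    linarith

theorem heatKernel_le {t : ℝ} (ht : 0 < t) (x y : Vertex ε k) :
    heatKernel t x y ≤ 2 * (256 * 19 ^ 3) * max (1 / t) (1 / √t) := by
  have ht2 : 0 < t / 2 := half_pos ht
  set B := 256 * 19 ^ 3 * max (1 / (t / 2)) (1 / √(t / 2)) with hB
  have h1 : heatKernel t x y ≤ B := by
    rw [show t = t / 2 + t / 2 by ring, heatKernel_eq_inner]
    have hx := norm_sq_semigroup_deltaL2_le ht2 x
    have hy := norm_sq_semigroup_deltaL2_le ht2 y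
    have h2 := real_inner_le_norm (semigroup ε k (t / 2) (deltaL2 x))
      (semigroup ε k (t / 2) (deltaL2 y))
    nlinarith [sq_nonneg (‖semigroup ε k (t / 2) (deltaL2 x)‖ -
      ‖semigroup ε k (t / 2) (deltaL2 y)‖)]
  refine h1.trans ?_
  rw [hB, mul_comm (2 : ℝ), mul_assoc (256 * 19 ^ 3) (2 : ℝ)]
  exact mul_le_mul_of_nonneg_left (max_one_div_half_le ht) (by norm_num)

/-! ## Exponential supersolutions -/

/-- A minimum of supersolutions is one, and `F` matters only where it is the strictly smaller of the
two. This allows `F` to fail at the junction of the components. -/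
theorem isSuper_min {θ g : ℝ} (hg : 0 ≤ g) {F C : Vertex ε k → ℝ} (hC : IsSuper θ C)
    (hF : ∀ x, 0 ≤ F x) (h : ∀ x, F x < g * C x →
      ∑ y ∈ nbrs x, cond x y * F y ≤ θ * (∑ y ∈ nbrs x, cond x y) * F x) :
    IsSuper θ fun x => min (F x) (g * C x) := by
  refine ⟨fun x => le_min (hF x) (mul_nonneg hg (hC.nonneg x)), fun x => ?_⟩
  rcases lt_or_ge (F x) (g * C x) with hx | hx
  · rw [min_eq_left hx.le]
    exact (Finset.sum_le_sum fun y _ => mul_le_mul_of_nonneg_left (min_le_left _ _)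
      (cond_nonneg x y)).trans (h x hx)
  · rw [min_eq_right hx]
    calc ∑ y ∈ nbrs x, cond x y * min (F y) (g * C y)
        ≤ ∑ y ∈ nbrs x, g * (cond x y * C y) := Finset.sum_le_sum fun y _ => by
          rw [mul_left_comm]
          exact mul_le_mul_of_nonneg_left (min_le_right _ _) (cond_nonneg x y)
      _ ≤ g * (θ * (∑ y ∈ nbrs x, cond x y) * C x) := by
          rw [← Finset.mul_sum]
          exact mul_le_mul_of_nonneg_left (hC.sum_le x) hg
      _ = _ := by ring

theorem sum_cond_mul_le_of_forall_le {θ : ℝ} {φ : Vertex ε k → ℝ} {x : Vertex ε k}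
    (h : ∀ y, (graph ε k).Adj x y → φ y ≤ θ * φ x) :
    ∑ y ∈ nbrs x, cond x y * φ y ≤ θ * (∑ y ∈ nbrs x, cond x y) * φ x := by
  rw [mul_right_comm, Finset.mul_sum]
  refine Finset.sum_le_sum fun y hy => ?_
  rw [mul_comm _ (cond x y)]
  exact mul_le_mul_of_nonneg_left (h y (mem_nbrs.mp hy)) (cond_nonneg x y)

theorem lt_norm_pt_of_latticeAdj {z : {z : ℤ × ℤ // ε < ‖pt k z‖}}
    (hz : ¬ (graph ε k).Adj (plane z) darn) {w : ℤ × ℤ} (hw : LatticeAdj z.1 w) :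
    ε < ‖pt k w‖ := by
  by_contra h
  exact hz (adj_plane_iff.mpr ⟨w, hw, (proj_of_le (not_lt.mp h)).symm⟩)

/-- Away from the darning point the four lattice neighbours stay distinct under `proj`, so the
inequality is one for the simple random walk on `ℤ²`. -/
theorem sum_cond_mul_plane_le {θ : ℝ} {φ : Vertex ε k → ℝ} {ψ : ℤ × ℤ → ℝ}
    (hφ : ∀ z, φ (plane z) = ψ z.1) {z : {z : ℤ × ℤ // ε < ‖pt k z‖}}
    (hz : ¬ (graph ε k).Adj (plane z) darn)
    (h : ψ (z.1.1 + 1, z.1.2) + ψ (z.1.1 - 1, z.1.2) + ψ (z.1.1, z.1.2 + 1) +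
      ψ (z.1.1, z.1.2 - 1) ≤ 4 * (θ * ψ z.1)) :
    ∑ y ∈ nbrs (plane z), cond (plane z) y * φ y ≤
      θ * (∑ y ∈ nbrs (plane z), cond (plane z) y) * φ (plane z) := by
  classical
  have hsum : ∀ f : Vertex ε k → ℝ,
      ∑ y ∈ nbrs (plane z), f y = ∑ w ∈ latticeNbrs z.1, f (proj ε k w) := by
    intro f
    rw [nbrs_plane, Finset.sum_image]
    intro v hv w hw hvw
    have h1 := lt_norm_pt_of_latticeAdj hz (mem_latticeNbrs.mp hv)
    rw [proj_of_lt h1] at hvw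
    exact (proj_eq_plane_iff.mp hvw.symm).symm
  have hc : ∀ w ∈ latticeNbrs z.1, cond (plane z) (proj ε k w) = 1 / 4 := fun w hw =>
    cond_plane (adj_plane_iff.mpr ⟨w, mem_latticeNbrs.mp hw, rfl⟩)
  have hp : ∀ w ∈ latticeNbrs z.1, cond (plane z) (proj ε k w) * φ (proj ε k w) =
      1 / 4 * ψ w := fun w hw => by
    rw [hc w hw, proj_of_lt (lt_norm_pt_of_latticeAdj hz (mem_latticeNbrs.mp hw)), hφ]
  rw [hsum, hsum, Finset.sum_congr rfl hp, Finset.sum_congr rfl hc, Finset.sum_const,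
    card_latticeNbrs, ← Finset.mul_sum, sum_latticeNbrs, hφ]
  simp only [nsmul_eq_mul]
  push_cast
  linarith

theorem sum_cond_mul_half_le {θ : ℝ} {φ : Vertex ε k → ℝ} {n : ℕ+}
    (h : φ (line ε k (n + 1)) + φ (line ε k (n - 1)) ≤ 2 * (θ * φ (half n))) :
    ∑ y ∈ nbrs (half n : Vertex ε k), cond (half n) y * φ y ≤
      θ * (∑ y ∈ nbrs (half n : Vertex ε k), cond (half n) y) * φ (half n) := by
  classical
  have hn : nbrs (half n : Vertex ε k) = {line ε k (n + 1), line ε k (n - 1)} := by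
    ext y
    rw [mem_nbrs, adj_half_iff, Finset.mem_insert, Finset.mem_singleton]
  have hne : line ε k (n + 1) ≠ line ε k (n - 1) := fun h => by
    have := line_injective h
    omega
  rw [hn, Finset.sum_pair hne, Finset.sum_pair hne, cond_half (adj_half_iff.mpr (Or.inl rfl)),
    cond_half (adj_half_iff.mpr (Or.inr rfl))]
  have h2 : (0 : ℝ) ≤ 2 ^ k / 2 := by positivity
  linear_combination (2 ^ k / 2) * h

/-- For `u ≥ 0` drop the truncation and use the addition formula; for `u ≤ 0` both arguments on the
left lie in `[0, |a|]`. Flattening `cosh` on the negative side thus preserves the supersolution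
property. -/
theorem cosh_max_add_cosh_max_le {β u a : ℝ} (ha : |a| ≤ 1) :
    Real.cosh (β * max (u + a) 0) + Real.cosh (β * max (u - a) 0) ≤
      2 * (Real.cosh β * Real.cosh (β * max u 0)) := by
  have hmono : ∀ b c : ℝ, |b| ≤ |c| → Real.cosh (β * b) ≤ Real.cosh (β * c) := fun b c h => by
    rw [Real.cosh_le_cosh, abs_mul, abs_mul]
    exact mul_le_mul_of_nonneg_left h (abs_nonneg β)
  have hmax : ∀ b : ℝ, |max b 0| ≤ |b| := fun b => by
    rw [abs_of_nonneg (le_max_right b 0)]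
    exact max_le (le_abs_self b) (abs_nonneg b)
  have hcoshβ : Real.cosh (β * a) ≤ Real.cosh β := by
    simpa using hmono a 1 (by simpa using ha)
  rcases le_total 0 u with hu | hu
  · rw [max_eq_left hu]
    calc Real.cosh (β * max (u + a) 0) + Real.cosh (β * max (u - a) 0)
        ≤ Real.cosh (β * (u + a)) + Real.cosh (β * (u - a)) :=
          add_le_add (hmono _ _ (hmax _)) (hmono _ _ (hmax _))
      _ = 2 * (Real.cosh (β * a) * Real.cosh (β * u)) := by
          rw [mul_add, mul_sub, Real.cosh_add, Real.cosh_sub]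
          ring
      _ ≤ _ := by
          have := mul_le_mul_of_nonneg_right hcoshβ (Real.cosh_pos (β * u)).le
          linarith
  · rw [max_eq_right hu, mul_zero, Real.cosh_zero, mul_one]
    have h : ∀ b : ℝ, b ≤ |a| → Real.cosh (β * max b 0) ≤ Real.cosh β := fun b hb => by
      refine (hmono _ _ ?_).trans hcoshβ
      rw [abs_of_nonneg (le_max_right b 0)]
      exact max_le hb (abs_nonneg a)
    linarith [h (u + a) (by linarith [le_abs_self a]), h (u - a) (by linarith [neg_abs_le a])]

theorem half_exp_abs_le_cosh (u : ℝ) : 1 / 2 * Real.exp |u| ≤ Real.cosh u := by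
  rw [← Real.cosh_abs, Real.cosh_eq]
  linarith [Real.exp_pos (-|u|)]

/-- The number `|a| + |b|` is always one of `|a + b|` and `|a - b|`, so the corresponding `cosh`
alone suffices. -/
theorem half_exp_le_cosh_add_cosh {β : ℝ} (hβ : 0 ≤ β) (a b : ℝ) :
    1 / 2 * Real.exp (β * (|a| + |b|)) ≤ Real.cosh (β * (a + b)) + Real.cosh (β * (a - b)) := by
  have h1 := half_exp_abs_le_cosh (β * (a + b))
  have h2 := half_exp_abs_le_cosh (β * (a - b))
  have h3 := Real.cosh_pos (β * (a + b))
  have h4 := Real.cosh_pos (β * (a - b))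
  rw [abs_mul, abs_of_nonneg hβ] at h1 h2
  have h5 : |a| + |b| = |a + b| ∨ |a| + |b| = |a - b| := by
    rcases le_total 0 a with ha | ha <;> rcases le_total 0 b with hb | hb
    · left; rw [abs_of_nonneg ha, abs_of_nonneg hb, abs_of_nonneg (add_nonneg ha hb)]
    · right; rw [abs_of_nonneg ha, abs_of_nonpos hb, abs_of_nonneg (by linarith)]; ring
    · right; rw [abs_of_nonpos ha, abs_of_nonneg hb, abs_of_nonpos (by linarith)]; ring
    · left; rw [abs_of_nonpos ha, abs_of_nonpos hb, abs_of_nonpos (by linarith)]; ring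
  rcases h5 with h5 | h5 <;> rw [h5] <;> linarith

/-! ### Directional components, levels and heights -/

/-- The component of `z` in the direction of `w`. -/
noncomputable def directional (w z : ℤ × ℤ) : ℝ :=
  ((w.1 : ℝ) * z.1 + (w.2 : ℝ) * z.2) / rad w

theorem directional_le_rad (w z : ℤ × ℤ) : directional w z ≤ rad z := by
  rcases (rad_nonneg w).eq_or_lt with h | h
  · rw [directional, ← h, div_zero]
    exact rad_nonneg z
  · rw [directional, div_le_iff₀ h]
    refine abs_le_of_sq_le_sq' ?_ (mul_nonneg (rad_nonneg z) h.le) |>.2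
    rw [mul_pow, rad_sq, rad_sq]
    nlinarith [sq_nonneg ((w.1 : ℝ) * z.2 - (w.2 : ℝ) * z.1)]

theorem abs_fst_le_rad (z : ℤ × ℤ) : |(z.1 : ℝ)| ≤ rad z :=
  Real.abs_le_sqrt (by linarith [sq_nonneg (z.2 : ℝ)])

theorem abs_snd_le_rad (z : ℤ × ℤ) : |(z.2 : ℝ)| ≤ rad z :=
  Real.abs_le_sqrt (by linarith [sq_nonneg (z.1 : ℝ)])

/-- A unit vector has entries of modulus at most `1`, so its linear functional is `1`-Lipschitz for
`ℓ¹`. -/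
theorem directional_le_add (w z z' : ℤ × ℤ) :
    directional w z ≤ directional w z' + gridDist z z' := by
  rcases (rad_nonneg w).eq_or_lt with h | h
  · simp [directional, ← h]
  · rw [directional, directional, div_add' _ _ _ h.ne', div_le_div_iff_of_pos_right h, gridDist_cast]
    have h1 : (w.1 : ℝ) * (z.1 - z'.1) ≤ rad w * |(z.1 : ℝ) - z'.1| := by
      refine (le_abs_self _).trans ?_
      rw [abs_mul]
      exact mul_le_mul_of_nonneg_right (abs_fst_le_rad w) (abs_nonneg _)
    have h2 : (w.2 : ℝ) * (z.2 - z'.2) ≤ rad w * |(z.2 : ℝ) - z'.2| := by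
      refine (le_abs_self _).trans ?_
      rw [abs_mul]
      exact mul_le_mul_of_nonneg_right (abs_snd_le_rad w) (abs_nonneg _)
    linarith

theorem directional_self (w : ℤ × ℤ) : directional w w = rad w := by
  rcases (rad_nonneg w).eq_or_lt with h | h
  · rw [directional, ← h, div_zero]
  · rw [directional, div_eq_iff h.ne', ← sq (rad w), rad_sq]
    ring

theorem rad_le_add (w z : ℤ × ℤ) : rad w ≤ rad z + gridDist w z := by
  have h1 := directional_le_add w w z
  rw [directional_self] at h1
  linarith [directional_le_rad w z]

theorem gridDist_of_latticeAdj {z w : ℤ × ℤ} (h : LatticeAdj z w) : gridDist z w = 1 := by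
  rcases latticeAdj_iff.mp h with rfl | rfl | rfl | rfl <;> simp [gridDist]

/-- This is the reason for the `- 1` in `height`: the height then vanishes at every plane neighbour
of the darning point, where several lattice bonds may have been merged. -/
theorem rad_le_of_adj_darn {z : {z : ℤ × ℤ // ε < ‖pt k z‖}}
    (h : (graph ε k).Adj (plane z) darn) : rad z.1 ≤ ε / mesh k + 1 := by
  obtain ⟨w, hw, hw'⟩ := adj_plane_iff.mp h
  have h1 := proj_eq_darn_iff.mp hw'.symm
  rw [norm_pt, ← le_div_iff₀' (mesh_pos k)] at h1
  have h2 := rad_le_add z.1 w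
  rw [gridDist_of_latticeAdj hw] at h2
  push_cast at h2
  linarith

/-- A lower bound, up to a constant factor and in units of the mesh size, for the distance to the
darning point. -/
noncomputable def level : Vertex ε k → ℝ
  | plane z => rad z.1 - ε / mesh k - 1
  | darn => 0
  | half n => (n : ℕ)

/-- The height above the darning point in the direction of the first argument. -/
noncomputable def height : Vertex ε k → Vertex ε k → ℝ
  | plane w, plane z => max (directional w.1 z.1 - ε / mesh k - 1) 0
  | half _, half n => (n : ℕ)
  | _, _ => 0

theorem height_nonneg (x z : Vertex ε k) : 0 ≤ height x z := by
  rcases x with w | _ | m <;> rcases z with z | _ | n <;> simp [height]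

theorem height_darn (x : Vertex ε k) : height x darn = 0 := by
  rcases x with w | _ | m <;> rfl

theorem height_half_line (m : ℕ+) (j : ℕ) : height (half m) (line ε k j) = j := by
  cases j with
  | zero => simp [line, height]
  | succ j => simp [line, height]

theorem height_line_of_not_isHalf {x : Vertex ε k} (hx : ¬ x.IsHalf) (j : ℕ) :
    height x (line ε k j) = 0 := by
  rcases x with w | _ | m
  · cases j <;> rfl
  · cases j <;> rfl
  · exact absurd trivial hx

theorem height_proj_of_not_isPlane {x : Vertex ε k} (hx : ¬ x.IsPlane) (z : ℤ × ℤ) :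
    height x (proj ε k z) = 0 := by
  by_cases hz : ε < ‖pt k z‖
  · rw [proj_of_lt hz]
    rcases x with w | _ | m
    · exact absurd trivial hx
    · rfl
    · rfl
  · rw [proj_of_le (not_lt.mp hz), height_darn]

theorem height_plane_of_adj_darn (x : Vertex ε k) {z : {z : ℤ × ℤ // ε < ‖pt k z‖}}
    (h : (graph ε k).Adj (plane z) darn) : height x (plane z) = 0 := by
  rcases x with w | _ | m
  · have h1 := rad_le_of_adj_darn h
    have h2 := directional_le_rad w.1 z.1
    exact max_eq_right (by linarith)
  · rfl
  · rfl

theorem height_le_one_of_adj_darn (x : Vertex ε k) {y : Vertex ε k}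
    (h : (graph ε k).Adj darn y) : height x y ≤ 1 := by
  rcases y with z | _ | n
  · rw [height_plane_of_adj_darn x h.symm]
    exact zero_le_one
  · exact h.elim
  · obtain rfl := adj_darn_half_iff.mp h
    rcases x with w | _ | m <;> simp [height]

theorem height_plane_le_add_one (x : Vertex ε k) {z : {z : ℤ × ℤ // ε < ‖pt k z‖}}
    {y : Vertex ε k} (h : (graph ε k).Adj (plane z) y) :
    height x y ≤ height x (plane z) + 1 := by
  have h0 := height_nonneg x (plane z)
  rcases y with z' | _ | n
  · rcases x with w | _ | m
    · obtain ⟨v, hv, hv'⟩ := adj_plane_iff.mp h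
      obtain rfl := proj_eq_plane_iff.mp hv'.symm
      have h1 := directional_le_add w.1 z'.1 z.1
      rw [gridDist_of_latticeAdj hv.symm] at h1
      push_cast at h1
      refine max_le ?_ (by linarith)
      have := le_max_left (directional w.1 z.1 - ε / mesh k - 1) 0
      change _ ≤ max (directional w.1 z.1 - ε / mesh k - 1) 0 + 1
      linarith
    · simp [height]
    · simp [height]
  · rw [height_darn]
    linarith
  · exact h.elim

/-- In the component of `x` the height is a truncated linear function, to which the `cosh`
inequality applies in each coordinate. At the darning point and its plane neighbours the height is
`0` and rises by at most `1` in a step. In the other component it vanishes. -/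
theorem isSuper_cosh_height {β : ℝ} (hβ : 0 ≤ β) (x : Vertex ε k) :
    IsSuper (Real.cosh β) fun z => Real.cosh (β * height x z) := by
  refine ⟨fun z => (Real.cosh_pos _).le, ?_⟩
  have hone : ∀ {y : Vertex ε k}, height x y ≤ 1 → Real.cosh (β * height x y) ≤ Real.cosh β := by
    intro y hy
    rw [Real.cosh_le_cosh, abs_of_nonneg (mul_nonneg hβ (height_nonneg x y)), abs_of_nonneg hβ]
    exact mul_le_of_le_one_right hβ hy
  rintro (z | _ | n)
  · by_cases hz : (graph ε k).Adj (plane z) darn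
    · refine sum_cond_mul_le_of_forall_le fun y hy => ?_
      have h0 := height_plane_of_adj_darn x hz
      have h1 := height_plane_le_add_one x hy
      rw [h0, mul_zero, Real.cosh_zero, mul_one]
      exact hone (by linarith)
    rcases x with w | _ | m
    · refine sum_cond_mul_plane_le
        (ψ := fun z => Real.cosh (β * max (directional w.1 z - ε / mesh k - 1) 0))
        (fun z => rfl) hz ?_
      have ha : |(w.1.1 : ℝ) / rad w.1| ≤ 1 := by
        rw [abs_div, abs_of_nonneg (rad_nonneg w.1)]
        exact div_le_one_of_le₀ (abs_fst_le_rad _) (rad_nonneg _)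
      have hb : |(w.1.2 : ℝ) / rad w.1| ≤ 1 := by
        rw [abs_div, abs_of_nonneg (rad_nonneg w.1)]
        exact div_le_one_of_le₀ (abs_snd_le_rad _) (rad_nonneg _)
      have h1 := cosh_max_add_cosh_max_le (β := β) (u := directional w.1 z.1 - ε / mesh k - 1) ha
      have h2 := cosh_max_add_cosh_max_le (β := β) (u := directional w.1 z.1 - ε / mesh k - 1) hb
      have e1 : directional w.1 (z.1.1 + 1, z.1.2) - ε / mesh k - 1 =
          directional w.1 z.1 - ε / mesh k - 1 + w.1.1 / rad w.1 := by
        simp only [directional]; push_cast; ring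
      have e2 : directional w.1 (z.1.1 - 1, z.1.2) - ε / mesh k - 1 =
          directional w.1 z.1 - ε / mesh k - 1 - w.1.1 / rad w.1 := by
        simp only [directional]; push_cast; ring
      have e3 : directional w.1 (z.1.1, z.1.2 + 1) - ε / mesh k - 1 =
          directional w.1 z.1 - ε / mesh k - 1 + w.1.2 / rad w.1 := by
        simp only [directional]; push_cast; ring
      have e4 : directional w.1 (z.1.1, z.1.2 - 1) - ε / mesh k - 1 =
          directional w.1 z.1 - ε / mesh k - 1 - w.1.2 / rad w.1 := by
        simp only [directional]; push_cast; ring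
      rw [e1, e2, e3, e4]
      linarith
    all_goals
      refine sum_cond_mul_le_of_forall_le fun y hy => ?_
      obtain ⟨v, -, rfl⟩ := adj_plane_iff.mp hy
      rw [height_proj_of_not_isPlane id]
      simp only [height, mul_zero, Real.cosh_zero, mul_one]
      exact Real.one_le_cosh β
  · refine sum_cond_mul_le_of_forall_le fun y hy => ?_
    rw [height_darn, mul_zero, Real.cosh_zero, mul_one]
    exact hone (height_le_one_of_adj_darn x hy)
  · by_cases hx : x.IsHalf
    · obtain ⟨m, rfl⟩ : ∃ m, x = half m := by
        rcases x with w | _ | m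
        · exact hx.elim
        · exact hx.elim
        · exact ⟨m, rfl⟩
      refine sum_cond_mul_half_le ?_
      rw [← line_coe n, height_half_line, height_half_line, height_half_line,
        Nat.cast_pred n.pos, Nat.cast_add, Nat.cast_one, mul_add, mul_sub, mul_one,
        Real.cosh_add, Real.cosh_sub]
      linarith
    · refine sum_cond_mul_half_le ?_
      rw [← line_coe n, height_line_of_not_isHalf hx, height_line_of_not_isHalf hx,
        height_line_of_not_isHalf hx, mul_zero, Real.cosh_zero, mul_one]
      linarith [Real.one_le_cosh β]

/-! ### Barriers centred at the source -/

/-- The function that bounds the growth from `x` as long as the walk stays in the component of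
`x`. -/
noncomputable def nearBarrier (β : ℝ) (x y z : Vertex ε k) : ℝ :=
  match x, z with
  | plane w, plane v => 2 * (Real.cosh (β * ((v.1.1 - w.1.1 : ℝ) + (v.1.2 - w.1.2))) +
      Real.cosh (β * ((v.1.1 - w.1.1 : ℝ) - (v.1.2 - w.1.2))))
  | half b, half n => 2 * Real.cosh (β * (((n : ℕ) : ℝ) - (b : ℕ)))
  | half b, darn => 2 * Real.cosh (β * (0 - (b : ℕ)))
  | x, z => Real.exp (β * level x) * Real.cosh (β * height y z)

/-- A supersolution that is of order `1` at `x` and grows exponentially away from `x` in the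
direction of `y`. -/
noncomputable def barrier (β : ℝ) (x y z : Vertex ε k) : ℝ :=
  min (nearBarrier β x y z) (Real.exp (β * level x) * Real.cosh (β * height y z))

theorem nearBarrier_nonneg (β : ℝ) (x y z : Vertex ε k) : 0 ≤ nearBarrier β x y z := by
  have h := fun u => (Real.cosh_pos u).le
  unfold nearBarrier
  split
  · exact mul_nonneg zero_le_two (add_nonneg (h _) (h _))
  · exact mul_nonneg zero_le_two (h _)
  · exact mul_nonneg zero_le_two (h _)
  · exact mul_nonneg (Real.exp_pos _).le (h _)

theorem exp_gridDist_le_nearBarrier {β : ℝ} (hβ : 0 ≤ β) (w v : {z : ℤ × ℤ // ε < ‖pt k z‖})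
    (y : Vertex ε k) :
    Real.exp (β * gridDist w.1 v.1) ≤ nearBarrier β (plane w) y (plane v) := by
  have h := half_exp_le_cosh_add_cosh hβ (v.1.1 - w.1.1 : ℝ) (v.1.2 - w.1.2)
  rw [gridDist_cast, abs_sub_comm, abs_sub_comm (w.1.2 : ℝ)]
  simp only [nearBarrier]
  linarith

theorem nearBarrier_half_line (β : ℝ) (b : ℕ+) (y : Vertex ε k) (j : ℕ) :
    nearBarrier β (half b) y (line ε k j) = 2 * Real.cosh (β * ((j : ℝ) - (b : ℕ))) := by
  cases j with
  | zero => simp [line, nearBarrier]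
  | succ j => simp [line, nearBarrier]

theorem exp_abs_le_two_mul_cosh (u : ℝ) : Real.exp |u| ≤ 2 * Real.cosh u := by
  linarith [half_exp_abs_le_cosh u]

/-- Inside the component of `x` the near term is an exact eigenfunction with eigenvalue `cosh β`. It
can fail only at the junction, and there it dominates the far term, whose height factor is `1`.
Everywhere else the two terms coincide by definition. -/
theorem isSuper_barrier {β : ℝ} (hβ : 0 ≤ β) (x y : Vertex ε k) :
    IsSuper (Real.cosh β) (barrier β x y) := by
  refine isSuper_min (Real.exp_pos _).le (isSuper_cosh_height hβ y) (nearBarrier_nonneg β x y) ?_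
  rcases x with w | _ | b
  · rintro (z | _ | n) hz
    · have hadj : ¬ (graph ε k).Adj (plane z) darn := by
        intro hadj
        refine hz.not_ge ?_
        rw [height_plane_of_adj_darn y hadj, mul_zero, Real.cosh_zero, mul_one]
        refine le_trans (Real.exp_le_exp.mpr (mul_le_mul_of_nonneg_left ?_ hβ))
          (exp_gridDist_le_nearBarrier hβ w z y)
        have h1 := rad_le_of_adj_darn hadj
        have h2 := rad_le_add w.1 z.1
        simp only [level]
        linarith
      refine sum_cond_mul_plane_le
        (ψ := fun v => 2 * (Real.cosh (β * ((v.1 - w.1.1 : ℝ) + (v.2 - w.1.2))) +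
          Real.cosh (β * ((v.1 - w.1.1 : ℝ) - (v.2 - w.1.2))))) (fun v => rfl) hadj (le_of_eq ?_)
      push_cast
      -- In the rotated coordinates `p`, `q` every lattice step changes both by `±1`, so each `cosh`
      -- is multiplied by `cosh β` on average.
      generalize hp : ((z.1.1 : ℝ) - w.1.1) + (z.1.2 - w.1.2) = p
      generalize hq : ((z.1.1 : ℝ) - w.1.1) - (z.1.2 - w.1.2) = q
      rw [show (z.1.1 + 1 - w.1.1 : ℝ) + (z.1.2 - w.1.2) = p + 1 by rw [← hp]; ring,
        show (z.1.1 + 1 - w.1.1 : ℝ) - (z.1.2 - w.1.2) = q + 1 by rw [← hq]; ring,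
        show (z.1.1 - 1 - w.1.1 : ℝ) + (z.1.2 - w.1.2) = p - 1 by rw [← hp]; ring,
        show (z.1.1 - 1 - w.1.1 : ℝ) - (z.1.2 - w.1.2) = q - 1 by rw [← hq]; ring,
        show (z.1.1 - w.1.1 : ℝ) + (z.1.2 + 1 - w.1.2) = p + 1 by rw [← hp]; ring,
        show (z.1.1 - w.1.1 : ℝ) - (z.1.2 + 1 - w.1.2) = q - 1 by rw [← hq]; ring,
        show (z.1.1 - w.1.1 : ℝ) + (z.1.2 - 1 - w.1.2) = p - 1 by rw [← hp]; ring,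
        show (z.1.1 - w.1.1 : ℝ) - (z.1.2 - 1 - w.1.2) = q + 1 by rw [← hq]; ring]
      simp only [mul_add, mul_sub, mul_one, Real.cosh_add, Real.cosh_sub]
      ring
    · exact absurd hz (lt_irrefl _)
    · exact absurd hz (lt_irrefl _)
  · intro z hz
    rcases z with z | _ | n <;> exact absurd hz (lt_irrefl _)
  · rintro (z | _ | n) hz
    · exact absurd hz (lt_irrefl _)
    · refine absurd hz (not_lt.mpr ?_)
      rw [height_darn, mul_zero, Real.cosh_zero, mul_one]
      refine le_trans (le_of_eq ?_) (exp_abs_le_two_mul_cosh _)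
      rw [zero_sub, mul_neg, abs_neg, abs_of_nonneg (mul_nonneg hβ (Nat.cast_nonneg _))]
      rfl
    · refine sum_cond_mul_half_le (le_of_eq ?_)
      rw [← line_coe n, nearBarrier_half_line, nearBarrier_half_line, nearBarrier_half_line,
        Nat.cast_pred n.pos, Nat.cast_add, Nat.cast_one,
        show ((n : ℕ) + 1 - (b : ℕ) : ℝ) = ((n : ℕ) - (b : ℕ)) + 1 by ring,
        show ((n : ℕ) - 1 - (b : ℕ) : ℝ) = ((n : ℕ) - (b : ℕ)) - 1 by ring,
        mul_add, mul_sub _ _ (1 : ℝ), mul_one, Real.cosh_add, Real.cosh_sub]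
      ring

theorem barrier_self_le (β : ℝ) (x y : Vertex ε k) : barrier β x y x ≤ 4 := by
  rcases x with w | _ | b
  · refine (min_le_left _ _).trans (le_of_eq ?_)
    simp only [nearBarrier, sub_self, add_zero, mul_zero, Real.cosh_zero]
    norm_num
  · refine (min_le_right _ _).trans ?_
    rw [height_darn]
    simp only [level, mul_zero, Real.cosh_zero, Real.exp_zero]
    norm_num
  · refine (min_le_left _ _).trans ?_
    simp only [nearBarrier, sub_self, mul_zero, Real.cosh_zero]
    norm_num

/-- The exponent `a` measures the growth from `x` to `z`. If the far term is the minimum, `a` counts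
the descent to the darning point plus the height towards `y`. Otherwise `a` is a distance within the
component of `x`, which bounds both the graph distance and the drop from `level x` to `height x z`.
-/
theorem exists_le_barrier {β : ℝ} (hβ : 0 ≤ β) (x y z : Vertex ε k) :
    ∃ a : ℝ, 1 / 2 * Real.exp (β * a) ≤ barrier β x y z ∧
      (a = level x + height y z ∨
        ((graph ε k).dist x z : ℝ) ≤ a ∧ level x ≤ height x z + a) := by
  have hfar : 1 / 2 * Real.exp (β * (level x + height y z)) ≤
      Real.exp (β * level x) * Real.cosh (β * height y z) := by
    rw [mul_add, Real.exp_add, mul_left_comm]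
    refine mul_le_mul_of_nonneg_left ?_ (Real.exp_pos _).le
    have h := half_exp_abs_le_cosh (β * height y z)
    rwa [abs_of_nonneg (mul_nonneg hβ (height_nonneg y z))] at h
  rcases lt_or_ge (nearBarrier β x y z)
    (Real.exp (β * level x) * Real.cosh (β * height y z)) with h | h
  · rw [barrier, min_eq_left h.le]
    rcases x with w | _ | b
    · rcases z with z | _ | n
      · refine ⟨gridDist w.1 z.1, ?_, Or.inr ⟨?_, ?_⟩⟩
        · linarith [exp_gridDist_le_nearBarrier hβ w z y, Real.exp_pos (β * gridDist w.1 z.1)]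
        · rw [← proj_coe w, ← proj_coe z]
          exact_mod_cast dist_proj_le w.1 z.1
        · have h1 := directional_le_add w.1 w.1 z.1
          rw [directional_self] at h1
          have h2 := le_max_left (directional w.1 z.1 - ε / mesh k - 1) 0
          simp only [level, height]
          linarith
      · exact absurd h (lt_irrefl _)
      · exact absurd h (lt_irrefl _)
    · rcases z with z | _ | n <;> exact absurd h (lt_irrefl _)
    · have hl : ∀ j : ℕ, ∃ a : ℝ, 1 / 2 * Real.exp (β * a) ≤
          nearBarrier β (half b) y (line ε k j) ∧
          (a = level (half b : Vertex ε k) + height y (line ε k j) ∨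
            ((graph ε k).dist (half b) (line ε k j) : ℝ) ≤ a ∧
            level (half b : Vertex ε k) ≤ height (half b) (line ε k j) + a) := by
        intro j
        refine ⟨|(j : ℝ) - (b : ℕ)|, ?_, Or.inr ⟨?_, ?_⟩⟩
        · rw [nearBarrier_half_line]
          have := exp_abs_le_two_mul_cosh (β * ((j : ℝ) - (b : ℕ)))
          rw [abs_mul, abs_of_nonneg hβ] at this
          linarith [Real.exp_pos (β * |(j : ℝ) - (b : ℕ)|)]
        · rw [← line_coe b, SimpleGraph.dist_comm]
          refine (Nat.cast_le.mpr (dist_line_le j b)).trans (le_of_eq ?_)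
          rw [Nat.cast_natAbs]
          push_cast
          rfl
        · rw [height_half_line]
          simp only [level]
          linarith [neg_abs_le ((j : ℝ) - (b : ℕ))]
      rcases z with z | _ | n
      · exact absurd h (lt_irrefl _)
      · exact hl 0
      · rw [← line_coe n]
        exact hl n
  · rw [barrier, min_eq_right h]
    exact ⟨_, hfar, Or.inl rfl⟩

theorem dist_darn_le (hε : 0 < ε) (x : Vertex ε k) :
    ((graph ε k).dist x darn : ℝ) ≤ √2 * level x + (√2 + 2) := by
  have h2 : 1 ≤ √2 := Real.one_le_sqrt.mpr one_le_two
  rcases x with z | _ | n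
  · have := dist_plane_darn_le hε z
    simp only [level]
    linarith
  · simp only [SimpleGraph.dist_self, level]
    norm_num
    linarith
  · rw [← line_coe n]
    have h := dist_line_le (ε := ε) (k := k) n 0
    have h' : ((graph ε k).dist (line ε k n) darn : ℝ) ≤ (n : ℕ) := by
      have : ((graph ε k).dist (line ε k n) darn) ≤ (n : ℕ) := by
        simpa using (show (graph ε k).dist (line ε k n) darn ≤ _ from h)
      exact_mod_cast this
    rw [line_coe] at h' ⊢
    simp only [level]
    nlinarith [(Nat.cast_nonneg (n : ℕ) : (0 : ℝ) ≤ (n : ℕ))]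

/-- Route from `x` to `y` through the darning point. The slope `7/10` is just below `1/√2`, the loss
between `ℓ¹` and Euclidean length, and `5` absorbs the rounding. -/
theorem le_level_add_level (hε : 0 < ε) (x y : Vertex ε k) :
    7 / 10 * ((graph ε k).dist x y : ℝ) - 5 ≤ level x + level y := by
  have h1 : ((graph ε k).dist x y : ℝ) ≤
      (graph ε k).dist x darn + (graph ε k).dist darn y := by
    exact_mod_cast (graph_connected hε k).dist_triangle
  rw [SimpleGraph.dist_comm (u := darn)] at h1
  have h2 := dist_darn_le hε x
  have h3 := dist_darn_le hε y
  have hs : √2 * √2 = 2 := Real.mul_self_sqrt zero_le_two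
  have hs1 : √2 ≤ 10 / 7 := Real.sqrt_le_iff.mpr ⟨by norm_num, by norm_num⟩
  have hs2 : 4 / 3 ≤ √2 := Real.le_sqrt_of_sq_le (by norm_num)
  have hN : (0 : ℝ) ≤ (graph ε k).dist x y := Nat.cast_nonneg _
  generalize ((graph ε k).dist x y : ℝ) = N at *
  have h4 : N ≤ √2 * (level x + level y + 2) + 4 := by linarith
  by_contra! h5
  nlinarith

theorem le_barrier_add_barrier (hε : 0 < ε) {β : ℝ} (hβ : 0 ≤ β) (x y z : Vertex ε k) :
    1 / 2 * Real.exp (β * ((7 / 10 * ((graph ε k).dist x y : ℝ) - 5) / 2)) ≤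
      barrier β x y z + barrier β y x z := by
  obtain ⟨a, ha, ha'⟩ := exists_le_barrier hβ x y z
  obtain ⟨b, hb, hb'⟩ := exists_le_barrier hβ y x z
  have hL := le_level_add_level hε x y
  have hN : (0 : ℝ) ≤ (graph ε k).dist x y := Nat.cast_nonneg _
  -- If at least one barrier is in its far regime, the heights combine to give at least `level x +
  -- level y`; if both are near, the triangle inequality through `z` gives the full distance. The
  -- larger exponent is then at least half of the total.
  have hab : 7 / 10 * ((graph ε k).dist x y : ℝ) - 5 ≤ a + b := by
    have hx := height_nonneg x z
    have hy := height_nonneg y z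
    rcases ha' with rfl | ⟨ha1, ha2⟩ <;> rcases hb' with rfl | ⟨hb1, hb2⟩
    · linarith
    · linarith
    · linarith
    · have h1 : ((graph ε k).dist x y : ℝ) ≤ (graph ε k).dist x z + (graph ε k).dist z y := by
        exact_mod_cast (graph_connected hε k).dist_triangle
      rw [SimpleGraph.dist_comm (u := z)] at h1
      linarith
  have hpa := Real.exp_pos (β * a)
  have hpb := Real.exp_pos (β * b)
  rcases le_total a b with h | h
  · have := Real.exp_le_exp.mpr (mul_le_mul_of_nonneg_left
      (show (7 / 10 * ((graph ε k).dist x y : ℝ) - 5) / 2 ≤ b by linarith) hβ)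
    linarith
  · have := Real.exp_le_exp.mpr (mul_le_mul_of_nonneg_left
      (show (7 / 10 * ((graph ε k).dist x y : ℝ) - 5) / 2 ≤ a by linarith) hβ)
    linarith

/-! ## The off-diagonal upper bound -/

/-- Insert `M ≤ φ + ψ` under the integral of `f g`. The part with `φ` keeps `f` and bounds `g` by
`B`; the part with `ψ` does the opposite. -/
theorem inner_le_of_weight_le {f g : L2 ε k} (hf : ∀ x, 0 ≤ f x) (hg : ∀ x, 0 ≤ g x)
    {φ ψ : Vertex ε k → ℝ} (hφ : ∀ x, 0 ≤ φ x) (hψ : ∀ x, 0 ≤ ψ x) {B M a b : ℝ} (hB : 0 ≤ B)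
    (hfB : ∀ x, f x ≤ B) (hgB : ∀ x, g x ≤ B) (hM : 0 < M) (hφψ : ∀ x, M ≤ φ x + ψ x)
    (ha : 0 ≤ a) (hb : 0 ≤ b) (hwf : weight φ f ≤ ENNReal.ofReal a)
    (hwg : weight ψ g ≤ ENNReal.ofReal b) : inner ℝ f g ≤ B * (a + b) / M := by
  rw [le_div_iff₀' hM]
  refine (ENNReal.ofReal_le_ofReal_iff (by positivity)).mp ?_
  rw [ENNReal.ofReal_mul hM.le, ofReal_inner_eq_tsum hf hg, ENNReal.ofReal_mul hB,
    ENNReal.ofReal_add ha hb, ← ENNReal.tsum_mul_left]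
  refine le_trans ?_ (mul_le_mul_right (add_le_add hwf hwg) _)
  rw [weight, weight, ← ENNReal.tsum_add, ← ENNReal.tsum_mul_left]
  refine ENNReal.tsum_le_tsum fun x => ?_
  have hm := (mass_pos x).le
  have hfx := hf x
  have hgx := hg x
  have hφx := hφ x
  have hψx := hψ x
  rw [← ENNReal.ofReal_mul hfx, ← ENNReal.ofReal_mul (by positivity), ← ENNReal.ofReal_mul hM.le,
    ← ENNReal.ofReal_mul hfx, ← ENNReal.ofReal_mul hgx,
    ← ENNReal.ofReal_add (by positivity) (by positivity), ← ENNReal.ofReal_mul hB]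
  refine ENNReal.ofReal_le_ofReal ?_
  calc M * (f x * g x * mass x) ≤ (φ x + ψ x) * (f x * g x * mass x) :=
        mul_le_mul_of_nonneg_right (hφψ x) (by positivity)
    _ = g x * (f x * (φ x * mass x)) + f x * (g x * (ψ x * mass x)) := by ring
    _ ≤ B * (f x * (φ x * mass x)) + B * (g x * (ψ x * mass x)) :=
        add_le_add (mul_le_mul_of_nonneg_right (hgB x) (by positivity))
          (mul_le_mul_of_nonneg_right (hfB x) (by positivity))
    _ = _ := by ring

/-- The off-diagonal bound with a free parameter `β`. -/
theorem heatKernel_le_mul_exp (hε : 0 < ε) {t : ℝ} (ht : 0 < t) {β : ℝ} (hβ : 0 ≤ β)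
    (x y : Vertex ε k) :
    heatKernel t x y ≤ 64 * (256 * 19 ^ 3) * max (1 / t) (1 / √t) *
      Real.exp (4 ^ k * t / 2 * (Real.cosh β - 1) -
        β * ((7 / 10 * ((graph ε k).dist x y : ℝ) - 5) / 2)) := by
  have ht2 : 0 < t / 2 := half_pos ht
  set B := 2 * (256 * 19 ^ 3) * max (1 / (t / 2)) (1 / √(t / 2)) with hB
  set D := (7 / 10 * ((graph ε k).dist x y : ℝ) - 5) / 2 with hD
  set e := Real.exp (4 ^ k * (t / 2) * (Real.cosh β - 1)) with he
  have he0 : 0 < e := Real.exp_pos _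
  have hB0 : 0 ≤ B := by positivity
  have hbound : ∀ x z : Vertex ε k, semigroup ε k (t / 2) (deltaL2 x) z ≤ B := fun x z => by
    rw [← heatKernel_eq]
    exact heatKernel_le ht2 z x
  have hweight : ∀ x y : Vertex ε k,
      weight (barrier β x y) (semigroup ε k (t / 2) (deltaL2 x)) ≤ ENNReal.ofReal (e * 4) := by
    intro x y
    refine (weight_semigroup_le (isSuper_barrier hβ x y) (Real.cosh_pos β).le ht2.le
      (deltaL2_nonneg x)).trans ?_
    rw [weight_deltaL2, ← ENNReal.ofReal_mul he0.le]
    exact ENNReal.ofReal_le_ofReal (mul_le_mul_of_nonneg_left (barrier_self_le β x y) he0.le)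
  have h1 := inner_le_of_weight_le (semigroup_nonneg ht2.le (deltaL2_nonneg x))
    (semigroup_nonneg ht2.le (deltaL2_nonneg y)) (isSuper_barrier hβ x y).nonneg
    (isSuper_barrier hβ y x).nonneg hB0 (hbound x) (hbound y)
    (M := 1 / 2 * Real.exp (β * D)) (by positivity) (le_barrier_add_barrier hε hβ x y)
    (by positivity) (by positivity) (hweight x y) (hweight y x)
  rw [← heatKernel_eq_inner, add_halves] at h1
  refine h1.trans ?_
  have h2 : B ≤ 4 * (256 * 19 ^ 3) * max (1 / t) (1 / √t) := by
    have := max_one_div_half_le ht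
    rw [hB]
    linarith
  rw [Real.exp_sub, show 4 ^ k * t / 2 * (Real.cosh β - 1) =
    4 ^ k * (t / 2) * (Real.cosh β - 1) by ring, ← he,
    show B * (e * 4 + e * 4) / (1 / 2 * Real.exp (β * D)) = 16 * B * (e / Real.exp (β * D)) by
      field_simp; ring]
  refine mul_le_mul_of_nonneg_right ?_ (by positivity)
  linarith

/-! ### Choice of the parameter `β` in the two regimes -/

theorem cosh_le_one_add {β : ℝ} (h0 : 0 ≤ β) (h2 : β ≤ 2) :
    Real.cosh β ≤ 1 + 3 / 2 * β ^ 2 := by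
  -- The quadratic estimate for `exp` needs an argument of modulus at most `1`; the double-angle
  -- formula then reaches `β = 2`.
  have key : Real.cosh (β / 2) ≤ 1 + (β / 2) ^ 2 := by
    have ha : |β / 2| ≤ 1 := by rw [abs_of_nonneg (by linarith)]; linarith
    have h3 := (abs_le.mp (Real.abs_exp_sub_one_sub_id_le ha)).2
    have h4 := (abs_le.mp (Real.abs_exp_sub_one_sub_id_le (x := -(β / 2)) (by rwa [abs_neg]))).2
    rw [Real.cosh_eq]
    linarith [neg_sq (β / 2)]
  have h5 : Real.cosh β = 2 * Real.cosh (β / 2) ^ 2 - 1 := by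
    have h6 := Real.cosh_two_mul (β / 2)
    have h7 := Real.cosh_sq (β / 2)
    rw [mul_div_cancel₀ β two_ne_zero] at h6
    linarith
  have h8 := pow_le_pow_left₀ (Real.cosh_pos (β / 2)).le key 2
  rw [h5]
  nlinarith [mul_nonneg (sq_nonneg β) (show 0 ≤ 4 - β ^ 2 by nlinarith)]

theorem graphDist_sq_div (x y : Vertex ε k) (t : ℝ) :
    graphDist x y ^ 2 / (32 * t) = ((graph ε k).dist x y : ℝ) ^ 2 / (32 * (4 ^ k * t)) := by
  have h : mesh k ^ 2 = 1 / 4 ^ k := by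
    rw [eq_div_iff (by positivity)]
    exact mesh_sq_mul_four_pow k
  rw [graphDist, mul_pow, h, div_mul_eq_mul_div, one_mul, div_div]
  congr 1
  ring

theorem two_pow_mul_graphDist (x y : Vertex ε k) :
    2 ^ k * graphDist x y = (graph ε k).dist x y := by
  rw [graphDist, ← mul_assoc, mul_comm _ (mesh k), mesh_mul_two_pow, one_mul]

theorem two_pow_mul_two_pow (k : ℕ) : (2 : ℝ) ^ k * 2 ^ k = 4 ^ k := by
  rw [← mul_pow]; norm_num

/-- The constant in the heat kernel upper bound. -/
noncomputable def upperConst : ℝ := 64 * (256 * 19 ^ 3) * Real.exp 5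

theorem upperConst_pos : 0 < upperConst := by unfold upperConst; positivity

/-- The additive loss in the distance contributes `5β/2` to the exponent, at most `5` when `β ≤ 2`;
it goes into the factor `exp 5` of the constant. -/
theorem heatKernel_le_of_exponent_le (hε : 0 < ε) {t : ℝ} (ht : 0 < t) {β a : ℝ} (hβ : 0 ≤ β)
    (x y : Vertex ε k) (h : 4 ^ k * t / 2 * (Real.cosh β - 1) -
      β * ((7 / 10 * ((graph ε k).dist x y : ℝ) - 5) / 2) ≤ 5 + a) :
    heatKernel t x y ≤ upperConst * max (1 / t) (1 / √t) * Real.exp a := by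
  refine (heatKernel_le_mul_exp hε ht hβ x y).trans ?_
  have h1 := Real.exp_le_exp.mpr h
  rw [Real.exp_add] at h1
  calc _ ≤ 64 * (256 * 19 ^ 3) * max (1 / t) (1 / √t) * (Real.exp 5 * Real.exp a) :=
        mul_le_mul_of_nonneg_left h1 (by positivity)
    _ = _ := by rw [upperConst]; ring

/-- Put `l = 4^k t` and `β = N / (8 l)`, which is at most `2` in this regime. Then `N²/(32 l) = 2 l
β²`, while the exponent is at most `(3/4 - 14/5) l β² + 5β/2`, and `14/5 - 3/4` exceeds `2`. -/
theorem heatKernel_le_gaussian (hε : 0 < ε) {t : ℝ} (ht : 0 < t) (x y : Vertex ε k)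
    (h : graphDist x y ≤ 16 * 2 ^ k * t) :
    heatKernel t x y ≤ upperConst * max (1 / t) (1 / √t) *
      Real.exp (-(graphDist x y) ^ 2 / (32 * t)) := by
  have hl : 0 < 4 ^ k * t := by positivity
  rw [neg_div, graphDist_sq_div]
  have hN : (0 : ℝ) ≤ (graph ε k).dist x y := Nat.cast_nonneg _
  have hNl : ((graph ε k).dist x y : ℝ) ≤ 16 * (4 ^ k * t) := by
    rw [← two_pow_mul_graphDist, ← two_pow_mul_two_pow]
    have := mul_le_mul_of_nonneg_left h (show (0 : ℝ) ≤ 2 ^ k by positivity)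
    linarith
  refine heatKernel_le_of_exponent_le hε ht
    (β := ((graph ε k).dist x y : ℝ) / (8 * (4 ^ k * t))) (by positivity) x y ?_
  generalize ((graph ε k).dist x y : ℝ) = N at *
  generalize 4 ^ k * t = l at *
  obtain ⟨β, hβ⟩ : ∃ β, β = N / (8 * l) := ⟨_, rfl⟩
  have hβ0 : 0 ≤ β := by rw [hβ]; positivity
  have hNβ : N = 8 * l * β := by rw [hβ]; field_simp
  have hβ2 : β ≤ 2 := by
    rw [hβ, div_le_iff₀ (by positivity)]
    linarith
  rw [← hβ, show N ^ 2 / (32 * l) = 2 * l * β ^ 2 by rw [hNβ]; field_simp; ring, hNβ]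
  have hcosh := cosh_le_one_add hβ0 hβ2
  have h1 := mul_le_mul_of_nonneg_left hcosh (half_pos hl).le
  nlinarith [mul_nonneg hl.le (sq_nonneg β)]

/-- With `β = 2` and `l = 4^k t` the exponent is at most `3 l - 7N/10 + 5`, and `16 l ≤ N` makes `3
l` smaller than the spare `N/5`. -/
theorem heatKernel_le_exponential (hε : 0 < ε) {t : ℝ} (ht : 0 < t) (x y : Vertex ε k)
    (h : 16 * 2 ^ k * t ≤ graphDist x y) :
    heatKernel t x y ≤ upperConst * max (1 / t) (1 / √t) *
      Real.exp (-(2 ^ k * graphDist x y) / 2) := by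
  have hl : 0 < 4 ^ k * t := by positivity
  rw [two_pow_mul_graphDist]
  have hNl : 16 * (4 ^ k * t) ≤ ((graph ε k).dist x y : ℝ) := by
    rw [← two_pow_mul_graphDist, ← two_pow_mul_two_pow]
    have := mul_le_mul_of_nonneg_left h (show (0 : ℝ) ≤ 2 ^ k by positivity)
    linarith
  refine heatKernel_le_of_exponent_le hε ht zero_le_two x y ?_
  generalize ((graph ε k).dist x y : ℝ) = N at *
  generalize 4 ^ k * t = l at *
  have h1 := mul_le_mul_of_nonneg_left (cosh_le_one_add zero_le_two le_rfl) (half_pos hl).le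
  linarith

/-! ### Bounded time intervals -/

theorem max_one_div_le {t T : ℝ} (ht : 0 < t) (htT : t ≤ T) :
    max (1 / t) (1 / √t) ≤ (1 + √T) / t := by
  have hst : 0 < √t := Real.sqrt_pos.mpr ht
  refine max_le ?_ ?_
  · exact div_le_div_of_nonneg_right (by linarith [Real.sqrt_nonneg T]) ht.le
  · rw [div_le_div_iff₀ hst ht, one_mul]
    have h1 := Real.sqrt_le_sqrt htT
    have h2 := Real.mul_self_sqrt ht.le
    nlinarith

theorem heatKernel_le_div (hε : 0 < ε) {t T : ℝ} (ht : 0 < t) (htT : t ≤ T) (x y : Vertex ε k) :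
    heatKernel t x y ≤ upperConst * (1 + √T) / t * (Real.exp (-(graphDist x y) ^ 2 / (32 * t)) +
      Real.exp (-(2 ^ k * graphDist x y) / 2)) := by
  have hC := upperConst_pos
  have hmax := max_one_div_le ht htT
  have h1 : upperConst * max (1 / t) (1 / √t) ≤ upperConst * (1 + √T) / t := by
    rw [mul_div_assoc]
    exact mul_le_mul_of_nonneg_left hmax hC.le
  have h2 : 0 ≤ upperConst * (1 + √T) / t := by positivity
  rcases le_total (graphDist x y) (16 * 2 ^ k * t) with h | h
  · exact (heatKernel_le_gaussian hε ht x y h).trans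
      (mul_le_mul h1 (le_add_of_nonneg_right (Real.exp_pos _).le) (Real.exp_pos _).le h2)
  · exact (heatKernel_le_exponential hε ht x y h).trans
      (mul_le_mul h1 (le_add_of_nonneg_left (Real.exp_pos _).le) (Real.exp_pos _).le h2)

end VaryingDim

theorem corollary3p4 (ε : ℝ) (hε₀ : 0 < ε) (hε₁ : ε < 1 / 64) (k₀ : ℕ)
    (hk₀ : ∀ k : ℕ, k₀ ≤ k → VaryingDim.mesh k < ε / 4) :
    (∃ C₃ : ℝ, 0 < C₃ ∧ ∀ k : ℕ, k₀ ≤ k → ∀ (x y : VaryingDim.Vertex ε k) (t : ℝ), 0 < t →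
      (VaryingDim.graphDist x y ≤ 16 * 2 ^ k * t →
        VaryingDim.heatKernel t x y ≤
          C₃ * max (1 / t) (1 / √t) * Real.exp (-(VaryingDim.graphDist x y) ^ 2 / (32 * t))) ∧
      (16 * 2 ^ k * t ≤ VaryingDim.graphDist x y →
        VaryingDim.heatKernel t x y ≤
          C₃ * max (1 / t) (1 / √t) * Real.exp (-(2 ^ k * VaryingDim.graphDist x y) / 2))) ∧
    (∀ T : ℝ, 0 < T → ∃ C₄ : ℝ, 0 < C₄ ∧ ∀ k : ℕ, k₀ ≤ k →
      ∀ (t : ℝ), 0 < t → t ≤ T → ∀ x y : VaryingDim.Vertex ε k,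
        VaryingDim.heatKernel t x y ≤
          C₄ / t * (Real.exp (-(VaryingDim.graphDist x y) ^ 2 / (32 * t)) +
            Real.exp (-(2 ^ k * VaryingDim.graphDist x y) / 2))) := by
  refine ⟨⟨VaryingDim.upperConst, VaryingDim.upperConst_pos, fun k _ x y t ht =>
    ⟨VaryingDim.heatKernel_le_gaussian hε₀ ht x y,
      VaryingDim.heatKernel_le_exponential hε₀ ht x y⟩⟩, fun T _ =>
    ⟨VaryingDim.upperConst * (1 + √T), mul_pos VaryingDim.upperConst_pos (by positivity),
      fun k _ t ht htT x y => VaryingDim.heatKernel_le_div hε₀ ht htT x y⟩⟩
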